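/- **Theorem.** Let $n$ be a natural number. All germs are at the origin of $\mathbb R^n$, and $x=(x_1,\dots,x_n)^t$. For an $n$-tuple of vector fields $V_1,\dots,V_n$ on $\mathbb R^n$, the associated matrix is the $n\times n$ matrix whose $k$-th column consists of the coefficients of $V_k$. A local analytic diffeomorphism is the germ of an analytic map $\Phi:(\mathbb R^n,0)\to(\mathbb R^n,0)$ with $\Phi(0)=0$ that has an analytic local inverse. 1. Let $V_1,\dots,V_n$ be germs of analytic vector fields that are linearly independent at each point. Then there is a local analytic diffeomorphism $\Phi$ such that the matrix associated with the tuple $\Phi_*V_1,\dots,\Phi_*V_n$ is $I+M(x)$, where $M$ is a matrix of analytic function germs with $$M(x)\cdot x\equiv 0 .$$ 2. Let $g$ be a germ of analytic Riemannian metrics on $\mathbb R^n$. Then there is a local analytic diffeomorphism $\Phi$ such that the transformed metric $\Phi_*g=(\Phi^{-1})^*g$ has an analytic orthonormal frame whose associated matrix is $I+M(x)$, where $M$ is a matrix of analytic function germs with $$M(x)\cdot x\equiv 0,\qquad M^t(x)\equiv M(x).$$ 3. Let a germ of analytic conformal structures on $\mathbb R^n$ be given, that is, the class $[g]$ of a germ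 $g$ of analytic Riemannian metrics up to multiplication by positive analytic function germs. Then there is a local analytic diffeomorphism $\Phi$ such that some metric in the transformed class $[\Phi_*g]$ has an analytic orthonormal frame whose associated matrix is $I+M(x)$, where $M$ is a matrix of analytic function germs with $$M(x)\cdot x\equiv 0,\qquad M^t(x)\equiv M(x),\qquad \operatorname{trace} M(x)\equiv 0 .$$ -/

import Mathlib

open Filter Topology

namespace AnalyticNormalForm

/-- The coordinate space `ℝⁿ`. Germs at the origin are represented by functions on `ℝⁿ`, of which
only the values near `0` matter. -/
abbrev Coord (n : ℕ) : Type := Fin n → ℝ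

/-- `Φ` represents the germ of a local analytic diffeomorphism `(ℝⁿ, 0) → (ℝⁿ, 0)`. -/
def IsLocalAnalyticDiffeo {n : ℕ} (Φ : Coord n → Coord n) : Prop :=
  AnalyticAt ℝ Φ 0 ∧ Φ 0 = 0 ∧
    ∃ Ψ : Coord n → Coord n, AnalyticAt ℝ Ψ 0 ∧ Ψ 0 = 0 ∧
      (∀ᶠ x in 𝓝 0, Ψ (Φ x) = x) ∧ (∀ᶠ y in 𝓝 0, Φ (Ψ y) = y)

/-- `V 0, …, V (n-1)` is an `n`-tuple of germs at `0` of analytic vector fields on `ℝⁿ` which are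
linearly independent at every point. -/
structure IsFrameGerm {n : ℕ} (V : Fin n → Coord n → Coord n) : Prop where
  analytic : ∀ k, AnalyticAt ℝ (V k) 0
  linearIndependent : ∀ᶠ x in 𝓝 (0 : Coord n), LinearIndependent ℝ (fun k => V k x)

/-- `g` represents a germ at `0` of analytic Riemannian metrics on `ℝⁿ`; `g x u v` is the scalar
product at the point `x` of the tangent vectors `u` and `v`. -/
structure IsMetricGerm {n : ℕ} (g : Coord n → Coord n →L[ℝ] Coord n →L[ℝ] ℝ) : Prop where
  analytic : AnalyticAt ℝ g 0
  symm : ∀ᶠ x in 𝓝 (0 : Coord n), ∀ u v, g x u v = g x v u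
  pos : ∀ᶠ x in 𝓝 (0 : Coord n), ∀ v, v ≠ 0 → 0 < g x v v

/-- Two metric germs define the same germ of analytic conformal structures: they differ by a
positive analytic factor. -/
def ConformallyEquivalent {n : ℕ} (g g' : Coord n → Coord n →L[ℝ] Coord n →L[ℝ] ℝ) : Prop :=
  ∃ c : Coord n → ℝ, AnalyticAt ℝ c 0 ∧ (∀ᶠ x in 𝓝 0, 0 < c x) ∧ ∀ᶠ x in 𝓝 0, g' x = c x • g x

/-- The local diffeomorphism `Φ` brings the tuple of vector fields `V` to `W`, i.e. `Φ_* V = W`. -/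
def TransformsFrame {n : ℕ} (Φ : Coord n → Coord n) (V W : Fin n → Coord n → Coord n) : Prop :=
  ∀ᶠ x in 𝓝 (0 : Coord n), ∀ k, fderiv ℝ Φ x (V k x) = W k (Φ x)

/-- The local diffeomorphism `Φ` brings the metric `g` to `g'`, i.e. `Φ^* g' = g`. -/
def TransformsMetric {n : ℕ} (Φ : Coord n → Coord n)
    (g g' : Coord n → Coord n →L[ℝ] Coord n →L[ℝ] ℝ) : Prop :=
  ∀ᶠ x in 𝓝 (0 : Coord n), ∀ u v,
    g' (Φ x) (fderiv ℝ Φ x u) (fderiv ℝ Φ x v) = g x u v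

/-- `W` is an orthonormal frame of the metric `g`. -/
def IsOrthonormalFrame {n : ℕ} (g : Coord n → Coord n →L[ℝ] Coord n →L[ℝ] ℝ)
    (W : Fin n → Coord n → Coord n) : Prop :=
  ∀ᶠ x in 𝓝 (0 : Coord n), ∀ i j, g x (W i x) (W j x) = if i = j then 1 else 0

/-- The matrix whose `k`-th column consists of the coefficients of the `k`-th vector field. -/
def associatedMatrix {n : ℕ} (W : Fin n → Coord n → Coord n) (x : Coord n) :
    Matrix (Fin n) (Fin n) ℝ :=
  Matrix.of fun i k => W k x i

/-- `M` is a matrix of germs at `0` of analytic functions. -/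
def IsAnalyticMatrixGerm {n : ℕ} (M : Coord n → Matrix (Fin n) (Fin n) ℝ) : Prop :=
  ∀ i j, AnalyticAt ℝ (fun x => M x i j) 0

/-- The analytic frame `W` has the associated matrix `I + M(x)`, where `M` is an analytic matrix
germ with `M(x) · x ≡ 0`. -/
structure HasNormalMatrix {n : ℕ} (W : Fin n → Coord n → Coord n)
    (M : Coord n → Matrix (Fin n) (Fin n) ℝ) : Prop where
  frame : IsFrameGerm W
  analytic : IsAnalyticMatrixGerm M
  matrix_eq : ∀ᶠ x in 𝓝 (0 : Coord n), associatedMatrix W x = 1 + M x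
  mulVec_eq : ∀ᶠ x in 𝓝 (0 : Coord n), (M x).mulVec x = 0

end AnalyticNormalForm

/-! All three normal forms come from solving a nonlinear equation for a map `Φ = x + X(x)` close to
the identity. After a linear change of coordinates the frame matrix (for a metric: the inverse of
its matrix) is `1 + η` with `η(0) = 0`, and a dilation makes `η` as small as desired. For a frame
the equation is `(1 + DX)(1 + η)Φ = Φ`. For a metric one seeks a symmetric `s` with `(1 + s)² = (1 +
DX)(1 + η)(1 + DX)ᵗ` and `sΦ = κ tr(s) Φ`. Read in the coordinates `y = Φ(x)`, the matrix `1 + s` is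
an orthonormal frame; `κ = 0` gives `M(y)y = 0`, and for `κ = 1/n` division of `1 + s` by the mean
of its diagonal gives the trace-free form for a conformal multiple of the metric.

The linearized equation, contracted with `x`, is `(x·∇)X = f` for frames and `½(DX + DXᵗ)x − κ x div
X = f` for metrics. These operators preserve the degree, and on homogeneous polynomials of degree
`k` Euler's identity solves them with a solution of size `O(1/k)`. This gain pays for the derivative
in `DX`, so nothing is lost and the open mapping property of strictly differentiable maps with
surjective derivative suffices (`exists_normal_frame`, `exists_normal_sym`). The Banach space is the
algebra `PSeries` of power series whose homogeneous parts have summable Bombieri norms. That norm is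
submultiplicative, and up to a constant it makes multiplication by `xᵢ` adjoint to `∂ᵢ`.

The adjointness is what solves the trace-free case `exists_symOp_inv_eq`: eliminating `X` in favour
of its divergence leads to the operator `c + |x|²Δ` with `c = (n−2)(k−1)(k−2)`, where `|x|²Δ` is
nonnegative. Since `c` is positive only for `n ≥ 3` and `k ≥ 3`, the metric normal form is applied
first; a symmetric `M` with `M(x)x = 0` has no terms of degree less than two
(`vanishesToOrder_two`), so the remaining corrections start in degree three. For `n = 2` isothermal
coordinates are found instead, by the Cauchy–Kovalevskaya argument `exists_linear_system`, and for
`n ≤ 1` the trace vanishes anyway. -/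

namespace AnalyticNormalForm
open MvPowerSeries

/-! ### Convergent power series and the germs they represent -/

/-- The multi-indices of degree `k`. -/
noncomputable def degIdx (n k : ℕ) : Finset (Fin n →₀ ℕ) := Finset.finsuppAntidiag Finset.univ k

lemma mem_degIdx {n k : ℕ} {α : Fin n →₀ ℕ} : α ∈ degIdx n k ↔ α.degree = k := by
  simp [degIdx, Finsupp.degree_eq_sum]

/-- Multi-indices, sorted by their degree. -/
noncomputable def degEquiv (n : ℕ) : (Σ k, degIdx n k) ≃ (Fin n →₀ ℕ) where
  toFun p := p.2.1
  invFun α := ⟨α.degree, α, mem_degIdx.2 rfl⟩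
  left_inv := by
    rintro ⟨k, α, h⟩
    obtain rfl := mem_degIdx.1 h
    rfl
  right_inv _ := rfl

lemma hasSum_sum_degree {n : ℕ} {F : (Fin n →₀ ℕ) → ℝ} {s : ℝ} (h : HasSum F s) :
    HasSum (fun k => ∑ α ∈ degIdx n k, F α) s :=
  ((degEquiv n).hasSum_iff.2 h).sigma fun k => (degIdx n k).hasSum F

lemma summable_of_sum_degree {n : ℕ} {F : (Fin n →₀ ℕ) → ℝ} (hF : ∀ α, 0 ≤ F α)
    (h : Summable fun k => ∑ α ∈ degIdx n k, F α) : Summable F := by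
  rw [← (degEquiv n).summable_iff]
  refine (summable_sigma_of_nonneg fun _ => hF _).2 ⟨fun k => ((degIdx n k).hasSum F).summable, ?_⟩
  convert h using 2 with k
  exact ((degIdx n k).hasSum F).tsum_eq

/-- The monomial function `x ↦ x ^ α`. -/
def mono {n : ℕ} (α : Fin n →₀ ℕ) (x : Coord n) : ℝ := ∏ i, x i ^ α i

lemma mono_add {n : ℕ} (α β : Fin n →₀ ℕ) (x : Coord n) :
    mono (α + β) x = mono α x * mono β x := by
  simp [mono, pow_add, Finset.prod_mul_distrib]

lemma mono_zero {n : ℕ} (x : Coord n) : mono 0 x = 1 := by simp [mono]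

lemma mono_single {n : ℕ} (i : Fin n) (x : Coord n) : mono (Finsupp.single i 1) x = x i := by
  rw [mono, Finset.prod_eq_single i] <;> simp +contextual [eq_comm]

lemma mono_smul {n : ℕ} (α : Fin n →₀ ℕ) (c : ℝ) (x : Coord n) :
    mono α (c • x) = c ^ α.degree * mono α x := by
  simp [mono, mul_pow, Finset.prod_mul_distrib, Finset.prod_pow_eq_pow_sum, Finsupp.degree_eq_sum]

lemma mono_eq_zero {n : ℕ} {α : Fin n →₀ ℕ} (h : α ≠ 0) : mono α (0 : Coord n) = 0 := by
  obtain ⟨i, hi⟩ := Finsupp.ne_iff.1 h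
  exact Finset.prod_eq_zero (Finset.mem_univ i) (by simpa using hi)

lemma abs_mono_le {n : ℕ} (α : Fin n →₀ ℕ) {x : Coord n} {r : ℝ} (h : ‖x‖ ≤ r) :
    |mono α x| ≤ r ^ α.degree := by
  rw [mono, Finset.abs_prod, Finsupp.degree_eq_sum, ← Finset.prod_pow_eq_pow_sum]
  refine Finset.prod_le_prod (fun _ _ => abs_nonneg _) fun i _ => ?_
  rw [abs_pow]
  exact pow_le_pow_left₀ (abs_nonneg _) ((norm_le_pi_norm x i).trans h) _

/-- `f` is near the origin the sum of the convergent power series `a`. -/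
def HasGerm {n : ℕ} (f : Coord n → ℝ) (a : MvPowerSeries (Fin n) ℝ) : Prop :=
  ∃ r > 0, Summable (fun α => |coeff α a| * r ^ α.degree) ∧
    ∀ x, ‖x‖ < r → HasSum (fun α => coeff α a * mono α x) (f x)

/-- `a` is a convergent power series. -/
def IsConv {n : ℕ} (a : MvPowerSeries (Fin n) ℝ) : Prop :=
  ∃ r > 0, Summable (fun α => |coeff α a| * r ^ α.degree)

lemma summable_abs_mul_mono {n : ℕ} {a : MvPowerSeries (Fin n) ℝ} {r : ℝ}
    (h : Summable (fun α => |coeff α a| * r ^ α.degree)) {x : Coord n} (hx : ‖x‖ ≤ r) :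
    Summable fun α => ‖coeff α a * mono α x‖ := by
  refine h.of_nonneg_of_le (fun _ => norm_nonneg _) fun α => ?_
  rw [norm_mul]
  exact mul_le_mul_of_nonneg_left (abs_mono_le α hx) (abs_nonneg _)

lemma summable_of_radius_le {n : ℕ} {a : MvPowerSeries (Fin n) ℝ} {r s : ℝ} (hs : 0 ≤ s)
    (hsr : s ≤ r) (h : Summable (fun α => |coeff α a| * r ^ α.degree)) :
    Summable (fun α => |coeff α a| * s ^ α.degree) :=
  h.of_nonneg_of_le (fun _ => by positivity) fun α =>
    mul_le_mul_of_nonneg_left (pow_le_pow_left₀ hs hsr _) (abs_nonneg _)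

/-- The sum of a power series. -/
noncomputable def ev {n : ℕ} (a : MvPowerSeries (Fin n) ℝ) (x : Coord n) : ℝ :=
  ∑' α, coeff α a * mono α x

lemma IsConv.hasGerm_ev {n : ℕ} {a : MvPowerSeries (Fin n) ℝ} (h : IsConv a) :
    HasGerm (ev a) a := by
  obtain ⟨r, hr, h⟩ := h
  exact ⟨r, hr, h, fun x hx => (summable_abs_mul_mono h hx.le).of_norm.hasSum⟩

lemma HasGerm.isConv {n : ℕ} {f : Coord n → ℝ} {a : MvPowerSeries (Fin n) ℝ} (h : HasGerm f a) :
    IsConv a :=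
  let ⟨r, hr, h, _⟩ := h
  ⟨r, hr, h⟩

lemma HasGerm.shrink {n : ℕ} {f : Coord n → ℝ} {a : MvPowerSeries (Fin n) ℝ} (h : HasGerm f a) :
    ∃ R > 0, ∀ r, 0 < r → r ≤ R → Summable (fun α => |coeff α a| * r ^ α.degree) ∧
      ∀ x, ‖x‖ < r → HasSum (fun α => coeff α a * mono α x) (f x) := by
  obtain ⟨R, hR, h1, h2⟩ := h
  exact ⟨R, hR, fun r hr hrR => ⟨summable_of_radius_le hr.le hrR h1,
    fun x hx => h2 x (hx.trans_le hrR)⟩⟩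

lemma HasGerm.common {n : ℕ} {f g : Coord n → ℝ} {a b : MvPowerSeries (Fin n) ℝ}
    (hf : HasGerm f a) (hg : HasGerm g b) :
    ∃ r > 0, (Summable (fun α => |coeff α a| * r ^ α.degree) ∧
      ∀ x, ‖x‖ < r → HasSum (fun α => coeff α a * mono α x) (f x)) ∧
      (Summable (fun α => |coeff α b| * r ^ α.degree) ∧
      ∀ x, ‖x‖ < r → HasSum (fun α => coeff α b * mono α x) (g x)) := by
  obtain ⟨R, hR, h⟩ := hf.shrink
  obtain ⟨R', hR', h'⟩ := hg.shrink
  have : 0 < min R R' := lt_min hR hR'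
  exact ⟨min R R', this, h _ this (min_le_left _ _), h' _ this (min_le_right _ _)⟩

lemma HasGerm.congr {n : ℕ} {f g : Coord n → ℝ} {a : MvPowerSeries (Fin n) ℝ} (h : HasGerm f a)
    (hfg : f =ᶠ[𝓝 0] g) : HasGerm g a := by
  obtain ⟨R, hR, h⟩ := h.shrink
  obtain ⟨ε, hε, h'⟩ := Metric.eventually_nhds_iff.1 hfg
  have : 0 < min R ε := lt_min hR hε
  obtain ⟨h1, h2⟩ := h _ this (min_le_left _ _)
  refine ⟨_, this, h1, fun x hx => ?_⟩
  rw [← h' (by simpa using hx.trans_le (min_le_right _ _))]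
  exact h2 x hx

lemma HasGerm.eventually_hasSum {n : ℕ} {f : Coord n → ℝ} {a : MvPowerSeries (Fin n) ℝ}
    (h : HasGerm f a) : ∀ᶠ x in 𝓝 0, HasSum (fun α => coeff α a * mono α x) (f x) := by
  obtain ⟨R, hR, -, h⟩ := h
  filter_upwards [Metric.ball_mem_nhds 0 hR] with x hx using h x (by simpa using hx)

lemma HasGerm.unique {n : ℕ} {f g : Coord n → ℝ} {a : MvPowerSeries (Fin n) ℝ}
    (hf : HasGerm f a) (hg : HasGerm g a) : f =ᶠ[𝓝 0] g := by
  filter_upwards [hf.eventually_hasSum, hg.eventually_hasSum] with x h1 h2 using h1.unique h2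

lemma HasGerm.apply_zero {n : ℕ} {f : Coord n → ℝ} {a : MvPowerSeries (Fin n) ℝ}
    (h : HasGerm f a) : f 0 = coeff 0 a := by
  refine h.eventually_hasSum.self_of_nhds.unique ?_
  convert hasSum_single (0 : Fin n →₀ ℕ) fun α hα => ?_
  · simp [mono_zero]
  · rw [mono_eq_zero hα, mul_zero]

lemma HasGerm.add {n : ℕ} {f g : Coord n → ℝ} {a b : MvPowerSeries (Fin n) ℝ}
    (hf : HasGerm f a) (hg : HasGerm g b) : HasGerm (fun x => f x + g x) (a + b) := by
  obtain ⟨r, hr, ⟨h1, h2⟩, h3, h4⟩ := hf.common hg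
  refine ⟨r, hr, (h1.add h3).of_nonneg_of_le (fun _ => by positivity) fun α => ?_, fun x hx => ?_⟩
  · rw [map_add, ← add_mul]
    exact mul_le_mul_of_nonneg_right (abs_add_le _ _) (by positivity)
  · simpa [add_mul] using (h2 x hx).add (h4 x hx)

lemma HasGerm.smul {n : ℕ} {f : Coord n → ℝ} {a : MvPowerSeries (Fin n) ℝ}
    (hf : HasGerm f a) (c : ℝ) : HasGerm (fun x => c * f x) (c • a) := by
  obtain ⟨r, hr, h1, h2⟩ := hf
  refine ⟨r, hr, ?_, fun x hx => ?_⟩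
  · simpa [abs_mul, mul_assoc] using h1.mul_left |c|
  · simpa [mul_assoc] using (h2 x hx).mul_left c

lemma HasGerm.mul {n : ℕ} {f g : Coord n → ℝ} {a b : MvPowerSeries (Fin n) ℝ}
    (hf : HasGerm f a) (hg : HasGerm g b) : HasGerm (fun x => f x * g x) (a * b) := by
  classical
  obtain ⟨r, hr, ⟨h1, h2⟩, h3, h4⟩ := hf.common hg
  refine ⟨r, hr, ?_, fun x hx => ?_⟩
  · have := summable_sum_mul_antidiagonal_of_summable_mul
      (summable_mul_of_summable_norm h1.norm h3.norm)
    refine this.of_nonneg_of_le (fun _ => by positivity) fun α => ?_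
    rw [coeff_mul]
    calc _ ≤ (∑ p ∈ Finset.HasAntidiagonal.antidiagonal α, |coeff p.1 a * coeff p.2 b|) *
        r ^ α.degree :=
          mul_le_mul_of_nonneg_right (Finset.abs_sum_le_sum_abs _ _) (by positivity)
      _ = _ := by
          rw [Finset.sum_mul]
          refine Finset.sum_congr rfl fun p hp => ?_
          rw [← Finset.HasAntidiagonal.mem_antidiagonal.1 hp, map_add, pow_add, abs_mul]
          ring
  · have h5 := summable_abs_mul_mono h1 hx.le
    have h6 := summable_abs_mul_mono h3 hx.le
    have h7 := summable_mul_of_summable_norm (f := fun α => coeff α a * mono α x)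
      (g := fun α => coeff α b * mono α x) h5 h6
    have h8 := (summable_sum_mul_antidiagonal_of_summable_mul (f := fun α => coeff α a * mono α x)
      (g := fun α => coeff α b * mono α x) h7).hasSum
    have h9 := Summable.tsum_mul_tsum_eq_tsum_sum_antidiagonal (f := fun α => coeff α a * mono α x)
      (g := fun α => coeff α b * mono α x) (h2 x hx).summable
      (h4 x hx).summable h7
    rw [← h9, (h2 x hx).tsum_eq, (h4 x hx).tsum_eq] at h8
    convert! h8 with α
    rw [coeff_mul, Finset.sum_mul]
    refine Finset.sum_congr rfl fun p hp => ?_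
    rw [← Finset.HasAntidiagonal.mem_antidiagonal.1 hp, mono_add]
    ring

lemma hasGerm_of_finite {n : ℕ} {f : Coord n → ℝ} {a : MvPowerSeries (Fin n) ℝ}
    (s : Finset (Fin n →₀ ℕ)) (hs : ∀ α ∉ s, coeff α a = 0)
    (hf : ∀ x, f x = ∑ α ∈ s, coeff α a * mono α x) : HasGerm f a := by
  refine ⟨1, one_pos, summable_of_ne_finset_zero (s := s) fun α hα => by simp [hs α hα],
    fun x _ => ?_⟩
  rw [hf]
  exact hasSum_sum_of_ne_finset_zero fun α hα => by simp [hs α hα]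

lemma hasGerm_const {n : ℕ} (c : ℝ) : HasGerm (fun _ : Coord n => c) (C c) := by
  classical
  exact hasGerm_of_finite {0}
    (fun α hα => by simpa [coeff_C] using fun h => absurd h (by simpa using hα))
    fun x => by simp [mono_zero]

lemma hasGerm_coord {n : ℕ} (i : Fin n) : HasGerm (fun x : Coord n => x i) (X i) := by
  classical
  exact hasGerm_of_finite {Finsupp.single i 1}
    (fun α hα => by simpa [coeff_X] using fun h => absurd h (by simpa using hα))
    fun x => by simp [mono_single]

lemma HasGerm.neg {n : ℕ} {f : Coord n → ℝ} {a : MvPowerSeries (Fin n) ℝ}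
    (hf : HasGerm f a) : HasGerm (fun x => -f x) (-a) := by
  simpa using hf.smul (-1)

lemma HasGerm.sub {n : ℕ} {f g : Coord n → ℝ} {a b : MvPowerSeries (Fin n) ℝ}
    (hf : HasGerm f a) (hg : HasGerm g b) : HasGerm (fun x => f x - g x) (a - b) := by
  simpa [sub_eq_add_neg] using hf.add hg.neg

lemma HasGerm.sum {n : ℕ} {ι : Type*} (s : Finset ι) {f : ι → Coord n → ℝ}
    {a : ι → MvPowerSeries (Fin n) ℝ} (h : ∀ i ∈ s, HasGerm (f i) (a i)) :
    HasGerm (fun x => ∑ i ∈ s, f i x) (∑ i ∈ s, a i) := by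
  classical
  induction s using Finset.induction_on with
  | empty => simpa using hasGerm_const (n := n) 0
  | insert i s hi ih =>
    simp only [Finset.sum_insert hi]
    exact (h i (Finset.mem_insert_self i s)).add (ih fun j hj => h j (Finset.mem_insert_of_mem hj))

end AnalyticNormalForm

/-! ### Analytic functions are the sums of convergent power series -/

namespace AnalyticNormalForm
open MvPowerSeries

/-- Peeling off one coordinate at a time writes a monomial as the diagonal of a product of
coordinate forms, each of norm at most one for the sup norm. The form is not symmetric, which is
harmless since only diagonal values enter the sum of a power series. -/
lemma exists_multilinear_mono {n : ℕ} (k : ℕ) (α : Fin n →₀ ℕ) :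
    ∃ Q : ContinuousMultilinearMap ℝ (fun _ : Fin k => Coord n) ℝ,
      ‖Q‖ ≤ 1 ∧ (α.degree = k → ∀ x, Q (fun _ => x) = mono α x) := by
  induction k generalizing α with
  | zero =>
    refine ⟨ContinuousMultilinearMap.constOfIsEmpty ℝ _ 1, by simp, fun h x => ?_⟩
    rw [Finsupp.degree_eq_zero_iff] at h
    simp [h, mono_zero]
  | succ k ih =>
    by_cases h : α.degree = k + 1
    · obtain ⟨i, hi⟩ : ∃ i, α i ≠ 0 := by
        by_contra! h0
        have : α = 0 := by ext i; simpa using h0 i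
        simp [this] at h
      have hα : Finsupp.single i 1 + (α - Finsupp.single i 1) = α := by
        apply add_tsub_cancel_of_le
        simpa using Nat.one_le_iff_ne_zero.2 hi
      obtain ⟨Q, hQ, hQ'⟩ := ih (α - Finsupp.single i 1)
      let ℓ : Coord n →L[ℝ] ℝ := ContinuousLinearMap.proj i
      have hℓ : ‖ℓ‖ ≤ 1 := ContinuousLinearMap.opNorm_le_bound _ zero_le_one fun x => by
        simpa using! norm_le_pi_norm x i
      refine ⟨ContinuousLinearMap.uncurryLeft (ℓ.smulRight Q), ?_, fun _ x => ?_⟩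
      · rw [ContinuousLinearMap.uncurryLeft_norm, ContinuousLinearMap.norm_smulRight_apply]
        exact mul_le_one₀ hℓ (norm_nonneg _) hQ
      · have hd : (α - Finsupp.single i 1).degree = k := by
          have := congrArg Finsupp.degree hα
          rw [map_add, Finsupp.degree_single, h] at this
          omega
        have := hQ' hd x
        rw [← hα, mono_add, mono_single, ← this]
        simp [ContinuousLinearMap.uncurryLeft_apply, ℓ]
        exact Or.inl rfl
    · exact ⟨0, by simp, fun h' => absurd h' h⟩

/-- Grouping by degree gives a formal multilinear series whose `k`-th norm is at most the sum of the
absolute coefficients of degree `k`, so absolute summability at `r` bounds its radius from below by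
`r`. -/
lemma HasGerm.analyticAt {n : ℕ} {f : Coord n → ℝ} {a : MvPowerSeries (Fin n) ℝ}
    (h : HasGerm f a) : AnalyticAt ℝ f 0 := by
  obtain ⟨r, hr, h1, h2⟩ := h
  choose Q hQ hQ' using fun k => exists_multilinear_mono (n := n) k
  let p : FormalMultilinearSeries ℝ (Coord n) ℝ := fun k => ∑ α ∈ degIdx n k, coeff α a • Q k α
  have hp : ∀ k, ‖p k‖ ≤ ∑ α ∈ degIdx n k, |coeff α a| := fun k =>
    (norm_sum_le _ _).trans <| Finset.sum_le_sum fun α _ => by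
      rw [norm_smul]
      exact mul_le_of_le_one_right (norm_nonneg _) (hQ k α)
  refine ⟨p, ENNReal.ofReal r, ?_, by simpa using hr, fun {y} hy => ?_⟩
  · refine FormalMultilinearSeries.le_radius_of_bound p (∑' α, |coeff α a| * r ^ α.degree)
      fun k => ?_
    rw [Real.coe_toNNReal _ hr.le]
    calc ‖p k‖ * r ^ k ≤ (∑ α ∈ degIdx n k, |coeff α a|) * r ^ k :=
          mul_le_mul_of_nonneg_right (hp k) (by positivity)
      _ = ∑ α ∈ degIdx n k, |coeff α a| * r ^ α.degree := by
          rw [Finset.sum_mul]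
          exact Finset.sum_congr rfl fun α hα => by rw [mem_degIdx.1 hα]
      _ ≤ _ := h1.sum_le_tsum _ fun α _ => by positivity
  · have hy' : ‖y‖ < r := by
      rw [Metric.eball_ofReal] at hy
      simpa using hy
    rw [zero_add]
    convert! hasSum_sum_degree (h2 y hy') using 2 with k
    simp only [p, sum_apply, smul_apply]
    exact Finset.sum_congr rfl fun α hα => by rw [hQ' k α (mem_degIdx.1 hα), smul_eq_mul]

/-- The multi-index counting the values of `t`. -/
noncomputable def tally {n k : ℕ} (t : Fin k → Fin n) : Fin n →₀ ℕ :=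
  ∑ j, Finsupp.single (t j) 1

lemma degree_tally {n k : ℕ} (t : Fin k → Fin n) : (tally t).degree = k := by
  simp [tally, map_sum]

lemma mono_tally {n k : ℕ} (t : Fin k → Fin n) (x : Coord n) : mono (tally t) x = ∏ j, x (t j) := by
  have : ∀ s : Finset (Fin k), mono (∑ j ∈ s, Finsupp.single (t j) 1) x = ∏ j ∈ s, x (t j) := by
    intro s
    induction s using Finset.induction_on with
    | empty => simp [mono_zero]
    | insert i s hi ih => rw [Finset.sum_insert hi, Finset.prod_insert hi, mono_add, mono_single, ih]
  exact this _

/-- Each multilinear term is expanded on the basis vectors, and the index tuples are collected by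
the monomial they produce. There are `n ^ k` tuples of length `k`, which costs a factor in the
radius of convergence. -/
lemma exists_hasGerm {n : ℕ} {f : Coord n → ℝ} (hf : AnalyticAt ℝ f 0) : ∃ a, HasGerm f a := by
  classical
  obtain ⟨p, R, hp⟩ := hf
  obtain ⟨ρ, hρ0, hρ⟩ := ENNReal.lt_iff_exists_nnreal_btwn.1 hp.r_pos
  have hρ0 : 0 < ρ := by simpa using hρ0
  obtain ⟨K, hK, hpK⟩ := p.norm_mul_pow_le_of_lt_radius (hρ.trans_le hp.r_le)
  let e : ∀ k, (Fin k → Fin n) → ℝ := fun k t => p k fun j => Pi.single (t j) 1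
  let c : (Fin n →₀ ℕ) → ℝ := fun α => ∑ t : Fin α.degree → Fin n with tally t = α, e _ t
  have hc : ∀ {k α}, α ∈ degIdx n k → c α = ∑ t : Fin k → Fin n with tally t = α, e _ t := by
    intro k α h
    obtain rfl := mem_degIdx.1 h
    rfl
  have hmaps : ∀ k, ∀ t ∈ (Finset.univ : Finset (Fin k → Fin n)), tally t ∈ degIdx n k :=
    fun k t _ => mem_degIdx.2 (degree_tally t)
  have hbound : ∀ k, ∑ α ∈ degIdx n k, |c α| ≤ n ^ k * (K / ρ ^ k) := by
    intro k
    calc ∑ α ∈ degIdx n k, |c α|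
        ≤ ∑ α ∈ degIdx n k, ∑ t : Fin k → Fin n with tally t = α, |e _ t| :=
          Finset.sum_le_sum fun α hα => by
            rw [hc hα]
            exact Finset.abs_sum_le_sum_abs _ _
      _ = ∑ t : Fin k → Fin n, |e _ t| := Finset.sum_fiberwise_of_maps_to (hmaps k) _
      _ ≤ ∑ t : Fin k → Fin n, K / ρ ^ k := Finset.sum_le_sum fun t _ => by
          refine ((p k).le_opNorm _).trans ?_
          have h1 : ∏ j, ‖(Pi.single (t j) 1 : Coord n)‖ ≤ 1 :=
            Finset.prod_le_one (fun _ _ => norm_nonneg _) fun j _ => by simp [Pi.norm_single]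
          refine (mul_le_of_le_one_right (norm_nonneg _) h1).trans ?_
          rw [le_div_iff₀ (by positivity)]
          exact hpK k
      _ = _ := by simp
  -- The factor `n + 1` absorbs the `n ^ k` index tuples, and the factor `2` leaves a geometric
  -- series.
  let r : ℝ := ρ / (2 * (n + 1))
  have hr : 0 < r := by positivity
  have hsum : Summable fun α => |c α| * r ^ α.degree := by
    refine summable_of_sum_degree (fun α => by positivity) ?_
    refine (summable_geometric_two.mul_left K).of_nonneg_of_le
      (fun k => Finset.sum_nonneg fun α _ => by positivity) fun k => ?_
    calc _ = (∑ α ∈ degIdx n k, |c α|) * r ^ k := by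
          rw [Finset.sum_mul]
          exact Finset.sum_congr rfl fun α hα => by rw [mem_degIdx.1 hα]
      _ ≤ n ^ k * (K / ρ ^ k) * r ^ k := mul_le_mul_of_nonneg_right (hbound k) (by positivity)
      _ = K * (n / (n + 1) * (1 / 2)) ^ k := by
          simp only [r, div_pow, mul_pow]
          field_simp
          simp
      _ ≤ K * (1 / 2) ^ k := by
          gcongr
          refine mul_le_of_le_one_left (by norm_num) ?_
          rw [div_le_one (by positivity)]
          linarith
  have hr1 : r ≤ ρ := div_le_self (by positivity) (by linarith [n.cast_nonneg (α := ℝ)])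
  refine ⟨c, r, hr, hsum, fun x hx => ?_⟩
  have h3 : Summable fun α => c α * mono α x :=
    (summable_abs_mul_mono (a := c) hsum hx.le).of_norm
  have h4 := hasSum_sum_degree h3.hasSum
  have hx' : x ∈ Metric.eball (0 : Coord n) R := by
    refine Metric.eball_subset_eball hρ.le ?_
    rw [← ENNReal.ofReal_coe_nnreal, Metric.eball_ofReal]
    simpa using hx.trans_le hr1
  have h5 := hp.hasSum hx'
  rw [zero_add] at h5
  have h6 : (fun k => p k fun _ => x) = fun k => ∑ α ∈ degIdx n k, c α * mono α x := by
    funext k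
    have hx0 : (fun _ : Fin k => x) = fun _ => ∑ i, x i • (Pi.single i 1 : Coord n) := by
      funext _
      exact pi_eq_sum_univ' x
    rw [hx0, ContinuousMultilinearMap.map_sum]
    simp only [ContinuousMultilinearMap.map_smul_univ]
    rw [← Finset.sum_fiberwise_of_maps_to (hmaps k)]
    refine Finset.sum_congr rfl fun α hα => ?_
    rw [hc hα, Finset.sum_mul]
    refine Finset.sum_congr rfl fun t ht => ?_
    rw [← (Finset.mem_filter.1 ht).2, mono_tally, smul_eq_mul, mul_comm]
  rw [h6] at h5
  rw [h5.unique h4]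
  exact h3.hasSum

end AnalyticNormalForm

/-! ### Termwise differentiation and dilation of germs -/

namespace AnalyticNormalForm
open MvPowerSeries

lemma hasDerivAt_mono_line {n : ℕ} (α : Fin n →₀ ℕ) (i : Fin n) (x : Coord n) (t : ℝ) :
    HasDerivAt (fun t => mono α (x + t • Pi.single i 1))
      (α i * mono (α - Finsupp.single i 1) (x + t • Pi.single i 1)) t := by
  have h : ∀ (β : Fin n →₀ ℕ) (t : ℝ), mono β (x + t • Pi.single i 1) =
      (x i + t) ^ β i * ∏ j ∈ Finset.univ.erase i, x j ^ β j := by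
    intro β t
    rw [mono, ← Finset.mul_prod_erase _ _ (Finset.mem_univ i)]
    congr 1
    · simp
    · refine Finset.prod_congr rfl fun j hj => ?_
      simp [Pi.single_eq_of_ne (Finset.ne_of_mem_erase hj)]
  simp only [h]
  have h2 : ∏ j ∈ Finset.univ.erase i, x j ^ (α - Finsupp.single i 1 : Fin n →₀ ℕ) j =
      ∏ j ∈ Finset.univ.erase i, x j ^ α j :=
    Finset.prod_congr rfl fun j hj => by
      simp [Finsupp.single_eq_of_ne (Finset.ne_of_mem_erase hj)]
  rw [h2, ← mul_assoc]
  have := (((hasDerivAt_id t).const_add (x i)).pow (α i)).mul_const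
    (∏ j ∈ Finset.univ.erase i, x j ^ α j)
  simpa using this

/-- Halving the radius pays for the factor `k` produced by a derivative, because `k ≤ 2 ^ k`. -/
lemma mul_half_pow_le {r : ℝ} (hr : 0 < r) (k : ℕ) :
    (k : ℝ) * (r / 2) ^ (k - 1) ≤ 2 / r * r ^ k := by
  rcases k with _ | k
  · simp; positivity
  · have h : ((k + 1 : ℕ) : ℝ) ≤ 2 ^ (k + 1) := by exact_mod_cast (Nat.lt_two_pow_self).le
    rw [Nat.add_sub_cancel, div_pow]
    calc ((k + 1 : ℕ) : ℝ) * (r ^ k / 2 ^ k) ≤ 2 ^ (k + 1) * (r ^ k / 2 ^ k) := by gcongr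
      _ = 2 / r * r ^ (k + 1) := by field_simp; ring

/-- On each line in direction `i` the series is differentiated term by term; on the ball of half the
radius the derivatives are dominated uniformly by a multiple of the original series. -/
lemma HasGerm.pderiv {n : ℕ} {f : Coord n → ℝ} {a : MvPowerSeries (Fin n) ℝ} (h : HasGerm f a)
    (i : Fin n) :
    HasGerm (fun x => fderiv ℝ f x (Pi.single i 1)) (MvPowerSeries.pderiv ℝ i a) := by
  classical
  obtain ⟨R, hR, h'⟩ := h.shrink
  obtain ⟨ε, hε, hε'⟩ := Metric.eventually_nhds_iff.1 h.analyticAt.eventually_analyticAt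
  set r : ℝ := min R ε with hr_def
  have hr : 0 < r := lt_min hR hε
  obtain ⟨h1, h2⟩ := h' r hr (min_le_left _ _)
  have hterm : ∀ α : Fin n →₀ ℕ, |coeff α a| * α i * (r / 2) ^ (α.degree - 1) ≤
      2 / r * (|coeff α a| * r ^ α.degree) := by
    intro α
    have hα : (α i : ℝ) ≤ α.degree := by exact_mod_cast Finsupp.le_degree i α
    calc _ ≤ |coeff α a| * α.degree * (r / 2) ^ (α.degree - 1) := by gcongr
      _ = |coeff α a| * (α.degree * (r / 2) ^ (α.degree - 1)) := by ring
      _ ≤ |coeff α a| * (2 / r * r ^ α.degree) := 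
          mul_le_mul_of_nonneg_left (mul_half_pow_le hr _) (abs_nonneg _)
      _ = _ := by ring
  have hsum : Summable fun α => |coeff α a| * α i * (r / 2) ^ (α.degree - 1) :=
    (h1.mul_left (2 / r)).of_nonneg_of_le (fun _ => by positivity) hterm
  have hinj : Function.Injective fun β : Fin n →₀ ℕ => β + Finsupp.single i 1 :=
    add_left_injective _
  refine ⟨r / 2, by positivity, ?_, fun x hx => ?_⟩
  · refine (hsum.comp_injective hinj).congr fun β => ?_
    simp only [Function.comp, map_add, Finsupp.degree_single, Nat.add_sub_cancel, coeff_pderiv,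
      abs_mul, Finsupp.add_apply, Finsupp.single_eq_same]
    rw [abs_of_nonneg (by positivity : (0 : ℝ) ≤ (β i : ℝ) + 1)]
    push_cast
    ring
  · have hline : ∀ t ∈ Metric.ball (0 : ℝ) (r / 2 - ‖x‖), ‖x + t • (Pi.single i 1 : Coord n)‖ <
        r / 2 := by
      intro t ht
      have h3 : ‖t • (Pi.single i 1 : Coord n)‖ = |t| := by
        rw [norm_smul, Pi.norm_single]; simp
      have h4 : |t| < r / 2 - ‖x‖ := by simpa using ht
      linarith [norm_add_le x (t • (Pi.single i 1 : Coord n))]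
    have h0 : (0 : ℝ) ∈ Metric.ball (0 : ℝ) (r / 2 - ‖x‖) := by simpa using hx
    have hd := hasDerivAt_tsum_of_isPreconnected (𝕜 := ℝ)
      (g := fun α t => coeff α a * mono α (x + t • Pi.single i 1))
      (g' := fun α t => coeff α a *
        (α i * mono (α - Finsupp.single i 1) (x + t • Pi.single i 1)))
      hsum Metric.isOpen_ball (convex_ball (0 : ℝ) (r / 2 - ‖x‖)).isPreconnected
      (fun α t _ => (hasDerivAt_mono_line α i x t).const_mul _) (fun α t ht => ?_) h0
      (by simpa using (h2 x (by linarith)).summable) h0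
    · have heq : (fun t => ∑' α, coeff α a * mono α (x + t • Pi.single i 1)) =ᶠ[𝓝 (0 : ℝ)]
          fun t => f (x + t • Pi.single i 1) := by
        filter_upwards [Metric.isOpen_ball.mem_nhds h0] with t ht
        exact (h2 _ ((hline t ht).trans (by linarith))).tsum_eq
      have hd' := hd.congr_of_eventuallyEq heq.symm
      have hfd : HasFDerivAt f (fderiv ℝ f x) x :=
        (hε' (by simpa using hx.trans (by linarith [min_le_right R ε]))).differentiableAt.hasFDerivAt
      have hl : HasDerivAt (fun t : ℝ => x + t • (Pi.single i 1 : Coord n)) (Pi.single i 1) 0 := by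
        simpa using ((hasDerivAt_id (0 : ℝ)).smul_const (Pi.single i 1 : Coord n)).const_add x
      have hcomp : HasDerivAt (fun t : ℝ => f (x + t • Pi.single i 1))
          (fderiv ℝ f x (Pi.single i 1)) 0 :=
        HasFDerivAt.comp_hasDerivAt (0 : ℝ) (by simpa using hfd) hl
      beta_reduce
      rw [hcomp.unique hd']
      simp only [zero_smul, add_zero]
      have hS : Summable fun α : Fin n →₀ ℕ =>
          coeff α a * (α i * mono (α - Finsupp.single i 1) x) := by
        refine (hsum.of_norm_bounded fun α => ?_)
        rcases Nat.eq_zero_or_pos (α i) with h0 | h0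
        · simp [h0]
        · rw [Real.norm_eq_abs, abs_mul, abs_mul, Nat.abs_cast, ← mul_assoc]
          gcongr
          refine (abs_mono_le _ hx.le).trans_eq ?_
          congr 1
          have : (Finsupp.single i 1 + (α - Finsupp.single i 1)) = α :=
            add_tsub_cancel_of_le (by simpa using Nat.one_le_iff_ne_zero.2 h0.ne')
          have := congrArg Finsupp.degree this
          rw [map_add, Finsupp.degree_single] at this
          omega
      have hH := hS.hasSum
      rw [← hinj.hasSum_iff] at hH
      · convert! hH using 2 with β
        simp [coeff_pderiv]
        ring
      · intro α hα
        have : α i = 0 := by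
          by_contra h0
          exact hα ⟨α - Finsupp.single i 1, tsub_add_cancel_of_le
            (by simpa using Nat.one_le_iff_ne_zero.2 h0)⟩
        simp [this]
    · rw [Real.norm_eq_abs, abs_mul, abs_mul, Nat.abs_cast, ← mul_assoc]
      rcases Nat.eq_zero_or_pos (α i) with h0 | h0
      · simp [h0]
      · gcongr
        refine (abs_mono_le _ (hline t ht).le).trans_eq ?_
        congr 1
        have : (Finsupp.single i 1 + (α - Finsupp.single i 1)) = α :=
          add_tsub_cancel_of_le (by simpa using Nat.one_le_iff_ne_zero.2 h0.ne')
        have := congrArg Finsupp.degree this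
        rw [map_add, Finsupp.degree_single] at this
        omega

/-- The power series `a(c x)`. -/
noncomputable def dilate {n : ℕ} (c : ℝ) (a : MvPowerSeries (Fin n) ℝ) : MvPowerSeries (Fin n) ℝ :=
  fun α => c ^ α.degree * coeff α a

lemma coeff_dilate {n : ℕ} (c : ℝ) (a : MvPowerSeries (Fin n) ℝ) (α : Fin n →₀ ℕ) :
    coeff α (dilate c a) = c ^ α.degree * coeff α a := rfl

lemma HasGerm.dilate {n : ℕ} {f : Coord n → ℝ} {a : MvPowerSeries (Fin n) ℝ} (h : HasGerm f a)
    {c : ℝ} (hc : 0 < c) : HasGerm (fun x => f (c • x)) (dilate c a) := by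
  obtain ⟨r, hr, h1, h2⟩ := h
  refine ⟨r / c, by positivity, h1.congr fun α => ?_, fun x hx => ?_⟩
  · rw [coeff_dilate, abs_mul, abs_of_pos (pow_pos hc _), div_pow]
    field_simp
  · have := h2 (c • x) (by
      rw [norm_smul, Real.norm_eq_abs, abs_of_pos hc]
      rwa [lt_div_iff₀' hc] at hx)
    convert! this using 2 with α
    rw [coeff_dilate, mono_smul]
    ring

end AnalyticNormalForm

/-! ### The Bombieri norm and its submultiplicativity -/

namespace AnalyticNormalForm
open MvPowerSeries
open Finset.HasAntidiagonal (antidiagonal mem_antidiagonal)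

lemma antidiagonal_filter_degree {n p q : ℕ} (γ : Fin n →₀ ℕ) :
    ((degIdx n p ×ˢ degIdx n q).filter fun x => x.1 + x.2 = γ) ⊆ antidiagonal γ := by
  intro x hx
  exact mem_antidiagonal.2 (Finset.mem_filter.1 hx).2

/-- Vandermonde's identity for multinomial coefficients: compare the coefficients of `(∑ Xᵢ) ^ (p +
q)` and `(∑ Xᵢ) ^ p * (∑ Xᵢ) ^ q`. -/
lemma sum_multinomial_mul {n p q : ℕ} {γ : Fin n →₀ ℕ} (hγ : γ.degree = p + q) :
    ∑ x ∈ degIdx n p ×ˢ degIdx n q with x.1 + x.2 = γ,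
      (x.1.multinomial : ℝ) * x.2.multinomial = γ.multinomial := by
  classical
  have key : ∀ (δ : Fin n →₀ ℕ) (k : ℕ),
      MvPolynomial.coeff δ ((∑ i, MvPolynomial.X i : MvPolynomial (Fin n) ℝ) ^ k) =
        if δ.degree = k then (δ.multinomial : ℝ) else 0 := by
    intro δ k
    rw [MvPolynomial.coeff_sum_X_pow_of_fintype]
    change ((if δ.degree = k then δ.multinomial else 0 : ℕ) : ℝ) = _
    push_cast
    rfl
  have h := key γ (p + q)
  rw [if_pos hγ, pow_add, MvPolynomial.coeff_mul] at h
  rw [← h, ← Finset.sum_subset (antidiagonal_filter_degree (p := p) (q := q) γ)]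
  · refine Finset.sum_congr rfl fun x hx => ?_
    have := Finset.mem_product.1 (Finset.mem_filter.1 hx).1
    rw [key, key, if_pos (mem_degIdx.1 this.1), if_pos (mem_degIdx.1 this.2)]
  · intro x hx hx'
    rw [key, key]
    by_contra h0
    refine hx' (Finset.mem_filter.2 ⟨Finset.mem_product.2 ?_, mem_antidiagonal.1 hx⟩)
    simp only [mem_degIdx]
    constructor <;> by_contra h <;> simp [h] at h0

/-- The weight of a multi-index in the Bombieri norm. -/
noncomputable def wt {n : ℕ} (α : Fin n →₀ ℕ) : ℝ := (α.multinomial : ℝ)⁻¹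

lemma multinomial_pos {n : ℕ} (α : Fin n →₀ ℕ) : 0 < α.multinomial := by
  rw [Finsupp.multinomial_eq]; exact Nat.multinomial_pos _ _

lemma wt_pos {n : ℕ} (α : Fin n →₀ ℕ) : 0 < wt α := by
  have := multinomial_pos α
  unfold wt
  positivity

/-- The homogeneous part of degree `k` of a power series as a Euclidean vector. -/
noncomputable def euclPart {n : ℕ} (k : ℕ) :
    MvPowerSeries (Fin n) ℝ →ₗ[ℝ] EuclideanSpace ℝ (degIdx n k) where
  toFun a := WithLp.toLp 2 fun α => √(wt α.1) * coeff α.1 a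
  map_add' a b := by ext; simp [mul_add]
  map_smul' c a := by ext; simp; ring

/-- The Bombieri norm of the homogeneous part of degree `k`. -/
noncomputable def bnorm {n : ℕ} (k : ℕ) (a : MvPowerSeries (Fin n) ℝ) : ℝ := ‖euclPart k a‖

lemma bnorm_nonneg {n : ℕ} (k : ℕ) (a : MvPowerSeries (Fin n) ℝ) : 0 ≤ bnorm k a := norm_nonneg _

lemma bnorm_add_le {n : ℕ} (k : ℕ) (a b : MvPowerSeries (Fin n) ℝ) :
    bnorm k (a + b) ≤ bnorm k a + bnorm k b := by
  rw [bnorm, map_add]; exact norm_add_le _ _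

lemma bnorm_smul {n : ℕ} (k : ℕ) (c : ℝ) (a : MvPowerSeries (Fin n) ℝ) :
    bnorm k (c • a) = |c| * bnorm k a := by
  rw [bnorm, map_smul, norm_smul, Real.norm_eq_abs, bnorm]

lemma bnorm_neg {n : ℕ} (k : ℕ) (a : MvPowerSeries (Fin n) ℝ) : bnorm k (-a) = bnorm k a := by
  simpa using bnorm_smul k (-1) a

lemma bnorm_zero {n : ℕ} (k : ℕ) : bnorm k (0 : MvPowerSeries (Fin n) ℝ) = 0 := by
  simp [bnorm]

lemma bnorm_sum_le {n : ℕ} {ι : Type*} (k : ℕ) (s : Finset ι) (a : ι → MvPowerSeries (Fin n) ℝ) :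
    bnorm k (∑ i ∈ s, a i) ≤ ∑ i ∈ s, bnorm k (a i) := by
  rw [bnorm, map_sum]; exact norm_sum_le _ _

lemma bnorm_sq {n : ℕ} (k : ℕ) (a : MvPowerSeries (Fin n) ℝ) :
    bnorm k a ^ 2 = ∑ α ∈ degIdx n k, wt α * coeff α a ^ 2 := by
  rw [bnorm, EuclideanSpace.norm_sq_eq,
    ← Finset.sum_coe_sort (degIdx n k) fun α => wt α * coeff α a ^ 2]
  refine Finset.sum_congr rfl fun α _ => ?_
  simp [euclPart, mul_pow, Real.sq_sqrt (wt_pos _).le]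

lemma bnorm_congr {n : ℕ} {k : ℕ} {a b : MvPowerSeries (Fin n) ℝ}
    (h : ∀ α, α.degree = k → coeff α a = coeff α b) : bnorm k a = bnorm k b := by
  have : euclPart k a = euclPart k b := by
    ext α
    simp [euclPart, h α.1 (mem_degIdx.1 α.2)]
  rw [bnorm, this, bnorm]

/-- For each monomial `γ` of the product, Cauchy–Schwarz is applied to the pairs with sum `γ`,
weighted by the products of their multinomial coefficients. By Vandermonde these weights add up to
the multinomial coefficient of `γ`, which the weight `wt γ` cancels exactly. -/
lemma bnorm_mul_homogeneous {n : ℕ} (p q : ℕ) (a b : MvPowerSeries (Fin n) ℝ) :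
    bnorm (p + q) (homogeneousComponent p a * homogeneousComponent q b) ≤
      bnorm p a * bnorm q b := by
  classical
  refine (sq_le_sq₀ (bnorm_nonneg _ _) (mul_nonneg (bnorm_nonneg _ _) (bnorm_nonneg _ _))).1 ?_
  rw [mul_pow, bnorm_sq, bnorm_sq, bnorm_sq, Finset.sum_mul_sum, ← Finset.sum_product',
    
    ← Finset.sum_fiberwise_of_maps_to (s := degIdx n p ×ˢ degIdx n q) (t := degIdx n (p + q))
      (g := fun x => x.1 + x.2)]
  · refine Finset.sum_le_sum fun γ hγ => ?_
    have hγ := mem_degIdx.1 hγ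
    have h1 : coeff γ (homogeneousComponent p a * homogeneousComponent q b) =
        ∑ x ∈ degIdx n p ×ˢ degIdx n q with x.1 + x.2 = γ, coeff x.1 a * coeff x.2 b := by
      rw [coeff_mul, ← Finset.sum_subset (antidiagonal_filter_degree (p := p) (q := q) γ)]
      · refine Finset.sum_congr rfl fun x hx => ?_
        have := Finset.mem_product.1 (Finset.mem_filter.1 hx).1
        rw [coeff_homogeneousComponent, coeff_homogeneousComponent, if_pos (mem_degIdx.1 this.1),
          if_pos (mem_degIdx.1 this.2)]
      · intro x hx hx'
        rw [coeff_homogeneousComponent, coeff_homogeneousComponent]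
        by_contra h0
        refine hx' (Finset.mem_filter.2 ⟨Finset.mem_product.2 ?_, mem_antidiagonal.1 hx⟩)
        simp only [mem_degIdx]
        constructor <;> by_contra h <;> simp [h] at h0
    have h2 := Finset.sum_sq_le_sum_mul_sum_of_sq_le_mul
      ((degIdx n p ×ˢ degIdx n q).filter fun x => x.1 + x.2 = γ)
      (f := fun x => (x.1.multinomial : ℝ) * x.2.multinomial)
      (g := fun x => wt x.1 * coeff x.1 a ^ 2 * (wt x.2 * coeff x.2 b ^ 2))
      (r := fun x => coeff x.1 a * coeff x.2 b)
      (fun x _ => by positivity)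
      (fun x _ => by have := wt_pos x.1; have := wt_pos x.2; positivity)
      (fun x _ => le_of_eq <| by
        have h1 : (x.1.multinomial : ℝ) ≠ 0 := by exact_mod_cast (multinomial_pos x.1).ne'
        have h2 : (x.2.multinomial : ℝ) ≠ 0 := by exact_mod_cast (multinomial_pos x.2).ne'
        simp only [wt]
        field_simp)
    rw [sum_multinomial_mul hγ] at h2
    rw [h1]
    calc _ ≤ wt γ * (γ.multinomial * _) := mul_le_mul_of_nonneg_left h2 (wt_pos γ).le
      _ = _ := by
        have h1 : (γ.multinomial : ℝ) ≠ 0 := by exact_mod_cast (multinomial_pos γ).ne'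
        rw [wt, inv_mul_cancel_left₀ h1]
  · intro x hx
    have := Finset.mem_product.1 hx
    rw [mem_degIdx, map_add, mem_degIdx.1 this.1, mem_degIdx.1 this.2]

lemma bnorm_mul_le {n : ℕ} (m : ℕ) (a b : MvPowerSeries (Fin n) ℝ) :
    bnorm m (a * b) ≤ ∑ p ∈ antidiagonal m, bnorm p.1 a * bnorm p.2 b := by
  classical
  have h : bnorm m (a * b) = bnorm m (∑ p ∈ antidiagonal m,
      homogeneousComponent p.1 a * homogeneousComponent p.2 b) := by
    refine bnorm_congr fun γ hγ => ?_
    rw [map_sum]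
    simp only [coeff_mul, coeff_homogeneousComponent]
    rw [Finset.sum_comm]
    refine Finset.sum_congr rfl fun x hx => ?_
    rw [Finset.sum_eq_single (x.1.degree, x.2.degree)]
    · simp
    · rintro ⟨p, q⟩ _ hpq
      by_cases h1 : x.1.degree = p
      · have h2 : x.2.degree ≠ q := fun h2 => hpq (by rw [h1, h2])
        simp [h2]
      · simp [h1]
    · intro h0
      exact absurd (mem_antidiagonal.2 (by
        rw [← hγ, ← mem_antidiagonal.1 hx, map_add])) h0
  rw [h]
  refine (bnorm_sum_le _ _ _).trans (Finset.sum_le_sum fun p hp => ?_)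
  rw [← mem_antidiagonal.1 hp]
  exact bnorm_mul_homogeneous _ _ _ _

end AnalyticNormalForm

/-! ### The Banach algebra of power series -/

namespace AnalyticNormalForm
open MvPowerSeries
open Finset.HasAntidiagonal (antidiagonal mem_antidiagonal)

lemma bnorm_of_degree_ne {n k : ℕ} {a : MvPowerSeries (Fin n) ℝ}
    (h : ∀ α, α.degree = k → coeff α a = 0) : bnorm k a = 0 := by
  rw [bnorm_congr (b := 0) (by simpa using h), bnorm_zero]

lemma summable_bnorm_mul {n : ℕ} {a b : MvPowerSeries (Fin n) ℝ}
    (ha : Summable fun k => bnorm k a) (hb : Summable fun k => bnorm k b) :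
    Summable (fun k => bnorm k (a * b)) ∧
      ∑' k, bnorm k (a * b) ≤ (∑' k, bnorm k a) * ∑' k, bnorm k b := by
  have h1 := summable_mul_of_summable_norm (f := fun k => bnorm k a) (g := fun k => bnorm k b)
    ha.norm hb.norm
  have h2 := summable_sum_mul_antidiagonal_of_summable_mul (f := fun k => bnorm k a)
    (g := fun k => bnorm k b) h1
  have h3 := h2.of_nonneg_of_le (fun k => bnorm_nonneg k (a * b)) fun k => bnorm_mul_le k a b
  refine ⟨h3, ?_⟩
  have h4 := Summable.tsum_mul_tsum_eq_tsum_sum_antidiagonal (f := fun k => bnorm k a)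
    (g := fun k => bnorm k b) ha hb h1
  rw [h4]
  exact h3.tsum_le_tsum (fun k => bnorm_mul_le k a b) h2

lemma summable_bnorm_C {n : ℕ} (c : ℝ) :
    Summable fun k => bnorm k (C c : MvPowerSeries (Fin n) ℝ) := by
  classical
  refine summable_of_ne_finset_zero (s := {0}) fun k hk => bnorm_of_degree_ne fun α hα => ?_
  rw [coeff_C, if_neg]
  rintro rfl
  simp_all

/-- The power series that converge absolutely on the unit ball, as measured by the Bombieri norms
of the homogeneous parts. -/
noncomputable def convAlg (n : ℕ) : Subalgebra ℝ (MvPowerSeries (Fin n) ℝ) where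
  carrier := {a | Summable fun k => bnorm k a}
  mul_mem' ha hb := (summable_bnorm_mul ha hb).1
  add_mem' ha hb := (ha.add hb).of_nonneg_of_le (fun k => bnorm_nonneg k _)
    fun k => bnorm_add_le k _ _
  algebraMap_mem' c := summable_bnorm_C c

/-- The Banach algebra of power series. -/
def PSeries (n : ℕ) : Type := convAlg n

noncomputable instance (n : ℕ) : CommRing (PSeries n) := inferInstanceAs (CommRing (convAlg n))

/-- The power series underlying an element of the Banach algebra. -/
noncomputable def PSeries.val {n : ℕ} (a : PSeries n) : MvPowerSeries (Fin n) ℝ := Subtype.val a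

lemma PSeries.summable {n : ℕ} (a : PSeries n) : Summable fun k => bnorm k a.val := a.2

/-- The element of the Banach algebra given by a power series. -/
def PSeries.mk {n : ℕ} (a : MvPowerSeries (Fin n) ℝ) (h : Summable fun k => bnorm k a) :
    PSeries n :=
  ⟨a, h⟩

namespace PSeries

variable {n : ℕ}

@[simp] lemma val_mk (a : MvPowerSeries (Fin n) ℝ) (h : Summable fun k => bnorm k a) :
    (mk a h).val = a := rfl

@[ext] lemma ext {a b : PSeries n} (h : a.val = b.val) : a = b := Subtype.ext h

@[simp] lemma val_add (a b : PSeries n) : (a + b).val = a.val + b.val := rfl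
@[simp] lemma val_sub (a b : PSeries n) : (a - b).val = a.val - b.val := rfl
@[simp] lemma val_neg (a : PSeries n) : (-a).val = -a.val := rfl
@[simp] lemma val_mul (a b : PSeries n) : (a * b).val = a.val * b.val := rfl
@[simp] lemma val_zero : (0 : PSeries n).val = 0 := rfl
@[simp] lemma val_one : (1 : PSeries n).val = 1 := rfl

/-- The norm of the Banach algebra of power series. -/
noncomputable def ringNorm (n : ℕ) : RingNorm (PSeries n) where
  toFun a := ∑' k, bnorm k a.val
  map_zero' := by simp [bnorm_zero]
  add_le' a b := by
    rw [← a.summable.tsum_add b.summable]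
    exact (a + b).summable.tsum_le_tsum (fun k => bnorm_add_le k _ _) (a.summable.add b.summable)
  neg' a := by simp [bnorm_neg]
  mul_le' a b := (summable_bnorm_mul a.summable b.summable).2
  eq_zero_of_map_eq_zero' a h := by
    have h1 := (hasSum_zero_iff_of_nonneg fun k => bnorm_nonneg k a.val).1 (h ▸ a.summable.hasSum)
    ext α
    have h2 := congrArg (· ^ 2) (congrFun h1 α.degree)
    simp only [bnorm_sq, Pi.zero_apply] at h2
    rw [zero_pow two_ne_zero, Finset.sum_eq_zero_iff_of_nonneg fun β _ =>
      mul_nonneg (wt_pos β).le (sq_nonneg _)] at h2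
    simpa [(wt_pos α).ne'] using h2 α (mem_degIdx.2 rfl)

noncomputable instance : NormedCommRing (PSeries n) where
  __ := (ringNorm n).toNormedRing
  mul_comm := mul_comm

lemma norm_def (a : PSeries n) : ‖a‖ = ∑' k, bnorm k a.val := rfl

noncomputable instance : Algebra ℝ (PSeries n) := inferInstanceAs (Algebra ℝ (convAlg n))

@[simp] lemma val_smul (c : ℝ) (a : PSeries n) : (c • a).val = c • a.val := rfl

noncomputable instance : NormedAlgebra ℝ (PSeries n) where
  norm_smul_le c a := by
    rw [norm_def, norm_def, val_smul, ← tsum_mul_left]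
    simp only [bnorm_smul, Real.norm_eq_abs]
    exact le_rfl

lemma val_sum {ι : Type*} (s : Finset ι) (a : ι → PSeries n) :
    (∑ i ∈ s, a i).val = ∑ i ∈ s, (a i).val :=
  map_sum (convAlg n).val a s

/-- The sequence of homogeneous parts. -/
noncomputable def toLp (n : ℕ) : PSeries n →+ lp (fun k => EuclideanSpace ℝ (degIdx n k)) 1 where
  toFun a := ⟨fun k => euclPart k a.val, memℓp_gen (by simpa [bnorm] using a.summable)⟩
  map_zero' := by ext; simp
  map_add' a b := by
    ext k : 2
    exact map_add (euclPart k) a.val b.val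

lemma norm_toLp (a : PSeries n) : ‖toLp n a‖ = ‖a‖ := by
  rw [lp.norm_eq_tsum_rpow (by simp), norm_def]
  simp [toLp, bnorm]

lemma toLp_surjective : Function.Surjective (toLp n) := by
  intro f
  let a : MvPowerSeries (Fin n) ℝ :=
    fun α => (√(wt α))⁻¹ * f α.degree ⟨α, mem_degIdx.2 rfl⟩
  have ha : ∀ k, euclPart k a = f k := by
    intro k
    ext ⟨α, hα⟩
    obtain rfl := mem_degIdx.1 hα
    have : √(wt α) ≠ 0 := (Real.sqrt_pos.2 (wt_pos α)).ne'
    change √(wt α) * ((√(wt α))⁻¹ * _) = _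
    rw [mul_inv_cancel_left₀ this]
  have hs : Summable fun k => bnorm k a := by
    have := (lp.memℓp f).summable (by simp)
    simpa [bnorm, ha] using this
  refine ⟨mk a hs, ?_⟩
  ext k : 2
  exact ha k

/-- Taking homogeneous parts is an isometry onto the `ℓ¹` sum of the finite-dimensional Euclidean
spaces of coefficients, and that sum is complete. -/
instance : CompleteSpace (PSeries n) := by
  have h : Isometry (toLp n) := AddMonoidHomClass.isometry_of_norm _ norm_toLp
  rw [completeSpace_iff_isComplete_range h.isUniformInducing, toLp_surjective.range_eq]
  exact isComplete_univ

/-- A linear operator on power series which shifts the degree by `s` and is bounded. -/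
noncomputable def liftCLM (O : MvPowerSeries (Fin n) ℝ →ₗ[ℝ] MvPowerSeries (Fin n) ℝ) (s : ℕ) (K : ℝ)
    (hK : 0 ≤ K) (h : ∀ a k, bnorm k (O a) ≤ K * bnorm (k + s) a) : PSeries n →L[ℝ] PSeries n :=
  have h1 (a : PSeries n) : Summable fun k => bnorm (k + s) a.val :=
    (summable_nat_add_iff s).2 a.summable
  LinearMap.mkContinuous
    { toFun a := mk (O a.val) (((h1 a).mul_left K).of_nonneg_of_le (fun _ => bnorm_nonneg _ _)
        fun k => h a.val k)
      map_add' a b := by ext1; simp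
      map_smul' c a := by ext1; simp } K fun a => by
    have h2 : ∑' k, bnorm (k + s) a.val ≤ ‖a‖ :=
      (h1 a).tsum_le_tsum_of_inj (fun k => k + s) (add_left_injective s)
        (fun _ _ => bnorm_nonneg _ _) (fun _ => le_rfl) a.summable
    refine le_trans ?_ (mul_le_mul_of_nonneg_left h2 hK)
    rw [norm_def, ← tsum_mul_left]
    exact (((h1 a).mul_left K).of_nonneg_of_le (fun _ => bnorm_nonneg _ _)
        fun k => h a.val k).tsum_le_tsum (fun k => h a.val k) ((h1 a).mul_left K)

lemma val_liftCLM (O : MvPowerSeries (Fin n) ℝ →ₗ[ℝ] MvPowerSeries (Fin n) ℝ) (s : ℕ) (K : ℝ)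
    (hK : 0 ≤ K) (h : ∀ a k, bnorm k (O a) ≤ K * bnorm (k + s) a) (a : PSeries n) :
    (liftCLM O s K hK h a).val = O a.val := rfl

end PSeries

end AnalyticNormalForm

/-! ### Comparison with convergent series, small dilations, operators of bounded norm -/

namespace AnalyticNormalForm
open MvPowerSeries

lemma wt_le_one {n : ℕ} (α : Fin n →₀ ℕ) : wt α ≤ 1 :=
  inv_le_one_of_one_le₀ (by exact_mod_cast multinomial_pos α)

lemma sum_multinomial {n : ℕ} (k : ℕ) : ∑ α ∈ degIdx n k, (α.multinomial : ℝ) = n ^ k := by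
  classical
  have key : ∀ δ : Fin n →₀ ℕ,
      MvPolynomial.coeff δ ((∑ i, MvPolynomial.X i : MvPolynomial (Fin n) ℝ) ^ k) =
        if δ.degree = k then (δ.multinomial : ℝ) else 0 := by
    intro δ
    rw [MvPolynomial.coeff_sum_X_pow_of_fintype]
    change ((if δ.degree = k then δ.multinomial else 0 : ℕ) : ℝ) = _
    push_cast
    rfl
  have h := MvPolynomial.eval_eq' (fun _ => (1 : ℝ))
    ((∑ i, MvPolynomial.X i : MvPolynomial (Fin n) ℝ) ^ k)
  simp only [map_pow, map_sum, MvPolynomial.eval_X, Finset.sum_const, Finset.card_univ,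
    Fintype.card_fin, nsmul_eq_mul, mul_one, one_pow, Finset.prod_const_one, key] at h
  rw [h, ← Finset.sum_subset (s₂ := degIdx n k)]
  · exact Finset.sum_congr rfl fun α hα => by
      have := MvPolynomial.mem_support_iff.1 hα
      rw [key] at this
      simp_all
  · intro α hα
    have := MvPolynomial.mem_support_iff.1 hα
    rw [key] at this
    exact mem_degIdx.2 (by by_contra h0; simp [h0] at this)
  · intro α hα hα'
    rw [MvPolynomial.mem_support_iff, key, if_pos (mem_degIdx.1 hα)] at hα'
    simpa using hα'

/-- The square root of the multinomial coefficient would already do; the full coefficient is taken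
because these sum to `n ^ k` over the degree. -/
lemma abs_coeff_le {n k : ℕ} (a : MvPowerSeries (Fin n) ℝ) {α : Fin n →₀ ℕ} (hα : α ∈ degIdx n k) :
    |coeff α a| ≤ α.multinomial * bnorm k a := by
  have h1 : (1 : ℝ) ≤ α.multinomial := by exact_mod_cast multinomial_pos α
  refine abs_le_of_sq_le_sq ?_ (mul_nonneg (by positivity) (bnorm_nonneg _ _))
  have h2 : wt α * coeff α a ^ 2 ≤ bnorm k a ^ 2 := by
    rw [bnorm_sq]
    exact Finset.single_le_sum (f := fun α => wt α * coeff α a ^ 2)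
      (fun β _ => mul_nonneg (wt_pos β).le (sq_nonneg _)) hα
  calc coeff α a ^ 2 = α.multinomial * (wt α * coeff α a ^ 2) := by
        rw [wt, mul_inv_cancel_left₀ (by positivity)]
    _ ≤ α.multinomial * bnorm k a ^ 2 := by gcongr
    _ ≤ α.multinomial * (α.multinomial * bnorm k a ^ 2) := by
        gcongr
        exact le_mul_of_one_le_left (sq_nonneg _) h1
    _ = _ := by ring

lemma sum_abs_coeff_le {n : ℕ} (k : ℕ) (a : MvPowerSeries (Fin n) ℝ) :
    ∑ α ∈ degIdx n k, |coeff α a| ≤ n ^ k * bnorm k a := by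
  rw [← sum_multinomial, Finset.sum_mul]
  exact Finset.sum_le_sum fun α hα => abs_coeff_le a hα

lemma bnorm_le_sum_abs {n : ℕ} (k : ℕ) (a : MvPowerSeries (Fin n) ℝ) :
    bnorm k a ≤ ∑ α ∈ degIdx n k, |coeff α a| := by
  refine (sq_le_sq₀ (bnorm_nonneg _ _) (Finset.sum_nonneg fun _ _ => abs_nonneg _)).1 ?_
  rw [bnorm_sq]
  calc _ ≤ ∑ α ∈ degIdx n k, |coeff α a| ^ 2 := Finset.sum_le_sum fun α _ => by
        rw [sq_abs]
        exact mul_le_of_le_one_left (sq_nonneg _) (wt_le_one α)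
    _ ≤ _ := Finset.sum_sq_le_sq_sum_of_nonneg fun _ _ => abs_nonneg _

lemma sum_degIdx_mul_pow {n : ℕ} (k : ℕ) (a : MvPowerSeries (Fin n) ℝ) (r : ℝ) :
    ∑ α ∈ degIdx n k, |coeff α a| * r ^ α.degree = (∑ α ∈ degIdx n k, |coeff α a|) * r ^ k := by
  rw [Finset.sum_mul]
  exact Finset.sum_congr rfl fun α hα => by rw [mem_degIdx.1 hα]

lemma PSeries.isConv {n : ℕ} (a : PSeries n) : IsConv a.val := by
  refine ⟨1 / (n + 1), by positivity, summable_of_sum_degree (fun _ => by positivity) ?_⟩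
  refine a.summable.of_nonneg_of_le (fun k => Finset.sum_nonneg fun _ _ => by positivity) fun k => ?_
  rw [sum_degIdx_mul_pow]
  calc _ ≤ n ^ k * bnorm k a.val * (1 / (n + 1)) ^ k := by
        gcongr
        exact sum_abs_coeff_le k a.val
    _ = (n / (n + 1)) ^ k * bnorm k a.val := by rw [div_pow, div_pow]; ring
    _ ≤ 1 * bnorm k a.val := by
        gcongr
        · exact bnorm_nonneg _ _
        · exact pow_le_one₀ (by positivity) ((div_le_one (by positivity)).2 (by linarith))
    _ = _ := one_mul _

lemma abs_coeff_dilate {n : ℕ} (a : MvPowerSeries (Fin n) ℝ) {c : ℝ} (hc : 0 < c)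
    (α : Fin n →₀ ℕ) : |coeff α (dilate c a)| = |coeff α a| * c ^ α.degree := by
  rw [coeff_dilate, abs_mul, abs_of_pos (pow_pos hc _), mul_comm]

/-- A convergent power series without constant term becomes, after a dilation, an arbitrarily small
element of the Banach algebra. -/
lemma IsConv.eventually_dilate {n : ℕ} {a : MvPowerSeries (Fin n) ℝ} (ha : IsConv a)
    (h0 : coeff 0 a = 0) {δ : ℝ} (hδ : 0 < δ) :
    ∀ᶠ c in 𝓝[>] (0 : ℝ), ∃ b : PSeries n, b.val = dilate c a ∧ ‖b‖ < δ := by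
  obtain ⟨r, hr, h⟩ := ha
  set S := ∑' α, |coeff α a| * r ^ α.degree
  have hS : 0 ≤ S := tsum_nonneg fun _ => by positivity
  have hev : ∀ᶠ c in 𝓝[>] (0 : ℝ), c < min r (r * δ / (S + 1)) :=
    nhdsWithin_le_nhds (eventually_lt_nhds (by positivity))
  filter_upwards [hev, self_mem_nhdsWithin] with c hc hc0
  have hc0 : 0 < c := hc0
  have hcr : c ≤ r := (hc.trans_le (min_le_left _ _)).le
  -- Without a constant term every coefficient carries at least one factor `c`, so the whole sum
  -- shrinks by `c / r`.
  have hterm : ∀ α, |coeff α (dilate c a)| ≤ c / r * (|coeff α a| * r ^ α.degree) := by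
    intro α
    rw [abs_coeff_dilate a hc0]
    by_cases hα : α = 0
    · simp [hα, h0]
    · have hd : α.degree ≠ 0 := by rwa [Ne, Finsupp.degree_eq_zero_iff]
      obtain ⟨m, hm⟩ := Nat.exists_eq_succ_of_ne_zero hd
      rw [hm, pow_succ, pow_succ]
      have : c ^ m ≤ r ^ m := pow_le_pow_left₀ hc0.le hcr m
      calc |coeff α a| * (c ^ m * c) ≤ |coeff α a| * (r ^ m * c) := by gcongr
        _ = _ := by field_simp
  have hs1 : Summable fun α => |coeff α (dilate c a)| :=
    (h.mul_left (c / r)).of_nonneg_of_le (fun _ => abs_nonneg _) hterm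
  have hs2 : ∑' α, |coeff α (dilate c a)| ≤ c / r * S := by
    rw [← tsum_mul_left]
    exact hs1.tsum_le_tsum hterm (h.mul_left _)
  have hs3 := hasSum_sum_degree hs1.hasSum
  have hs4 : Summable fun k => bnorm k (dilate c a) :=
    hs3.summable.of_nonneg_of_le (fun _ => bnorm_nonneg _ _) fun k => bnorm_le_sum_abs k _
  refine ⟨PSeries.mk _ hs4, rfl, ?_⟩
  rw [PSeries.norm_def, PSeries.val_mk]
  calc _ ≤ ∑' k, ∑ α ∈ degIdx n k, |coeff α (dilate c a)| :=
        hs4.tsum_le_tsum (fun k => bnorm_le_sum_abs k _) hs3.summable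
    _ ≤ c / r * S := by rw [hs3.tsum_eq]; exact hs2
    _ < δ := by
        have h1 : c * (S + 1) < r * δ := by
          rw [← lt_div_iff₀ (by positivity)]
          exact hc.trans_le (min_le_right _ _)
        rw [div_mul_eq_mul_div, div_lt_iff₀ hr]
        linarith

/-- Quotient of two multinomial coefficients. This recursion for the weights is the source of both
the bound for `∂ᵢ` and its adjointness to multiplication by `xᵢ`. -/
lemma wt_add_single {n k : ℕ} (i : Fin n) {β : Fin n →₀ ℕ} (hβ : β ∈ degIdx n k) :
    wt (β + Finsupp.single i 1) * (k + 1) = wt β * (β i + 1) := by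
  have hβ := mem_degIdx.1 hβ
  have h1 : ∀ γ : Fin n →₀ ℕ, (∏ j, ((γ j).factorial : ℝ)) * γ.multinomial =
      (γ.degree.factorial : ℝ) := by
    intro γ
    rw [Finsupp.multinomial_eq_of_support_subset (Finset.subset_univ _), Finsupp.degree_eq_sum]
    exact_mod_cast Nat.multinomial_spec Finset.univ γ
  have h2 := h1 β
  have h3 := h1 (β + Finsupp.single i 1)
  rw [map_add, Finsupp.degree_single, hβ] at h3
  rw [hβ] at h2
  have h4 : ∏ j, (((β + Finsupp.single i 1 : Fin n →₀ ℕ) j).factorial : ℝ) =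
      (β i + 1) * ∏ j, ((β j).factorial : ℝ) := by
    rw [← Finset.mul_prod_erase _ _ (Finset.mem_univ i),
      ← Finset.mul_prod_erase Finset.univ (fun j => ((β j).factorial : ℝ)) (Finset.mem_univ i)]
    have : ∏ j ∈ Finset.univ.erase i, (((β + Finsupp.single i 1 : Fin n →₀ ℕ) j).factorial : ℝ) =
        ∏ j ∈ Finset.univ.erase i, ((β j).factorial : ℝ) :=
      Finset.prod_congr rfl fun j hj => by
        simp [Finsupp.single_eq_of_ne (Finset.ne_of_mem_erase hj)]
    rw [this]
    simp [Nat.factorial_succ]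
    ring
  rw [h4, Nat.factorial_succ, Nat.cast_mul, ← h2] at h3
  have h5 : (0 : ℝ) < ∏ j, ((β j).factorial : ℝ) :=
    Finset.prod_pos fun j _ => by positivity
  have h6 : (0 : ℝ) < β.multinomial := by exact_mod_cast multinomial_pos β
  have h7 : (0 : ℝ) < (β + Finsupp.single i 1).multinomial := by
    exact_mod_cast multinomial_pos _
  rw [wt, wt]
  push_cast at h3
  have h8 : ((β i : ℝ) + 1) * (β + Finsupp.single i 1).multinomial =
      (k + 1) * β.multinomial := by
    have : (∏ j, ((β j).factorial : ℝ)) * (((β i : ℝ) + 1) * (β + Finsupp.single i 1).multinomial)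
      = (∏ j, ((β j).factorial : ℝ)) * ((k + 1) * β.multinomial) := by linarith
    exact mul_left_cancel₀ h5.ne' this
  field_simp
  linarith

lemma bnorm_pderiv_le {n : ℕ} (k : ℕ) (i : Fin n) (a : MvPowerSeries (Fin n) ℝ) :
    bnorm k (pderiv ℝ i a) ≤ (k + 1) * bnorm (k + 1) a := by
  refine (sq_le_sq₀ (bnorm_nonneg _ _) (mul_nonneg (by positivity) (bnorm_nonneg _ _))).1 ?_
  rw [mul_pow, bnorm_sq, bnorm_sq, Finset.mul_sum]
  have hinj : Set.InjOn (fun β : Fin n →₀ ℕ => β + Finsupp.single i 1) (degIdx n k) :=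
    (add_left_injective _).injOn
  calc ∑ β ∈ degIdx n k, wt β * coeff β (pderiv ℝ i a) ^ 2
      ≤ ∑ β ∈ degIdx n k, (k + 1) ^ 2 *
        (wt (β + Finsupp.single i 1) * coeff (β + Finsupp.single i 1) a ^ 2) :=
        Finset.sum_le_sum fun β hβ => by
          have h1 : (β i : ℝ) ≤ k := by
            rw [← mem_degIdx.1 hβ]
            exact_mod_cast Finsupp.le_degree i β
          rw [coeff_pderiv]
          calc _ = (wt β * (β i + 1)) * (β i + 1) * coeff (β + Finsupp.single i 1) a ^ 2 := by ring
            _ = wt (β + Finsupp.single i 1) * (k + 1) * (β i + 1) *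
                coeff (β + Finsupp.single i 1) a ^ 2 := by rw [wt_add_single i hβ]
            _ ≤ wt (β + Finsupp.single i 1) * (k + 1) * (k + 1) *
                coeff (β + Finsupp.single i 1) a ^ 2 := by
                have := wt_pos (β + Finsupp.single i 1)
                gcongr
            _ = _ := by ring
    _ = ∑ γ ∈ (degIdx n k).image (fun β => β + Finsupp.single i 1),
        (k + 1) ^ 2 * (wt γ * coeff γ a ^ 2) := by rw [Finset.sum_image hinj]
    _ ≤ _ := Finset.sum_le_sum_of_subset_of_nonneg (fun γ hγ => by
          obtain ⟨β, hβ, rfl⟩ := Finset.mem_image.1 hγ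
          rw [mem_degIdx, map_add, Finsupp.degree_single, mem_degIdx.1 hβ])
        fun γ _ _ => by have := wt_pos γ; positivity

/-- Multiplication of the homogeneous part of degree `k` by `m k`. -/
noncomputable def diag {n : ℕ} (m : ℕ → ℝ) :
    MvPowerSeries (Fin n) ℝ →ₗ[ℝ] MvPowerSeries (Fin n) ℝ where
  toFun a := fun α => m α.degree * coeff α a
  map_add' a b := by
    ext α
    change m _ * coeff α (a + b) = m _ * coeff α a + m _ * coeff α b
    rw [map_add, mul_add]
  map_smul' c a := by
    ext α
    change m _ * coeff α (c • a) = c * (m _ * coeff α a)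
    rw [coeff_smul]
    ring

lemma coeff_diag {n : ℕ} (m : ℕ → ℝ) (a : MvPowerSeries (Fin n) ℝ) (α : Fin n →₀ ℕ) :
    coeff α (diag m a) = m α.degree * coeff α a := rfl

lemma bnorm_diag {n : ℕ} (m : ℕ → ℝ) (k : ℕ) (a : MvPowerSeries (Fin n) ℝ) :
    bnorm k (diag m a) = |m k| * bnorm k a := by
  rw [← bnorm_smul]
  refine bnorm_congr fun α hα => ?_
  rw [coeff_diag, coeff_smul, hα]

namespace PSeries

variable {n : ℕ}

/-- The truncation which removes the terms of degree less than `m`. -/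
noncomputable def cut (m : ℕ) : PSeries n →L[ℝ] PSeries n :=
  liftCLM (diag fun k => if k < m then 0 else 1) 0 1 zero_le_one fun a k => by
    rw [bnorm_diag]
    gcongr
    · exact bnorm_nonneg _ _
    · split_ifs <;> simp
    · exact le_rfl

/-- Division of the homogeneous part of degree `k` by `k + 1`. -/
noncomputable def smoothen : PSeries n →L[ℝ] PSeries n :=
  liftCLM (diag fun k => ((k : ℝ) + 1)⁻¹) 0 1 zero_le_one fun a k => by
    rw [bnorm_diag, abs_of_nonneg (by positivity)]
    gcongr
    · exact bnorm_nonneg _ _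
    · exact inv_le_one_of_one_le₀ (by linarith [k.cast_nonneg (α := ℝ)])
    · exact le_rfl

/-- The partial derivative of `smoothen`. -/
noncomputable def dsmoothen (i : Fin n) : PSeries n →L[ℝ] PSeries n :=
  liftCLM ((pderiv ℝ i).toLinearMap ∘ₗ diag fun k => ((k : ℝ) + 1)⁻¹) 1 1 zero_le_one fun a k => by
    -- The derivative costs `k + 1`, while `smoothen` has divided the part of degree `k + 1` by `k +
    -- 2`.
    refine (bnorm_pderiv_le k i _).trans ?_
    rw [bnorm_diag, abs_of_nonneg (by positivity), ← mul_assoc]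
    gcongr
    · exact bnorm_nonneg _ _
    · push_cast
      rw [← div_eq_mul_inv, div_le_one (by positivity)]
      linarith

lemma coeff_cut (m : ℕ) (a : PSeries n) (α : Fin n →₀ ℕ) :
    coeff α (cut m a).val = if α.degree < m then 0 else coeff α a.val := by
  rw [cut, val_liftCLM, coeff_diag]
  split_ifs <;> simp

lemma coeff_smoothen (a : PSeries n) (α : Fin n →₀ ℕ) :
    coeff α (smoothen a).val = ((α.degree : ℝ) + 1)⁻¹ * coeff α a.val := by
  rw [smoothen, val_liftCLM, coeff_diag]

lemma val_dsmoothen (i : Fin n) (a : PSeries n) :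
    (dsmoothen i a).val = pderiv ℝ i (smoothen a).val := rfl

end PSeries

end AnalyticNormalForm

/-! ### Homogeneous series, Bombieri adjointness and the operator `|x|²Δ` -/

namespace AnalyticNormalForm
open MvPowerSeries
open Finset.HasAntidiagonal (antidiagonal mem_antidiagonal)

variable {n : ℕ}

lemma coeff_add_single_X_mul (i : Fin n) (a : MvPowerSeries (Fin n) ℝ) (β : Fin n →₀ ℕ) :
    coeff (β + Finsupp.single i 1) (X i * a) = coeff β a := by
  rw [X, add_comm, coeff_add_monomial_mul, one_mul]

lemma coeff_X_mul_of_eq_zero (i : Fin n) (a : MvPowerSeries (Fin n) ℝ) {α : Fin n →₀ ℕ}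
    (h : α i = 0) : coeff α (X i * a) = 0 := by
  classical
  rw [X, coeff_monomial_mul, if_neg]
  simp [h]

lemma exists_add_single {i : Fin n} {α : Fin n →₀ ℕ} (h : α i ≠ 0) :
    ∃ β : Fin n →₀ ℕ, β + Finsupp.single i 1 = α :=
  ⟨α - Finsupp.single i 1, tsub_add_cancel_of_le (by simpa using Nat.one_le_iff_ne_zero.2 h)⟩

lemma coeff_X_mul_pderiv (i : Fin n) (a : MvPowerSeries (Fin n) ℝ) (α : Fin n →₀ ℕ) :
    coeff α (X i * pderiv ℝ i a) = α i * coeff α a := by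
  by_cases h : α i = 0
  · rw [coeff_X_mul_of_eq_zero i _ h, h, Nat.cast_zero, zero_mul]
  · obtain ⟨β, rfl⟩ := exists_add_single h
    rw [coeff_add_single_X_mul, coeff_pderiv]
    simp [mul_comm]

lemma isHomogeneous_iff {a : MvPowerSeries (Fin n) ℝ} {k : ℕ} :
    a.IsHomogeneous k ↔ ∀ α, α.degree ≠ k → coeff α a = 0 :=
  ⟨fun h α hα => h.coeff_eq_zero hα, fun h α hα => by
    by_contra h0
    refine hα (h α ?_)
    rwa [Finsupp.degree_eq_weight_one]⟩

lemma homog_smul {a : MvPowerSeries (Fin n) ℝ} {k : ℕ} (h : a.IsHomogeneous k) (c : ℝ) :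
    (c • a).IsHomogeneous k :=
  isHomogeneous_iff.2 fun α hα => by rw [coeff_smul, isHomogeneous_iff.1 h α hα, mul_zero]

lemma homog_sub {a b : MvPowerSeries (Fin n) ℝ} {k : ℕ} (h : a.IsHomogeneous k)
    (h' : b.IsHomogeneous k) : (a - b).IsHomogeneous k :=
  isHomogeneous_iff.2 fun α hα => by
    rw [map_sub, isHomogeneous_iff.1 h α hα, isHomogeneous_iff.1 h' α hα, sub_zero]

lemma homog_sum {ι : Type*} {s : Finset ι} {a : ι → MvPowerSeries (Fin n) ℝ} {k : ℕ}
    (h : ∀ i ∈ s, (a i).IsHomogeneous k) : (∑ i ∈ s, a i).IsHomogeneous k :=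
  isHomogeneous_iff.2 fun α hα => by
    rw [map_sum]
    exact Finset.sum_eq_zero fun i hi => isHomogeneous_iff.1 (h i hi) α hα

lemma homog_X_mul {a : MvPowerSeries (Fin n) ℝ} {k : ℕ} (h : a.IsHomogeneous k)
    (i : Fin n) : (X i * a).IsHomogeneous (k + 1) :=
  isHomogeneous_iff.2 fun α hα => by
    by_cases h0 : α i = 0
    · exact coeff_X_mul_of_eq_zero i _ h0
    · obtain ⟨β, rfl⟩ := exists_add_single h0
      rw [coeff_add_single_X_mul]
      refine isHomogeneous_iff.1 h β fun hβ => hα ?_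
      rw [map_add, Finsupp.degree_single, hβ]

lemma homog_pderiv {a : MvPowerSeries (Fin n) ℝ} {k : ℕ} (h : a.IsHomogeneous (k + 1))
    (i : Fin n) : (pderiv ℝ i a).IsHomogeneous k :=
  isHomogeneous_iff.2 fun α hα => by
    rw [coeff_pderiv, isHomogeneous_iff.1 h _ fun h0 => hα ?_, zero_mul]
    rw [map_add, Finsupp.degree_single] at h0
    omega

lemma homog_euler {a : MvPowerSeries (Fin n) ℝ} {k : ℕ} (h : a.IsHomogeneous k) :
    ∑ i, X i * pderiv ℝ i a = (k : ℝ) • a := by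
  ext α
  rw [map_sum, coeff_smul]
  simp only [coeff_X_mul_pderiv]
  rw [← Finset.sum_mul]
  by_cases hα : α.degree = k
  · congr 1
    rw [← hα, Finsupp.degree_eq_sum]
    push_cast
    rfl
  · rw [isHomogeneous_iff.1 h α hα, mul_zero, mul_zero]

lemma pderiv_X_mul (i j : Fin n) (a : MvPowerSeries (Fin n) ℝ) :
    pderiv ℝ i (X j * a) = (if i = j then a else 0) + X j * pderiv ℝ i a := by
  rw [Derivation.leibniz, smul_eq_mul, smul_eq_mul, add_comm]
  split_ifs with h
  · rw [h, pderiv_X_self, mul_one]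
  · rw [pderiv_X_of_ne (Ne.symm h), mul_zero]

lemma bnorm_X_mul_le (k : ℕ) (i : Fin n) (a : MvPowerSeries (Fin n) ℝ) :
    bnorm (k + 1) (X i * a) ≤ bnorm k a := by
  refine (bnorm_mul_le _ _ _).trans_eq ?_
  rw [Finset.sum_eq_single (1, k)]
  · have : bnorm 1 (X i : MvPowerSeries (Fin n) ℝ) = 1 := by
      classical
      rw [← sq_eq_sq₀ (bnorm_nonneg _ _) zero_le_one, bnorm_sq,
        Finset.sum_eq_single (Finsupp.single i 1)]
      · rw [coeff_X, if_pos rfl, wt, Finsupp.multinomial_eq]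
        simp
      · intro α _ hα
        rw [coeff_X, if_neg hα]
        ring
      · intro h
        exact absurd (mem_degIdx.2 (Finsupp.degree_single _ _)) h
    simp [this]
  · rintro ⟨p, q⟩ hpq hne
    have hpq := mem_antidiagonal.1 hpq
    simp only at hpq
    have : p ≠ 1 := fun h => hne (by rw [h] at hpq ⊢; congr 1; omega)
    classical
    rw [bnorm_of_degree_ne (k := p), zero_mul]
    intro α hα
    rw [coeff_X, if_neg]
    rintro rfl
    exact this (by rw [← hα, Finsupp.degree_single])
  · intro h
    exact absurd (mem_antidiagonal.2 (add_comm _ _)) h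

/-- The inner product of the Bombieri norm. -/
noncomputable def binner (k : ℕ) (a b : MvPowerSeries (Fin n) ℝ) : ℝ :=
  ∑ α ∈ degIdx n k, wt α * (coeff α a * coeff α b)

lemma inner_euclPart (k : ℕ) (a b : MvPowerSeries (Fin n) ℝ) :
    inner ℝ (euclPart k a) (euclPart k b) = binner k a b := by
  rw [binner, PiLp.inner_apply,
    ← Finset.sum_coe_sort (degIdx n k) fun α => wt α * (coeff α a * coeff α b)]
  refine Finset.sum_congr rfl fun α _ => ?_
  simp only [euclPart, LinearMap.coe_mk, AddHom.coe_mk]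
  have := Real.mul_self_sqrt (wt_pos α.1).le
  simp only [inner, RCLike.re_to_real]
  change √(wt α.1) * coeff α.1 b * (√(wt α.1) * coeff α.1 a) = _
  linear_combination (coeff α.1 b * coeff α.1 a) * this

/-- Reindexing along `β ↦ β + eᵢ` and the recursion of the weights make multiplication by `xᵢ` and
`∂ᵢ` adjoint up to the factor `k + 1`. -/
lemma binner_X_mul (k : ℕ) (i : Fin n) (a b : MvPowerSeries (Fin n) ℝ) :
    (k + 1) * binner (k + 1) (X i * a) b = binner k a (pderiv ℝ i b) := by
  classical
  have hinj : Set.InjOn (fun β : Fin n →₀ ℕ => β + Finsupp.single i 1) (degIdx n k) :=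
    (add_left_injective _).injOn
  have hsub : (degIdx n k).image (fun β => β + Finsupp.single i 1) ⊆ degIdx n (k + 1) := by
    intro γ hγ
    obtain ⟨β, hβ, rfl⟩ := Finset.mem_image.1 hγ
    rw [mem_degIdx, map_add, Finsupp.degree_single, mem_degIdx.1 hβ]
  rw [binner, binner, ← Finset.sum_subset hsub, Finset.sum_image hinj, Finset.mul_sum]
  · refine Finset.sum_congr rfl fun β hβ => ?_
    rw [coeff_add_single_X_mul, coeff_pderiv]
    linear_combination (coeff β a * coeff (β + Finsupp.single i 1) b) * wt_add_single i hβ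
  · intro α hα hα'
    have : α i = 0 := by
      by_contra h
      obtain ⟨β, rfl⟩ := exists_add_single h
      rw [mem_degIdx, map_add, Finsupp.degree_single] at hα
      exact hα' (Finset.mem_image_of_mem (fun β => β + Finsupp.single i 1)
        (mem_degIdx.2 (Nat.succ_injective hα)))
    rw [coeff_X_mul_of_eq_zero i _ this]
    ring

/-- The formal Laplacian. -/
noncomputable def laplace : MvPowerSeries (Fin n) ℝ →ₗ[ℝ] MvPowerSeries (Fin n) ℝ :=
  ∑ i, (pderiv ℝ i).toLinearMap ∘ₗ (pderiv ℝ i).toLinearMap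

lemma laplace_apply (a : MvPowerSeries (Fin n) ℝ) :
    laplace a = ∑ i, pderiv ℝ i (pderiv ℝ i a) := by
  simp [laplace]

/-- Multiplication by `|x|²`. -/
noncomputable def mulRadius : MvPowerSeries (Fin n) ℝ →ₗ[ℝ] MvPowerSeries (Fin n) ℝ :=
  ∑ i, LinearMap.mulLeft ℝ (X i) ∘ₗ LinearMap.mulLeft ℝ (X i)

lemma mulRadius_apply (a : MvPowerSeries (Fin n) ℝ) : mulRadius a = ∑ i, X i * (X i * a) := by
  simp [mulRadius]

/-- Moving both factors `xᵢ` to the other side turns the left factor `|x|²` into a Laplacian, so a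
positive multiple of this product equals the squared Bombieri norm of `Δa`. -/
lemma binner_mulRadius_laplace_nonneg (k : ℕ) (a : MvPowerSeries (Fin n) ℝ) :
    0 ≤ binner (k + 2) (mulRadius (laplace a)) a := by
  have h1 : ∀ i, ((k : ℝ) + 1) * ((k + 2) * binner (k + 2) (X i * (X i * laplace a)) a) =
      binner k (laplace a) (pderiv ℝ i (pderiv ℝ i a)) := by
    intro i
    rw [← binner_X_mul, ← binner_X_mul]
    push_cast
    ring
  have h2 : binner (k + 2) (mulRadius (laplace a)) a =
      ∑ i, binner (k + 2) (X i * (X i * laplace a)) a := by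
    simp only [binner, mulRadius_apply, map_sum]
    rw [Finset.sum_comm]
    simp only [Finset.sum_mul, Finset.mul_sum]
  have h3 : ((k : ℝ) + 1) * ((k + 2) * binner (k + 2) (mulRadius (laplace a)) a) =
      binner k (laplace a) (laplace a) := by
    rw [h2, Finset.mul_sum, Finset.mul_sum, Finset.sum_congr rfl fun i _ => h1 i]
    conv_rhs => rw [binner]; enter [2, α]; rw [laplace_apply (n := n) a]
    simp only [binner]
    rw [Finset.sum_comm]
    refine Finset.sum_congr rfl fun α _ => ?_
    rw [← Finset.mul_sum, ← Finset.mul_sum, laplace_apply, map_sum]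
  have h4 : 0 ≤ binner k (laplace a) (laplace a) := by
    rw [← inner_euclPart]
    exact real_inner_self_nonneg
  rw [← h3] at h4
  have h5 : (0 : ℝ) < (k + 1) * (k + 2) := by positivity
  rw [← mul_assoc] at h4
  exact nonneg_of_mul_nonneg_right h4 h5

lemma homog_laplace {a : MvPowerSeries (Fin n) ℝ} {k : ℕ} (h : a.IsHomogeneous (k + 2)) :
    (laplace a).IsHomogeneous k := by
  rw [laplace_apply]
  exact homog_sum fun i _ => homog_pderiv (homog_pderiv h i) i

lemma homog_mulRadius {a : MvPowerSeries (Fin n) ℝ} {k : ℕ} (h : a.IsHomogeneous k) :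
    (mulRadius a).IsHomogeneous (k + 2) := by
  rw [mulRadius_apply]
  exact homog_sum fun i _ => homog_X_mul (homog_X_mul h i) i

/-- Extension of a vector of coefficients of degree `k` by zero, as a function. -/
noncomputable def ofEuclFun (k : ℕ) (v : EuclideanSpace ℝ (degIdx n k)) : MvPowerSeries (Fin n) ℝ :=
  fun α => if h : α ∈ degIdx n k then (√(wt α))⁻¹ * v ⟨α, h⟩ else 0

lemma coeff_ofEuclFun (k : ℕ) (v : EuclideanSpace ℝ (degIdx n k)) (α : Fin n →₀ ℕ) :
    coeff α (ofEuclFun k v) = if h : α ∈ degIdx n k then (√(wt α))⁻¹ * v ⟨α, h⟩ else 0 := rfl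

/-- Extension of a vector of coefficients of degree `k` by zero. -/
noncomputable def ofEucl (k : ℕ) :
    EuclideanSpace ℝ (degIdx n k) →ₗ[ℝ] MvPowerSeries (Fin n) ℝ where
  toFun := ofEuclFun k
  map_add' v w := by
    ext α
    rw [map_add, coeff_ofEuclFun, coeff_ofEuclFun, coeff_ofEuclFun]
    split_ifs <;> simp [mul_add]
  map_smul' c v := by
    ext α
    rw [RingHom.id_apply, coeff_smul, coeff_ofEuclFun, coeff_ofEuclFun]
    split_ifs <;> simp [mul_left_comm]

lemma isHomogeneous_ofEucl (k : ℕ) (v : EuclideanSpace ℝ (degIdx n k)) :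
    (ofEucl k v).IsHomogeneous k :=
  isHomogeneous_iff.2 fun α hα => (coeff_ofEuclFun k v α).trans <| dif_neg fun h => hα (mem_degIdx.1 h)

lemma euclPart_ofEucl (k : ℕ) (v : EuclideanSpace ℝ (degIdx n k)) : euclPart k (ofEucl k v) = v := by
  ext α
  have h : √(wt α.1) ≠ 0 := (Real.sqrt_pos.2 (wt_pos α.1)).ne'
  change √(wt α.1) * coeff α.1 (ofEuclFun k v) = _
  rw [coeff_ofEuclFun, dif_pos α.2, mul_inv_cancel_left₀ h]

lemma homog_ext_euclPart {a b : MvPowerSeries (Fin n) ℝ} {k : ℕ} (ha : a.IsHomogeneous k)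
    (hb : b.IsHomogeneous k) (h : euclPart k a = euclPart k b) : a = b := by
  ext α
  by_cases hα : α.degree = k
  · have h1 : √(wt α) ≠ 0 := (Real.sqrt_pos.2 (wt_pos α)).ne'
    have h2 := congrArg (fun v => v ⟨α, mem_degIdx.2 hα⟩) h
    exact mul_left_cancel₀ h1 h2
  · rw [isHomogeneous_iff.1 ha α hα, isHomogeneous_iff.1 hb α hα]

/-- The operator `c + |x|² Δ` is invertible on homogeneous polynomials. -/
lemma exists_smul_add_mulRadius_laplace {c : ℝ} (hc : 0 < c) {k : ℕ} {r : MvPowerSeries (Fin n) ℝ}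
    (hr : r.IsHomogeneous (k + 2)) :
    ∃ a : MvPowerSeries (Fin n) ℝ, a.IsHomogeneous (k + 2) ∧ c • a + mulRadius (laplace a) = r ∧
      c * bnorm (k + 2) a ≤ bnorm (k + 2) r := by
  let T : EuclideanSpace ℝ (degIdx n (k + 2)) →ₗ[ℝ] EuclideanSpace ℝ (degIdx n (k + 2)) :=
    euclPart (k + 2) ∘ₗ (c • LinearMap.id + mulRadius ∘ₗ laplace) ∘ₗ ofEucl (k + 2)
  have hT : ∀ v, T v = euclPart (k + 2) (c • ofEucl (k + 2) v +
      mulRadius (laplace (ofEucl (k + 2) v))) := fun v => rfl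
  -- Coercivity with constant `c`, from the nonnegativity of `|x|²Δ`. It yields injectivity, hence
  -- bijectivity in finite dimension, and the bound for the inverse.
  have hpos : ∀ v, c * ‖v‖ ^ 2 ≤ inner ℝ (T v) v := by
    intro v
    rw [hT, map_add, map_smul, inner_add_left, inner_smul_left, euclPart_ofEucl,
      real_inner_self_eq_norm_sq]
    have := binner_mulRadius_laplace_nonneg k (ofEucl (k + 2) v)
    rw [← inner_euclPart, euclPart_ofEucl] at this
    simpa using this
  have hbd : ∀ v, c * ‖v‖ ≤ ‖T v‖ := by
    intro v
    rcases eq_or_ne v 0 with rfl | hv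
    · simp
    · have h1 := (hpos v).trans (real_inner_le_norm _ _)
      have h2 : 0 < ‖v‖ := norm_pos_iff.2 hv
      nlinarith
  have hinj : Function.Injective T := by
    rw [← LinearMap.ker_eq_bot, LinearMap.ker_eq_bot']
    intro v hv
    have := hbd v
    rw [hv, norm_zero] at this
    exact norm_le_zero_iff.1 (nonpos_of_mul_nonpos_right this hc)
  obtain ⟨v, hv⟩ := LinearMap.injective_iff_surjective.1 hinj (euclPart (k + 2) r)
  refine ⟨ofEucl (k + 2) v, isHomogeneous_ofEucl _ v, ?_, ?_⟩
  · refine homog_ext_euclPart (k := k + 2) ?_ hr (by rw [← hT, hv])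
    exact MvPowerSeries.IsHomogeneous.add (homog_smul (isHomogeneous_ofEucl _ v) c)
      (homog_mulRadius (homog_laplace (isHomogeneous_ofEucl _ v)))
  · have := hbd v
    rwa [hv, ← euclPart_ofEucl (k + 2) v] at this

end AnalyticNormalForm

/-! ### The linearized operators on homogeneous polynomials -/

namespace AnalyticNormalForm
open MvPowerSeries

variable {n : ℕ}

/-- The formal divergence. -/
noncomputable def divg (Y : Fin n → MvPowerSeries (Fin n) ℝ) : MvPowerSeries (Fin n) ℝ :=
  ∑ i, pderiv ℝ i (Y i)

/-- The formal pairing with the radial vector field. -/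
noncomputable def rdot (Y : Fin n → MvPowerSeries (Fin n) ℝ) : MvPowerSeries (Fin n) ℝ :=
  ∑ i, X i * Y i

/-- The linearization of the equation for normal coordinates, contracted with the radial field. -/
noncomputable def symOp (κ : ℝ) :
    (Fin n → MvPowerSeries (Fin n) ℝ) →ₗ[ℝ] (Fin n → MvPowerSeries (Fin n) ℝ) where
  toFun Y i := (1 / 2 : ℝ) • ∑ j, X j * (pderiv ℝ j (Y i) + pderiv ℝ i (Y j)) -
    κ • (X i * divg Y)
  map_add' Y Z := by
    funext i
    simp only [divg, Pi.add_apply, map_add, mul_add, Finset.sum_add_distrib, smul_add]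
    abel
  map_smul' c Y := by
    funext i
    simp only [divg, Pi.smul_apply, Derivation.map_smul, mul_smul_comm, ← smul_add,
      ← Finset.smul_sum, smul_sub, RingHom.id_apply]
    rw [smul_comm c, smul_comm c]

lemma symOp_apply (κ : ℝ) (Y : Fin n → MvPowerSeries (Fin n) ℝ) (i : Fin n) :
    symOp κ Y i = (1 / 2 : ℝ) • ∑ j, X j * (pderiv ℝ j (Y i) + pderiv ℝ i (Y j)) -
      κ • (X i * divg Y) := rfl

/-- The directional derivative along the radial field. -/
noncomputable def radOp :
    (Fin n → MvPowerSeries (Fin n) ℝ) →ₗ[ℝ] (Fin n → MvPowerSeries (Fin n) ℝ) where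
  toFun Y i := ∑ j, X j * pderiv ℝ j (Y i)
  map_add' Y Z := by
    funext i
    simp only [Pi.add_apply, map_add, mul_add, Finset.sum_add_distrib]
  map_smul' c Y := by
    funext i
    simp only [Pi.smul_apply, Derivation.map_smul, mul_smul_comm, ← Finset.smul_sum,
      RingHom.id_apply]

lemma radOp_apply (Y : Fin n → MvPowerSeries (Fin n) ℝ) (i : Fin n) :
    radOp Y i = ∑ j, X j * pderiv ℝ j (Y i) := rfl

lemma pderiv_rdot (Y : Fin n → MvPowerSeries (Fin n) ℝ) (i : Fin n) :
    pderiv ℝ i (rdot Y) = Y i + ∑ j, X j * pderiv ℝ i (Y j) := by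
  rw [rdot, map_sum]
  simp only [pderiv_X_mul, Finset.sum_add_distrib]
  simp

/-- Euler's identity and the product rule for `x·Y` leave only `Y`, the gradient of `x·Y` and the
divergence of `Y`. Hence the equation is solved once the scalars `x·Y` and `div Y` are known. -/
lemma symOp_homogeneous (κ : ℝ) {k : ℕ} {Y : Fin n → MvPowerSeries (Fin n) ℝ}
    (hY : ∀ i, (Y i).IsHomogeneous k) (i : Fin n) :
    symOp κ Y i = (1 / 2 : ℝ) • (((k : ℝ) - 1) • Y i + pderiv ℝ i (rdot Y)) -
      κ • (X i * divg Y) := by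
  rw [symOp_apply, pderiv_rdot]
  simp only [mul_add, Finset.sum_add_distrib, homog_euler (hY i)]
  module

lemma laplace_mulRadius {k : ℕ} {a : MvPowerSeries (Fin n) ℝ} (ha : a.IsHomogeneous k) :
    laplace (mulRadius a) = mulRadius (laplace a) + (4 * (k : ℝ) + 2 * n) • a := by
  have h : ∀ i j : Fin n, pderiv ℝ i (pderiv ℝ i (X j * (X j * a))) =
      (if i = j then (2 : ℝ) • a + (4 : ℝ) • (X i * pderiv ℝ i a) else 0) +
        X j * (X j * pderiv ℝ i (pderiv ℝ i a)) := by
    intro i j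
    by_cases hij : i = j
    · subst hij
      simp only [pderiv_X_mul, if_true, map_add]
      simp only [mul_add, ofNat_smul_eq_nsmul ℝ]
      module
    · simp only [pderiv_X_mul, hij, if_false, zero_add]
  rw [laplace_apply, mulRadius_apply, mulRadius_apply, laplace_apply]
  simp only [map_sum, h, Finset.sum_add_distrib, Finset.sum_ite_eq, Finset.mem_univ, if_true]
  rw [← Finset.smul_sum, ← Finset.smul_sum, homog_euler ha]
  simp only [Finset.mul_sum]
  rw [Finset.sum_comm (f := fun i j => X j * (X j * pderiv ℝ i (pderiv ℝ i a)))]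
  simp only [Finset.sum_const, Finset.card_univ, Fintype.card_fin, ← Nat.cast_smul_eq_nsmul ℝ]
  module

lemma rdot_add (Y Z : Fin n → MvPowerSeries (Fin n) ℝ) : rdot (Y + Z) = rdot Y + rdot Z := by
  simp [rdot, mul_add, Finset.sum_add_distrib]

lemma rdot_smul (c : ℝ) (Y : Fin n → MvPowerSeries (Fin n) ℝ) : rdot (c • Y) = c • rdot Y := by
  simp [rdot, Finset.smul_sum]

lemma divg_add (Y Z : Fin n → MvPowerSeries (Fin n) ℝ) : divg (Y + Z) = divg Y + divg Z := by
  simp [divg, Finset.sum_add_distrib]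

lemma divg_smul (c : ℝ) (Y : Fin n → MvPowerSeries (Fin n) ℝ) : divg (c • Y) = c • divg Y := by
  simp [divg, Finset.smul_sum]

lemma homog_rdot {k : ℕ} {Y : Fin n → MvPowerSeries (Fin n) ℝ}
    (hY : ∀ i, (Y i).IsHomogeneous k) : (rdot Y).IsHomogeneous (k + 1) :=
  homog_sum fun i _ => homog_X_mul (hY i) i

lemma homog_divg {k : ℕ} {Y : Fin n → MvPowerSeries (Fin n) ℝ}
    (hY : ∀ i, (Y i).IsHomogeneous (k + 1)) : (divg Y).IsHomogeneous k :=
  homog_sum fun i _ => homog_pderiv (hY i) i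

lemma bnorm_rdot_le (k : ℕ) (Y : Fin n → MvPowerSeries (Fin n) ℝ) :
    bnorm (k + 1) (rdot Y) ≤ ∑ i, bnorm k (Y i) :=
  (bnorm_sum_le _ _ _).trans (Finset.sum_le_sum fun i _ => bnorm_X_mul_le k i _)

lemma bnorm_divg_le (k : ℕ) (Y : Fin n → MvPowerSeries (Fin n) ℝ) :
    bnorm k (divg Y) ≤ (k + 1) * ∑ i, bnorm (k + 1) (Y i) := by
  rw [Finset.mul_sum]
  exact (bnorm_sum_le _ _ _).trans (Finset.sum_le_sum fun i _ => bnorm_pderiv_le k i _)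

lemma bnorm_laplace_le (k : ℕ) (a : MvPowerSeries (Fin n) ℝ) :
    bnorm k (laplace a) ≤ n * ((k + 1) * ((k + 2) * bnorm (k + 2) a)) := by
  rw [laplace_apply]
  refine (bnorm_sum_le _ _ _).trans ?_
  have h : ∀ i : Fin n, bnorm k (pderiv ℝ i (pderiv ℝ i a)) ≤
      (k + 1) * ((k + 2) * bnorm (k + 2) a) := fun i => by
    refine (bnorm_pderiv_le k i _).trans ?_
    gcongr
    refine (bnorm_pderiv_le (k + 1) i a).trans_eq ?_
    push_cast
    ring
  refine (Finset.sum_le_sum fun i _ => h i).trans_eq ?_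
  simp

lemma bnorm_mulRadius_le (k : ℕ) (a : MvPowerSeries (Fin n) ℝ) :
    bnorm (k + 2) (mulRadius a) ≤ n * bnorm k a := by
  rw [mulRadius_apply]
  refine (bnorm_sum_le _ _ _).trans ?_
  refine (Finset.sum_le_sum fun i _ => (bnorm_X_mul_le (k + 1) i _).trans
    (bnorm_X_mul_le k i a)).trans_eq ?_
  simp

lemma bnorm_sub_le (k : ℕ) (a b : MvPowerSeries (Fin n) ℝ) :
    bnorm k (a - b) ≤ bnorm k a + bnorm k b := by
  rw [sub_eq_add_neg, ← bnorm_neg k b]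
  exact bnorm_add_le _ _ _

lemma bnorm_le_sum (k : ℕ) (f : Fin n → MvPowerSeries (Fin n) ℝ) (i : Fin n) :
    bnorm k (f i) ≤ ∑ j, bnorm k (f j) :=
  Finset.single_le_sum (f := fun j => bnorm k (f j)) (fun _ _ => bnorm_nonneg _ _)
    (Finset.mem_univ i)

lemma exists_radOp_eq {k : ℕ} (hk : 2 ≤ k) {f : Fin n → MvPowerSeries (Fin n) ℝ}
    (hf : ∀ i, (f i).IsHomogeneous k) :
    ∃ Y : Fin n → MvPowerSeries (Fin n) ℝ, (∀ i, (Y i).IsHomogeneous k) ∧ radOp Y = f ∧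
      ∀ i, (k + 1) * bnorm k (Y i) ≤ 2 * ∑ j, bnorm k (f j) := by
  have hk' : (2 : ℝ) ≤ k := by exact_mod_cast hk
  have hY : ∀ i, ((k : ℝ)⁻¹ • f i).IsHomogeneous k := fun i => homog_smul (hf i) _
  refine ⟨fun i => (k : ℝ)⁻¹ • f i, hY, ?_, fun i => ?_⟩
  · funext i
    rw [radOp_apply, homog_euler (hY i), smul_smul, mul_inv_cancel₀ (by positivity), one_smul]
  · rw [bnorm_smul, abs_of_nonneg (by positivity), ← mul_assoc]
    refine mul_le_mul ?_ (bnorm_le_sum k f i) (bnorm_nonneg _ _) (by norm_num)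
    rw [← div_eq_mul_inv, div_le_iff₀ (by positivity)]
    linarith

/-- The equation reads `½((k−1)Y + ∇(x·Y)) = f`. Pairing with `x` and using Euler's identity in
degree `k + 1` gives `k (x·Y) = x·f`, after which `Y` can be read off; this needs `k ≠ 1`. -/
lemma exists_symOp_zero_eq {k : ℕ} (hk : 2 ≤ k) {f : Fin n → MvPowerSeries (Fin n) ℝ}
    (hf : ∀ i, (f i).IsHomogeneous k) :
    ∃ Y : Fin n → MvPowerSeries (Fin n) ℝ, (∀ i, (Y i).IsHomogeneous k) ∧ symOp 0 Y = f ∧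
      ∀ i, (k + 1) * bnorm k (Y i) ≤ 12 * ∑ j, bnorm k (f j) := by
  have hk' : (2 : ℝ) ≤ k := by exact_mod_cast hk
  have hk1 : (k : ℝ) - 1 ≠ 0 := by linarith
  have hk0 : (k : ℝ) ≠ 0 := by linarith
  have hψ : (rdot f).IsHomogeneous (k + 1) := homog_rdot hf
  let Y : Fin n → MvPowerSeries (Fin n) ℝ :=
    (2 / ((k : ℝ) - 1)) • (f + (-1 / (2 * k : ℝ)) • fun i => pderiv ℝ i (rdot f))
  have hYi : ∀ i, Y i = (2 / ((k : ℝ) - 1)) • (f i + (-1 / (2 * k : ℝ)) • pderiv ℝ i (rdot f)) :=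
    fun i => rfl
  have hY : ∀ i, (Y i).IsHomogeneous k := fun i =>
    homog_smul (MvPowerSeries.IsHomogeneous.add (hf i) (homog_smul (homog_pderiv hψ i) _)) _
  have hdot : rdot Y = (k : ℝ)⁻¹ • rdot f := by
    have h1 : rdot (fun i => pderiv ℝ i (rdot f)) = ((k + 1 : ℕ) : ℝ) • rdot f := homog_euler hψ
    simp only [Y]
    rw [rdot_smul, rdot_add, rdot_smul, h1]
    push_cast
    match_scalars
    field_simp
    ring
  refine ⟨Y, hY, ?_, fun i => ?_⟩
  · funext i
    rw [symOp_homogeneous 0 hY, hdot, Derivation.map_smul, hYi]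
    match_scalars <;> field_simp <;> ring
  · set S := ∑ j, bnorm k (f j)
    have hS : 0 ≤ S := Finset.sum_nonneg fun _ _ => bnorm_nonneg _ _
    have h1 : bnorm k (f i) ≤ S := bnorm_le_sum k f i
    have h2 : bnorm k (pderiv ℝ i (rdot f)) ≤ (k + 1) * S :=
      (bnorm_pderiv_le k i _).trans (by gcongr; exact bnorm_rdot_le k f)
    have h3 : bnorm k (f i + (-1 / (2 * k : ℝ)) • pderiv ℝ i (rdot f)) ≤ 2 * S := by
      refine (bnorm_add_le _ _ _).trans ?_
      rw [bnorm_smul, abs_div, abs_neg, abs_one, abs_of_pos (by positivity : (0 : ℝ) < 2 * k)]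
      have : 1 / (2 * k : ℝ) * ((k + 1) * S) ≤ S := by
        rw [← mul_assoc]
        refine mul_le_of_le_one_left hS ?_
        rw [div_mul_eq_mul_div, div_le_one (by positivity)]
        linarith
      have h5 : 1 / (2 * k : ℝ) * bnorm k (pderiv ℝ i (rdot f)) ≤ S :=
        le_trans (by gcongr) this
      linarith
    rw [hYi, bnorm_smul, abs_of_nonneg (div_nonneg (by norm_num) (by linarith)), ← mul_assoc]
    have h4 : ((k : ℝ) + 1) * (2 / (k - 1)) ≤ 6 := by
      rw [mul_div_assoc', div_le_iff₀ (by linarith)]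
      linarith
    calc _ ≤ 6 * (2 * S) := mul_le_mul h4 h3 (bnorm_nonneg _ _) (by norm_num)
      _ = _ := by ring

end AnalyticNormalForm

/-! ### The trace-free linearized equation and the passage to the Banach algebra -/

namespace AnalyticNormalForm
open MvPowerSeries

variable {n : ℕ}

lemma divergence_bound {N K S : ℝ} (hN : 3 ≤ N) (hK : 3 ≤ K) (hS : 0 ≤ S) :
    2 * N * K * (K * S) + N * (N * (K * ((K + 1) * S))) ≤ (K - 1) * (K - 2) * (16 * N ^ 2 * S) := by
  have h1 : 2 * N ≤ N ^ 2 := by nlinarith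
  have h2 : 0 ≤ K * K * S := by positivity
  have h3 := mul_le_mul_of_nonneg_right h1 h2
  have h4 : K * K + K * (K + 1) ≤ (K - 1) * (K - 2) * 16 := by nlinarith
  have h5 := mul_le_mul_of_nonneg_left h4 (by positivity : 0 ≤ N ^ 2 * S)
  linarith

/-- Put `φ = x·Y` and `D = div Y`. Pairing the equation with `x` gives `kφ = |x|²D/n + x·f`. Taking
its divergence, inserting this `φ` and commuting `Δ` with `|x|²` gives `cD + |x|²ΔD = 2nk div f −
nΔ(x·f)` with `c = (n−2)(k−1)(k−2)`. Positivity of `c` makes this solvable for `D`, and then `φ` and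
`Y` follow. -/
lemma exists_symOp_inv_eq (hn : 3 ≤ n) {k : ℕ} (hk : 3 ≤ k)
    {f : Fin n → MvPowerSeries (Fin n) ℝ} (hf : ∀ i, (f i).IsHomogeneous k) :
    ∃ Y : Fin n → MvPowerSeries (Fin n) ℝ, (∀ i, (Y i).IsHomogeneous k) ∧
      symOp (n : ℝ)⁻¹ Y = f ∧
      ∀ i, (k + 1) * bnorm k (Y i) ≤ 200 * n ^ 2 * ∑ j, bnorm k (f j) := by
  obtain ⟨d, rfl⟩ : ∃ d, k = d + 3 := ⟨k - 3, by omega⟩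
  set K : ℝ := (d : ℝ) + 3 with hK
  have hKk : ((d + 3 : ℕ) : ℝ) = K := by push_cast; rfl
  have hK3 : 3 ≤ K := by simp [hK]
  have hn3 : (3 : ℝ) ≤ n := by exact_mod_cast hn
  have hψ : (rdot f).IsHomogeneous (d + 4) := homog_rdot hf
  have hδ : (divg f).IsHomogeneous (d + 2) := homog_divg hf
  set c : ℝ := (n - 2) * ((K - 1) * (K - 2)) with hc
  have hK12 : 0 < (K - 1) * (K - 2) := mul_pos (by linarith) (by linarith)
  have hc1 : (K - 1) * (K - 2) ≤ c := le_mul_of_one_le_left hK12.le (by linarith)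
  set ρ : MvPowerSeries (Fin n) ℝ := (2 * n * K) • divg f - (n : ℝ) • laplace (rdot f) with hρ_def
  have hρ : ρ.IsHomogeneous (d + 2) :=
    homog_sub (homog_smul hδ _) (homog_smul (homog_laplace hψ) _)
  obtain ⟨D, hD, hDeq, hDle⟩ := exists_smul_add_mulRadius_laplace (hK12.trans_le hc1) hρ
  set φ : MvPowerSeries (Fin n) ℝ := K⁻¹ • ((n : ℝ)⁻¹ • mulRadius D + rdot f) with hφ_def
  have hφ : φ.IsHomogeneous (d + 4) :=
    homog_smul (MvPowerSeries.IsHomogeneous.add (homog_smul (homog_mulRadius hD) _) hψ) _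
  let Y : Fin n → MvPowerSeries (Fin n) ℝ :=
    (2 / (K - 1)) • (f + ((n : ℝ)⁻¹ • (fun i => X i * D) + (-1 / 2 : ℝ) • fun i => pderiv ℝ i φ))
  have hYi : ∀ i, Y i = (2 / (K - 1)) •
    (f i + ((n : ℝ)⁻¹ • (X i * D) + (-1 / 2 : ℝ) • pderiv ℝ i φ)) := fun i => rfl
  have hY : ∀ i, (Y i).IsHomogeneous (d + 3) := fun i =>
    homog_smul (MvPowerSeries.IsHomogeneous.add (hf i) (MvPowerSeries.IsHomogeneous.add
      (homog_smul (homog_X_mul hD i) _) (homog_smul (homog_pderiv hφ i) _))) _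
  have hK1 : K - 1 ≠ 0 := by linarith
  have hK0 : K ≠ 0 := by linarith
  have hn0 : (n : ℝ) ≠ 0 := by linarith
  -- `D` and `φ` were introduced as the solutions of the derived scalar equations; they now have to
  -- be recognized as `div Y` and `x·Y`.
  have hdot : rdot Y = φ := by
    have h1 : rdot (fun i => pderiv ℝ i φ) = (K + 1) • φ := by
      rw [show K + 1 = ((d + 4 : ℕ) : ℝ) by push_cast; ring]
      exact homog_euler hφ
    have h2 : rdot (fun i => X i * D) = mulRadius D := (mulRadius_apply D).symm
    simp only [Y]
    rw [rdot_smul, rdot_add, rdot_add, rdot_smul, rdot_smul, h1, h2, hφ_def]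
    match_scalars <;> field_simp <;> ring
  have hdiv : divg Y = D := by
    have h1 : divg (fun i => X i * D) = (n + K - 1) • D := by
      simp only [divg, pderiv_X_mul, if_true, Finset.sum_add_distrib, homog_euler hD]
      simp only [Finset.sum_const, Finset.card_univ, Fintype.card_fin,
        ← Nat.cast_smul_eq_nsmul ℝ]
      have h2 : (n : ℝ) + K - 1 = n + ((d + 2 : ℕ) : ℝ) := by
        rw [hK]
        push_cast
        ring
      rw [← add_smul, h2]
    have h2 : divg (fun i => pderiv ℝ i φ) = laplace φ := (laplace_apply φ).symm
    have h3 : laplace φ = K⁻¹ • ((n : ℝ)⁻¹ • ((2 * n * K) • divg f - (n : ℝ) • laplace (rdot f)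
        - c • D + (4 * (K - 1) + 2 * n) • D) + laplace (rdot f)) := by
      have h4 : 4 * ((d + 2 : ℕ) : ℝ) + 2 * n = 4 * (K - 1) + 2 * n := by
        rw [hK]
        push_cast
        ring
      rw [hφ_def, map_smul, map_add, map_smul, laplace_mulRadius hD, ← hρ_def, ← hDeq,
        add_sub_cancel_left, h4]
    simp only [Y]
    rw [divg_smul, divg_add, divg_add, divg_smul, divg_smul, h1, h2, h3, hc]
    match_scalars <;> field_simp <;> ring
  refine ⟨Y, hY, ?_, fun i => ?_⟩
  · funext i
    rw [symOp_homogeneous _ hY, hdot, hdiv, hYi, hKk]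
    match_scalars <;> field_simp <;> ring
  · set S := ∑ j, bnorm (d + 3) (f j)
    have hS : 0 ≤ S := Finset.sum_nonneg fun _ _ => bnorm_nonneg _ _
    have b1 : bnorm (d + 3) (f i) ≤ S := bnorm_le_sum _ f i
    have b2 : bnorm (d + 4) (rdot f) ≤ S := bnorm_rdot_le _ f
    have b3 : bnorm (d + 2) (divg f) ≤ K * S := by
      refine (bnorm_divg_le _ f).trans_eq ?_
      rw [hK]
      push_cast
      ring
    clear hdot hdiv hY hφ hρ hψ hδ hDeq hD
    clear_value Y φ ρ c K S
    have b4 : bnorm (d + 2) (laplace (rdot f)) ≤ n * (K * ((K + 1) * S)) := by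
      refine (bnorm_laplace_le (d + 2) _).trans ?_
      have e1 : ((d + 2 : ℕ) : ℝ) + 1 = K := by rw [hK]; push_cast; ring
      have e2 : ((d + 2 : ℕ) : ℝ) + 2 = K + 1 := by rw [hK]; push_cast; ring
      rw [e1, e2]
      gcongr
    have b5 : bnorm (d + 2) ρ ≤ 2 * n * K * (K * S) + n * (n * (K * ((K + 1) * S))) := by
      rw [hρ_def]
      refine (bnorm_sub_le _ _ _).trans ?_
      rw [bnorm_smul, bnorm_smul, abs_of_nonneg (by positivity), abs_of_nonneg (by positivity)]
      gcongr
    -- The right-hand side `ρ` costs a factor of order `K²`, and the lower bound `(K − 1)(K − 2)`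
    -- for `c` absorbs it; so the estimate of `D` is uniform in the degree.
    have b6 : bnorm (d + 2) D ≤ 16 * n ^ 2 * S := by
      have h1 : (K - 1) * (K - 2) * bnorm (d + 2) D ≤
          (K - 1) * (K - 2) * (16 * n ^ 2 * S) := by
        refine (mul_le_mul_of_nonneg_right hc1 (bnorm_nonneg _ _)).trans (hDle.trans (b5.trans ?_))
        exact divergence_bound hn3 hK3 hS
      exact le_of_mul_le_mul_left h1 hK12
    have b7 : bnorm (d + 4) φ ≤ K⁻¹ * (17 * n ^ 2 * S) := by
      rw [hφ_def, bnorm_smul, abs_of_nonneg (by positivity)]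
      gcongr
      refine (bnorm_add_le _ _ _).trans ?_
      rw [bnorm_smul, abs_of_nonneg (by positivity)]
      have h1 : (n : ℝ)⁻¹ * bnorm (d + 4) (mulRadius D) ≤ bnorm (d + 2) D := by
        rw [inv_mul_le_iff₀ (by positivity)]
        exact bnorm_mulRadius_le _ _
      have h2 : S ≤ n ^ 2 * S := le_mul_of_one_le_left hS (by nlinarith)
      linarith
    have b8 : bnorm (d + 3) (pderiv ℝ i φ) ≤ 34 * n ^ 2 * S := by
      refine (bnorm_pderiv_le _ i φ).trans ?_
      rw [hKk]
      calc (K + 1) * bnorm (d + 4) φ ≤ (K + 1) * (K⁻¹ * (17 * n ^ 2 * S)) := by gcongr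
        _ = ((K + 1) * K⁻¹) * (17 * n ^ 2 * S) := by ring
        _ ≤ 2 * (17 * n ^ 2 * S) := by
            gcongr
            rw [← div_eq_mul_inv, div_le_iff₀ (by linarith)]
            linarith
        _ = _ := by ring
    have b9 : bnorm (d + 3) (f i + ((n : ℝ)⁻¹ • (X i * D) + (-1 / 2 : ℝ) • pderiv ℝ i φ)) ≤
        50 * n ^ 2 * S := by
      refine (bnorm_add_le _ _ _).trans ?_
      have h0 := bnorm_add_le (d + 3) ((n : ℝ)⁻¹ • (X i * D)) ((-1 / 2 : ℝ) • pderiv ℝ i φ)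
      rw [bnorm_smul, bnorm_smul, abs_of_nonneg (by positivity : (0 : ℝ) ≤ (n : ℝ)⁻¹)] at h0
      have h1 : (n : ℝ)⁻¹ * bnorm (d + 3) (X i * D) ≤ 16 * n ^ 2 * S :=
        (mul_le_of_le_one_left (bnorm_nonneg _ _) (inv_le_one_of_one_le₀ (by linarith))).trans
          ((bnorm_X_mul_le _ _ _).trans b6)
      have h2 : S ≤ n ^ 2 * S := le_mul_of_one_le_left hS (by nlinarith)
      have h3 : |(-1 / 2 : ℝ)| = 1 / 2 := by norm_num [abs_div]
      rw [h3] at h0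
      linarith
    rw [hYi, bnorm_smul, abs_of_nonneg (div_nonneg (by norm_num) (by linarith)), ← mul_assoc, hKk]
    have h4 : (K + 1) * (2 / (K - 1)) ≤ 4 := by
      rw [mul_div_assoc', div_le_iff₀ (by linarith)]
      linarith
    calc _ ≤ 4 * (50 * n ^ 2 * S) := mul_le_mul h4 b9 (bnorm_nonneg _ _) (by norm_num)
      _ = _ := by ring

/-- The operators `xᵢ∂ⱼ` preserve the degree. The linearized operators are built from them, so they
can be inverted degree by degree. -/
lemma homogeneousComponent_X_mul_pderiv (k : ℕ) (i j : Fin n) (a : MvPowerSeries (Fin n) ℝ) :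
    homogeneousComponent k (X i * pderiv ℝ j a) =
      X i * pderiv ℝ j (homogeneousComponent k a) := by
  ext α
  rw [coeff_homogeneousComponent]
  by_cases h : α i = 0
  · rw [coeff_X_mul_of_eq_zero i _ h, coeff_X_mul_of_eq_zero i _ h, ite_self]
  · obtain ⟨β, rfl⟩ := exists_add_single h
    rw [coeff_add_single_X_mul, coeff_add_single_X_mul, coeff_pderiv, coeff_pderiv,
      coeff_homogeneousComponent]
    simp only [map_add, Finsupp.degree_single]
    split_ifs <;> simp

lemma homogeneousComponent_symOp (κ : ℝ) (k : ℕ) (Y : Fin n → MvPowerSeries (Fin n) ℝ) (i : Fin n) :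
    homogeneousComponent k (symOp κ Y i) =
      symOp κ (fun j => homogeneousComponent k (Y j)) i := by
  simp only [symOp_apply, divg, Finset.mul_sum, mul_add, map_sub, map_smul, map_sum, map_add,
    homogeneousComponent_X_mul_pderiv]

lemma homogeneousComponent_radOp (k : ℕ) (Y : Fin n → MvPowerSeries (Fin n) ℝ) (i : Fin n) :
    homogeneousComponent k (radOp Y i) = radOp (fun j => homogeneousComponent k (Y j)) i := by
  simp only [radOp_apply, map_sum, homogeneousComponent_X_mul_pderiv]

namespace PSeries

lemma cut_eq_self_iff {m : ℕ} {a : PSeries n} :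
    cut m a = a ↔ ∀ α : Fin n →₀ ℕ, α.degree < m → coeff α a.val = 0 := by
  constructor
  · intro h α hα
    rw [← h, coeff_cut, if_pos hα]
  · intro h
    ext α
    rw [coeff_cut]
    split_ifs with hα
    · rw [h α hα]
    · rfl

/-- An operator which can be inverted on homogeneous polynomials with a gain of one degree can be
inverted on the Banach algebra of power series. -/
lemma exists_smoothen_eq
    (O : (Fin n → MvPowerSeries (Fin n) ℝ) →ₗ[ℝ] (Fin n → MvPowerSeries (Fin n) ℝ))
    (hO : ∀ k Y i, homogeneousComponent k (O Y i) = O (fun j => homogeneousComponent k (Y j)) i)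
    {m : ℕ} {K : ℝ}
    (hsolve : ∀ k, m ≤ k → ∀ f : Fin n → MvPowerSeries (Fin n) ℝ, (∀ i, (f i).IsHomogeneous k) →
      ∃ Y : Fin n → MvPowerSeries (Fin n) ℝ, (∀ i, (Y i).IsHomogeneous k) ∧ O Y = f ∧
        ∀ i, (k + 1) * bnorm k (Y i) ≤ K * ∑ j, bnorm k (f j))
    (f : Fin n → PSeries n) (hf : ∀ i, cut m (f i) = f i) :
    ∃ Y : Fin n → PSeries n, (∀ i, cut m (Y i) = Y i) ∧
      O (fun i => (smoothen (Y i)).val) = fun i => (f i).val := by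
  have h1 : ∀ k, ∃ Y : Fin n → MvPowerSeries (Fin n) ℝ, m ≤ k → (∀ i, (Y i).IsHomogeneous k) ∧
      O Y = (fun i => homogeneousComponent k (f i).val) ∧
      ∀ i, (k + 1) * bnorm k (Y i) ≤ K * ∑ j, bnorm k (f j).val := by
    intro k
    by_cases hk : m ≤ k
    · obtain ⟨Y, h1, h2, h3⟩ := hsolve k hk (fun i => homogeneousComponent k (f i).val)
        fun i => isHomogeneous_homogeneousComponent _ _
      refine ⟨Y, fun _ => ⟨h1, h2, fun i => (h3 i).trans_eq ?_⟩⟩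
      have h4 : ∀ j, bnorm k (homogeneousComponent k (f j).val) = bnorm k (f j).val := fun j =>
        bnorm_congr fun α hα => by rw [coeff_homogeneousComponent, if_pos hα]
      simp only [h4]
    · exact ⟨0, fun h => absurd h hk⟩
  choose Z hZ using h1
  -- The solution of degree `k` is stored multiplied by `k + 1`: the gain of one degree keeps this
  -- summable, and `smoothen` removes the factor again.
  let y : Fin n → MvPowerSeries (Fin n) ℝ := fun i α =>
    if α.degree < m then 0 else ((α.degree : ℝ) + 1) * coeff α (Z α.degree i)
  have hy : ∀ i α, coeff α (y i) =
    if α.degree < m then 0 else ((α.degree : ℝ) + 1) * coeff α (Z α.degree i) := fun _ _ => rfl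
  have hyb : ∀ i k, bnorm k (y i) ≤ |K| * ∑ j, bnorm k (f j).val := by
    intro i k
    have hS : 0 ≤ ∑ j, bnorm k (f j).val := Finset.sum_nonneg fun _ _ => bnorm_nonneg _ _
    by_cases hk : m ≤ k
    · have : bnorm k (y i) = bnorm k (((k : ℝ) + 1) • Z k i) := bnorm_congr fun α hα => by
        rw [hy, if_neg (by omega), coeff_smul, hα]
      rw [this, bnorm_smul, abs_of_nonneg (by positivity)]
      exact ((hZ k hk).2.2 i).trans (mul_le_mul_of_nonneg_right (le_abs_self K) hS)
    · rw [bnorm_of_degree_ne fun α hα => by rw [hy, if_pos (by omega)]]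
      positivity
  have hys : ∀ i, Summable fun k => bnorm k (y i) := fun i =>
    ((summable_sum fun j _ => (f j).summable).mul_left |K|).of_nonneg_of_le
      (fun k => bnorm_nonneg _ _) (hyb i)
  have hcomp : ∀ k, O (fun i => homogeneousComponent k (smoothen (mk (y i) (hys i))).val) =
      fun i => homogeneousComponent k (f i).val := by
    intro k
    by_cases hk : m ≤ k
    · rw [← (hZ k hk).2.1]
      refine congrArg O (funext fun i => ?_)
      ext α
      rw [coeff_homogeneousComponent, coeff_smoothen, val_mk, hy]
      split_ifs with h1 h2
      · omega
      · rw [h1]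
        have : (k : ℝ) + 1 ≠ 0 := by positivity
        field_simp
      · exact (isHomogeneous_iff.1 ((hZ k hk).1 i) α h1).symm
    · have h1 : (fun i => homogeneousComponent k (smoothen (mk (y i) (hys i))).val) = 0 := by
        funext i
        ext α
        rw [coeff_homogeneousComponent, coeff_smoothen, val_mk, hy]
        split_ifs with h1 h2
        · simp
        · omega
        · rfl
      rw [h1, map_zero]
      funext i
      ext α
      rw [coeff_homogeneousComponent]
      split_ifs with h1
      · rw [cut_eq_self_iff.1 (hf i) α (by omega)]; rfl
      · rfl
  refine ⟨fun i => mk (y i) (hys i), fun i => cut_eq_self_iff.2 fun α hα => ?_, ?_⟩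
  · rw [val_mk, hy, if_pos hα]
  · funext i
    ext α
    have h1 := congrArg (coeff α) (hO α.degree (fun i => (smoothen (mk (y i) (hys i))).val) i)
    rw [hcomp, coeff_homogeneousComponent, coeff_homogeneousComponent, if_pos rfl, if_pos rfl] at h1
    exact h1

end PSeries

end AnalyticNormalForm

/-! ### Order of vanishing, and functions that vanish to first or second order -/

namespace AnalyticNormalForm
open MvPowerSeries
open Finset.HasAntidiagonal (antidiagonal mem_antidiagonal)

variable {n : ℕ}

namespace PSeries

/-- The coordinate functions as elements of the Banach algebra. -/
noncomputable def coord (i : Fin n) : PSeries n :=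
  mk (X i) <| by
    refine summable_of_ne_finset_zero (s := {1}) fun k hk => bnorm_of_degree_ne fun α hα => ?_
    classical
    rw [coeff_X, if_neg]
    rintro rfl
    rw [Finsupp.degree_single] at hα
    exact hk (by simp [hα])

lemma val_coord (i : Fin n) : (coord i).val = X i := rfl

/-- The ideal of power series without terms of degree less than `m`. -/
noncomputable def ord (n m : ℕ) : Ideal (PSeries n) where
  carrier := {a | ∀ α : Fin n →₀ ℕ, α.degree < m → coeff α a.val = 0}
  add_mem' ha hb α hα := by rw [val_add, map_add, ha α hα, hb α hα, add_zero]
  zero_mem' α _ := by rw [val_zero, map_zero]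
  smul_mem' c a ha α hα := by
    classical
    rw [smul_eq_mul, val_mul, coeff_mul]
    refine Finset.sum_eq_zero fun x hx => ?_
    rw [ha x.2, mul_zero]
    rw [← mem_antidiagonal.1 hx, map_add] at hα
    omega

lemma cut_eq_self {m : ℕ} {a : PSeries n} : cut m a = a ↔ a ∈ ord n m := cut_eq_self_iff

lemma cut_mem (m : ℕ) (a : PSeries n) : cut m a ∈ ord n m := fun α hα => by
  rw [coeff_cut, if_pos hα]

lemma mul_mem_ord {p q : ℕ} {a b : PSeries n} (ha : a ∈ ord n p) (hb : b ∈ ord n q) :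
    a * b ∈ ord n (p + q) := by
  classical
  intro α hα
  rw [val_mul, coeff_mul]
  refine Finset.sum_eq_zero fun x hx => ?_
  rw [← mem_antidiagonal.1 hx, map_add] at hα
  by_cases h : x.1.degree < p
  · rw [ha x.1 h, zero_mul]
  · rw [hb x.2 (by omega), mul_zero]

lemma ord_anti {p q : ℕ} (h : p ≤ q) : ord n q ≤ ord n p := fun _ ha α hα => ha α (hα.trans_le h)

lemma smul_mem_ord {p : ℕ} {a : PSeries n} (c : ℝ) (ha : a ∈ ord n p) : c • a ∈ ord n p :=
  fun α hα => by rw [val_smul, coeff_smul, ha α hα, mul_zero]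

lemma smoothen_mem {p : ℕ} {a : PSeries n} (ha : a ∈ ord n p) : smoothen a ∈ ord n p :=
  fun α hα => by rw [coeff_smoothen, ha α hα, mul_zero]

lemma dsmoothen_mem {p : ℕ} {a : PSeries n} (ha : a ∈ ord n p) (i : Fin n) :
    dsmoothen i a ∈ ord n (p - 1) :=
  fun α hα => by
    rw [val_dsmoothen, coeff_pderiv, coeff_smoothen, ha, mul_zero, zero_mul]
    rw [map_add, Finsupp.degree_single]
    omega

lemma coord_mem (i : Fin n) : coord i ∈ ord n 1 := fun α hα => by
  classical
  rw [val_coord, coeff_X, if_neg]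
  rintro rfl
  simp at hα

end PSeries

/-- A function which vanishes and is strictly differentiable at `0`. -/
def VanishesStrict {E F : Type*} [NormedAddCommGroup E] [NormedSpace ℝ E] [NormedAddCommGroup F]
    [NormedSpace ℝ F] (f : E → F) : Prop :=
  f 0 = 0 ∧ ∃ f' : E →L[ℝ] F, HasStrictFDerivAt f f' 0

/-- A function which vanishes with its strict derivative at `0`. -/
def VanishesTwice {E F : Type*} [NormedAddCommGroup E] [NormedSpace ℝ E] [NormedAddCommGroup F]
    [NormedSpace ℝ F] (f : E → F) : Prop :=
  f 0 = 0 ∧ HasStrictFDerivAt f (0 : E →L[ℝ] F) 0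

section Vanish

variable {E F R : Type*} [NormedAddCommGroup E] [NormedSpace ℝ E] [NormedAddCommGroup F]
  [NormedSpace ℝ F] [NormedCommRing R] [NormedAlgebra ℝ R]

lemma VanishesTwice.strict {f : E → F} (h : VanishesTwice f) : VanishesStrict f :=
  ⟨h.1, _, h.2⟩

lemma _root_.ContinuousLinearMap.vanishesStrict (f : E →L[ℝ] F) : VanishesStrict fun x => f x :=
  ⟨map_zero f, f, f.hasStrictFDerivAt⟩

lemma VanishesStrict.add {f g : E → F} (hf : VanishesStrict f) (hg : VanishesStrict g) :
    VanishesStrict fun x => f x + g x :=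
  let ⟨f', hf'⟩ := hf.2
  let ⟨g', hg'⟩ := hg.2
  ⟨by simp [hf.1, hg.1], f' + g', hf'.add hg'⟩

lemma VanishesTwice.add {f g : E → F} (hf : VanishesTwice f) (hg : VanishesTwice g) :
    VanishesTwice fun x => f x + g x :=
  ⟨by simp [hf.1, hg.1], by simpa using hf.2.fun_add hg.2⟩

lemma VanishesTwice.sub {f g : E → F} (hf : VanishesTwice f) (hg : VanishesTwice g) :
    VanishesTwice fun x => f x - g x :=
  ⟨by simp [hf.1, hg.1], by simpa using hf.2.fun_sub hg.2⟩

lemma VanishesTwice.sum {ι : Type*} (s : Finset ι) {f : ι → E → F}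
    (h : ∀ i ∈ s, VanishesTwice (f i)) : VanishesTwice fun x => ∑ i ∈ s, f i x :=
  ⟨Finset.sum_eq_zero fun i hi => (h i hi).1,
    by simpa using HasStrictFDerivAt.fun_sum fun i hi => (h i hi).2⟩

lemma VanishesTwice.clm {G : Type*} [NormedAddCommGroup G] [NormedSpace ℝ G] {f : E → F}
    (h : VanishesTwice f) (T : F →L[ℝ] G) : VanishesTwice fun x => T (f x) :=
  ⟨by simp only [h.1, map_zero], by simpa using T.hasStrictFDerivAt.comp 0 h.2⟩

lemma VanishesStrict.mul {f g : E → R} (hf : VanishesStrict f) (hg : VanishesStrict g) :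
    VanishesTwice fun x => f x * g x :=
  let ⟨_, hf'⟩ := hf.2
  let ⟨_, hg'⟩ := hg.2
  ⟨by simp [hf.1], (hf'.fun_mul hg').congr_fderiv (by ext v; simp [hf.1, hg.1])⟩

lemma vanishesTwice_matrix_mul {f g : E → Matrix (Fin n) (Fin n) R}
    (hf : ∀ i j, VanishesStrict fun x => f x i j) (hg : ∀ i j, VanishesStrict fun x => g x i j)
    (i j : Fin n) : VanishesTwice fun x => (f x * g x) i j := by
  simp only [Matrix.mul_apply]
  exact VanishesTwice.sum _ fun k _ => (hf i k).mul (hg k j)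

end Vanish

end AnalyticNormalForm

/-! ### The equation for metrics and its linearization -/

namespace AnalyticNormalForm
open MvPowerSeries

variable {n : ℕ}

namespace PSeries

/-- The Jacobian matrix of the map with the components `smoothen (Y i)`. -/
noncomputable def jacS (Y : Fin n → PSeries n) : Matrix (Fin n) (Fin n) (PSeries n) :=
  Matrix.of fun i j => dsmoothen j (Y i)

@[simp] lemma jacS_apply (Y : Fin n → PSeries n) (i j : Fin n) : jacS Y i j = dsmoothen j (Y i) :=
  rfl

/-- Identifies `symOp` as the symmetric part of the Jacobian of `X` applied to `x`, minus `κ` times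
the divergence of `X` times `x`. -/
lemma val_symOp (κ : ℝ) (Y : Fin n → PSeries n) (i : Fin n) :
    ((1 / 2 : ℝ) • ∑ j, (jacS Y i j + jacS Y j i) * coord j -
      κ • ((∑ l, jacS Y l l) * coord i)).val = symOp κ (fun j => (smoothen (Y j)).val) i := by
  rw [symOp_apply, divg]
  simp only [val_sub, val_smul, val_mul, val_sum, val_add, jacS_apply, val_dsmoothen, val_coord]
  simp only [mul_comm]

/-- The unknowns and parameters of the equation for normal coordinates. -/
abbrev Dom (n : ℕ) : Type :=
  (Fin n → Fin n → PSeries n) × (Fin n → PSeries n) × (Fin n → Fin n → PSeries n)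

/-- The range of the equation for normal coordinates. -/
abbrev Cod (n : ℕ) : Type :=
  (Fin n → Fin n → PSeries n) × (Fin n → Fin n → PSeries n) × (Fin n → PSeries n)

noncomputable def cη (i j : Fin n) : Dom n →L[ℝ] PSeries n :=
  ContinuousLinearMap.proj j ∘L ContinuousLinearMap.proj i ∘L ContinuousLinearMap.fst ℝ _ _

noncomputable def cY (i : Fin n) : Dom n →L[ℝ] PSeries n :=
  ContinuousLinearMap.proj i ∘L ContinuousLinearMap.fst ℝ _ _ ∘L ContinuousLinearMap.snd ℝ _ _

noncomputable def ct (i j : Fin n) : Dom n →L[ℝ] PSeries n :=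
  ContinuousLinearMap.proj j ∘L ContinuousLinearMap.proj i ∘L ContinuousLinearMap.snd ℝ _ _ ∘L
    ContinuousLinearMap.snd ℝ _ _

@[simp] lemma cη_apply (i j : Fin n) (p : Dom n) : cη i j p = p.1 i j := rfl
@[simp] lemma cY_apply (i : Fin n) (p : Dom n) : cY i p = p.2.1 i := rfl
@[simp] lemma ct_apply (i j : Fin n) (p : Dom n) : ct i j p = p.2.2 i j := rfl

noncomputable def cd (m : ℕ) (i j : Fin n) : Dom n →L[ℝ] PSeries n :=
  dsmoothen j ∘L cut m ∘L cY i

noncomputable def cX (m : ℕ) (i : Fin n) : Dom n →L[ℝ] PSeries n :=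
  smoothen ∘L cut m ∘L cY i

/-- The unknown `s`. It is obtained by symmetrizing and truncating a free matrix `t`, so that the
equation lives on full product spaces and not on subspaces of symmetric matrices of given order. -/
noncomputable def cs (m : ℕ) (i j : Fin n) : Dom n →L[ℝ] PSeries n :=
  (1 / 2 : ℝ) • (cut (m - 1) ∘L (ct i j + ct j i))

/-- The linear part of `(1 + s)² = (1 + DX)(1 + η)(1 + DX)ᵗ` contains `2s`; one `s` is replaced by
`t`. The skew and low-degree parts of `t` make the range the whole space, and for symmetric `η` of
sufficient order the equation still forces the original one. -/
noncomputable def linear₁ (m : ℕ) (i j : Fin n) : Dom n →L[ℝ] PSeries n :=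
  cs m i j + ct i j - cη i j - cd m i j - cd m j i

/-- The summand `Y − cut Y` serves only to reach the low-degree part of the range; the rest of the
equation sees `Y` through `cut m`. -/
noncomputable def linear₂ (m : ℕ) (κ : ℝ) (i : Fin n) : Dom n →L[ℝ] PSeries n :=
  cut m ∘L (∑ j, ContinuousLinearMap.mul ℝ (PSeries n) (coord j) ∘L cs m i j -
    κ • (ContinuousLinearMap.mul ℝ (PSeries n) (coord i) ∘L ∑ l, cs m l l)) +
    cY i - cut m ∘L cY i

noncomputable def linearPart (m : ℕ) (κ : ℝ) : Dom n →L[ℝ] Cod n :=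
  (ContinuousLinearMap.fst ℝ _ _).prod
    ((ContinuousLinearMap.pi fun i => ContinuousLinearMap.pi fun j => linear₁ m i j).prod
      (ContinuousLinearMap.pi fun i => linear₂ m κ i))

noncomputable def mη (p : Dom n) : Matrix (Fin n) (Fin n) (PSeries n) := Matrix.of p.1
noncomputable def md (m : ℕ) (p : Dom n) : Matrix (Fin n) (Fin n) (PSeries n) :=
  Matrix.of fun i j => cd m i j p
noncomputable def ms (m : ℕ) (p : Dom n) : Matrix (Fin n) (Fin n) (PSeries n) :=
  Matrix.of fun i j => cs m i j p

noncomputable def quad₁ (m : ℕ) (p : Dom n) : Matrix (Fin n) (Fin n) (PSeries n) :=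
  ms m p * ms m p - md m p * mη p - (mη p + md m p + md m p * mη p) * (md m p).transpose

noncomputable def quad₂ (m : ℕ) (κ : ℝ) (i : Fin n) (p : Dom n) : PSeries n :=
  cut m (∑ j, cs m i j p * cX m j p - (∑ l, κ • cs m l l p) * cX m i p)

/-- The equation for normal coordinates. -/
noncomputable def normalEq (m : ℕ) (κ : ℝ) (p : Dom n) : Cod n :=
  (p.1, fun i j => linear₁ m i j p + quad₁ m p i j, fun i => linear₂ m κ i p + quad₂ m κ i p)

lemma vanishesTwice_quad₁ (m : ℕ) (i j : Fin n) :
    VanishesTwice fun p : Dom n => quad₁ m p i j := by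
  have hs : ∀ i j, VanishesStrict fun p : Dom n => ms m p i j := fun i j =>
    (cs m i j).vanishesStrict
  have hd : ∀ i j, VanishesStrict fun p : Dom n => md m p i j := fun i j =>
    (cd m i j).vanishesStrict
  have hη : ∀ i j, VanishesStrict fun p : Dom n => mη p i j := fun i j =>
    (cη i j).vanishesStrict
  exact ((vanishesTwice_matrix_mul hs hs i j).sub (vanishesTwice_matrix_mul hd hη i j)).sub
    (vanishesTwice_matrix_mul
      (fun i j => ((hη i j).add (hd i j)).add (vanishesTwice_matrix_mul hd hη i j).strict)
      (fun i j => hd j i) i j)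

lemma vanishesTwice_quad₂ (m : ℕ) (κ : ℝ) (i : Fin n) :
    VanishesTwice fun p : Dom n => quad₂ m κ i p := by
  refine VanishesTwice.clm ?_ (cut m)
  refine (VanishesTwice.sum _ fun j _ =>
    (cs m i j).vanishesStrict.mul (cX m j).vanishesStrict).sub ?_
  refine VanishesStrict.mul ?_ (cX m i).vanishesStrict
  simpa using! (∑ l, κ • cs m l l : Dom n →L[ℝ] PSeries n).vanishesStrict

lemma hasStrictFDerivAt_normalEq (m : ℕ) (κ : ℝ) :
    HasStrictFDerivAt (normalEq (n := n) m κ) (linearPart m κ) 0 := by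
  have h1 : HasStrictFDerivAt (fun p : Dom n => p.1) (ContinuousLinearMap.fst ℝ _ _) 0 :=
    hasStrictFDerivAt_fst
  have h2 : HasStrictFDerivAt (fun p : Dom n => fun i j => linear₁ m i j p + quad₁ m p i j)
      (ContinuousLinearMap.pi fun i => ContinuousLinearMap.pi fun j => linear₁ m i j) 0 := by
    refine hasStrictFDerivAt_pi.2 fun i => hasStrictFDerivAt_pi.2 fun j => ?_
    simpa using (linear₁ m i j).hasStrictFDerivAt.fun_add (vanishesTwice_quad₁ m i j).2
  have h3 : HasStrictFDerivAt (fun p : Dom n => fun i => linear₂ m κ i p + quad₂ m κ i p)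
      (ContinuousLinearMap.pi fun i => linear₂ m κ i) 0 := by
    refine hasStrictFDerivAt_pi.2 fun i => ?_
    simpa using (linear₂ m κ i).hasStrictFDerivAt.fun_add (vanishesTwice_quad₂ m κ i).2
  exact h1.prodMk (h2.prodMk h3)

lemma normalEq_zero (m : ℕ) (κ : ℝ) : normalEq (n := n) m κ 0 = 0 := by
  refine Prod.ext rfl (Prod.ext ?_ ?_)
  · funext i j
    simp [normalEq, (vanishesTwice_quad₁ m i j).1]
  · funext i
    simp [normalEq, (vanishesTwice_quad₂ m κ i).1]

/-- Solvability of the linearized equation. -/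
def Solvable (O : (Fin n → MvPowerSeries (Fin n) ℝ) →ₗ[ℝ] (Fin n → MvPowerSeries (Fin n) ℝ))
    (m : ℕ) : Prop :=
  ∀ f : Fin n → PSeries n, (∀ i, cut m (f i) = f i) →
    ∃ Y : Fin n → PSeries n, (∀ i, cut m (Y i) = Y i) ∧
      O (fun i => (smoothen (Y i)).val) = fun i => (f i).val

/-- Symmetrizing and truncating the first equation expresses `s` as a known matrix `u` plus the
symmetric part of `DX`. Inserted in the second equation this leaves `symOp κ X` equal to a known
right-hand side, which `Solvable` handles; `t` is then read off. -/
lemma linearPart_surjective {m : ℕ} {κ : ℝ} (h : Solvable (n := n) (symOp κ) m) :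
    (linearPart (n := n) m κ).range = ⊤ := by
  rw [LinearMap.range_eq_top]
  rintro ⟨η, e₁, e₂⟩
  -- One factor `½` comes from the symmetrization, the other from the coefficient `2` of `s` in the
  -- symmetrized equation.
  let u : Matrix (Fin n) (Fin n) (PSeries n) := Matrix.of fun i j =>
    (1 / 4 : ℝ) • cut (m - 1) (e₁ i j + e₁ j i + η i j + η j i)
  obtain ⟨Z, hZ, hZeq⟩ := h (fun i => cut m (e₂ i - (∑ j, u i j * coord j -
    κ • ((∑ l, u l l) * coord i)))) fun i => cut_eq_self.2 (cut_mem _ _)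
  -- The low-degree part of `e₂` is matched by that of `Y`, which the truncated terms ignore.
  let Y : Fin n → PSeries n := fun i => Z i + (e₂ i - cut m (e₂ i))
  have hcc : ∀ a : PSeries n, cut m (cut m a) = cut m a := fun a => cut_eq_self.2 (cut_mem _ _)
  have hcc' : ∀ a : PSeries n, cut (m - 1) (cut (m - 1) a) = cut (m - 1) a :=
    fun a => cut_eq_self.2 (cut_mem _ _)
  have hY : ∀ i, cut m (Y i) = Z i := fun i => by
    simp only [Y, map_add, map_sub, hZ, hcc, sub_self, add_zero]
  let s : Matrix (Fin n) (Fin n) (PSeries n) := Matrix.of fun i j =>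
    u i j + (1 / 2 : ℝ) • (jacS Z i j + jacS Z j i)
  let t : Fin n → Fin n → PSeries n := fun i j => e₁ i j + η i j + jacS Z i j + jacS Z j i - s i j
  have hd : ∀ i j, cd m i j (η, Y, t) = jacS Z i j := fun i j => by
    simp [cd, hY]
  have hcd : ∀ i j, cut (m - 1) (jacS Z i j) = jacS Z i j := fun i j =>
    cut_eq_self.2 (dsmoothen_mem (cut_eq_self.1 (hZ i)) j)
  have hs : ∀ i j, cs m i j (η, Y, t) = s i j := fun i j => by
    simp only [cs, t, s, u, Matrix.of_apply, _root_.smul_apply,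
      ContinuousLinearMap.comp_apply, _root_.add_apply, ct_apply, map_add, map_sub,
      map_smul, hcc', hcd]
    module
  refine ⟨(η, Y, t), Prod.ext rfl (Prod.ext ?_ ?_)⟩
  · funext i j
    change linear₁ m i j (η, Y, t) = e₁ i j
    simp only [linear₁, _root_.add_apply, _root_.sub_apply, hs, hd,
      ct_apply, cη_apply, t]
    abel
  · funext i
    change linear₂ m κ i (η, Y, t) = e₂ i
    have h1 := val_symOp κ Z i
    rw [hZeq] at h1
    have h2 := PSeries.ext h1
    have h3 : ∑ j, coord j * s i j - κ • (coord i * ∑ l, s l l) =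
        (∑ j, u i j * coord j - κ • ((∑ l, u l l) * coord i)) +
        ((1 / 2 : ℝ) • ∑ j, (jacS Z i j + jacS Z j i) * coord j -
          κ • ((∑ l, jacS Z l l) * coord i)) := by
      have h4 : ∑ l, s l l = ∑ l, u l l + ∑ l, jacS Z l l := by
        rw [← Finset.sum_add_distrib]
        refine Finset.sum_congr rfl fun l _ => ?_
        simp only [s, Matrix.of_apply]
        module
      have h5 : ∑ j, coord j * s i j = ∑ j, u i j * coord j +
          (1 / 2 : ℝ) • ∑ j, (jacS Z i j + jacS Z j i) * coord j := by
        rw [Finset.smul_sum, ← Finset.sum_add_distrib]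
        refine Finset.sum_congr rfl fun l _ => ?_
        simp only [s, Matrix.of_apply, mul_add, mul_smul_comm, add_mul]
        rw [mul_comm (coord l), mul_comm (coord l), mul_comm (coord l)]
      rw [h4, h5, mul_comm (coord i), add_mul, smul_add]
      abel
    simp only [linear₂, _root_.add_apply, _root_.sub_apply,
      ContinuousLinearMap.comp_apply, cY_apply, hY, _root_.smul_apply,
      _root_.sum_apply, hs, ContinuousLinearMap.mul_apply']
    rw [h3, h2, map_add (cut m), hcc, map_sub (cut m) (e₂ i)]
    simp only [Y]
    abel

end PSeries

end AnalyticNormalForm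

/-! ### Solving the equation for metrics with small data -/

namespace AnalyticNormalForm
open MvPowerSeries

variable {n : ℕ}

namespace PSeries

lemma matrix_mul_mem {R : Type*} [CommRing R] {I : Ideal R} {A : Matrix (Fin n) (Fin n) R}
    (hA : ∀ i j, A i j ∈ I) (B : Matrix (Fin n) (Fin n) R) (i j : Fin n) : (A * B) i j ∈ I := by
  rw [Matrix.mul_apply]
  exact Ideal.sum_mem _ fun k _ => Ideal.mul_mem_right _ _ (hA i k)

/-- A germ of symmetric matrices close to the identity is brought to normal form by a map
`x + X(x)`. -/
theorem exists_normal_sym {m : ℕ} {κ : ℝ} (hm : 2 ≤ m) (h : Solvable (n := n) (symOp κ) m) :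
    ∃ δ > 0, ∀ η : Matrix (Fin n) (Fin n) (PSeries n), η.transpose = η →
      (∀ i j, η i j ∈ ord n (m - 1)) → (∀ i j, ‖η i j‖ < δ) →
      ∃ (Y : Fin n → PSeries n) (s : Matrix (Fin n) (Fin n) (PSeries n)),
        (∀ i, Y i ∈ ord n m) ∧ s.transpose = s ∧ (∀ i j, s i j ∈ ord n (m - 1)) ∧
        (1 + s) * (1 + s) = (1 + jacS Y) * (1 + η) * (1 + jacS Y).transpose ∧
        ∀ i, ∑ j, s i j * (coord j + smoothen (Y j)) =
          κ • (s.trace * (coord i + smoothen (Y i))) := by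
  -- A surjective strict derivative makes the map open at the origin, so all small targets are
  -- attained. The parameter `η` is repeated as the first component, which lets the target `(η, 0,
  -- 0)` prescribe it.
  have hmap := (hasStrictFDerivAt_normalEq (n := n) m κ).map_nhds_eq_of_surj
    (linearPart_surjective h)
  rw [normalEq_zero] at hmap
  have hmem : Set.range (normalEq (n := n) m κ) ∈ 𝓝 (0 : Cod n) := by
    rw [← hmap]
    exact Filter.range_mem_map
  obtain ⟨δ, hδ, hball⟩ := Metric.mem_nhds_iff.1 hmem
  refine ⟨δ, hδ, fun η hsym hord hlt => ?_⟩
  have hin : ((fun i j => η i j, 0, 0) : Cod n) ∈ Metric.ball (0 : Cod n) δ := by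
    rw [mem_ball_zero_iff, Prod.norm_def, Prod.norm_def]
    simp only [norm_zero, max_self, sup_lt_iff, hδ, and_true]
    exact (pi_norm_lt_iff hδ).2 fun i => (pi_norm_lt_iff hδ).2 fun j => hlt i j
  obtain ⟨⟨η', Y, t⟩, hp⟩ := hball hin
  obtain rfl : η' = fun i j => η i j := congrArg Prod.fst hp
  set p : Dom n := (fun i j => η i j, Y, t) with hpdef
  have hp₁ : ∀ i j, linear₁ m i j p + quad₁ m p i j = 0 := fun i j =>
    congrFun (congrFun (congrArg (fun q : Cod n => q.2.1) hp) i) j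
  have hp₂ : ∀ i, linear₂ m κ i p + quad₂ m κ i p = 0 := fun i =>
    congrFun (congrArg (fun q : Cod n => q.2.2) hp) i
  let Z : Fin n → PSeries n := fun i => cut m (Y i)
  have hZ : ∀ i, Z i ∈ ord n m := fun i => cut_mem m _
  have hmd : md m p = jacS Z := rfl
  have hmη : mη p = η := rfl
  set s := ms m p with hs
  have hsapp : ∀ i j, s i j = (1 / 2 : ℝ) • cut (m - 1) (t i j + t j i) := fun i j => rfl
  have hsT : s.transpose = s := by
    ext1 i j
    rw [Matrix.transpose_apply, hsapp, hsapp, add_comm]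
  have hsord : ∀ i j, s i j ∈ ord n (m - 1) := fun i j => smul_mem_ord _ (cut_mem _ _)
  have hdord : ∀ i j, jacS Z i j ∈ ord n (m - 1) := fun i j => dsmoothen_mem (hZ i) j
  -- The defect of the equation for `(1 + s)²`. The first component of the solved system says that
  -- `t = s − B`.
  set B := (1 + s) * (1 + s) - (1 + jacS Z) * (1 + η) * (1 + jacS Z).transpose with hB
  have hB' : B = s + s + (s * s - jacS Z * η - (η + jacS Z + jacS Z * η) * (jacS Z).transpose) -
      η - jacS Z - (jacS Z).transpose := by
    rw [hB, Matrix.transpose_add, Matrix.transpose_one]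
    noncomm_ring
  have hBT : B.transpose = B := by
    simp only [hB, Matrix.transpose_sub, Matrix.transpose_mul, Matrix.transpose_add,
      Matrix.transpose_one, hsT, hsym, Matrix.transpose_transpose, Matrix.mul_assoc]
  have htB : ∀ i j, t i j = s i j - B i j := fun i j => by
    have h1 := hp₁ i j
    simp only [linear₁, _root_.add_apply, _root_.sub_apply, ct_apply, cη_apply, quad₁, hmd, hmη,
      ← hs] at h1
    have h2 := congrFun (congrFun hB' i) j
    simp only [Matrix.add_apply, Matrix.sub_apply, Matrix.transpose_apply] at h1 h2
    have h3 : cs m i j p = s i j := rfl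
    have h4 : cd m i j p = jacS Z i j := rfl
    have h5 : cd m j i p = jacS Z j i := rfl
    have h6 : p.2.2 i j = t i j := rfl
    have h7 : p.1 i j = η i j := rfl
    rw [h3, h4, h5, h6, h7] at h1
    rw [h2]
    linear_combination h1
  have hBord : ∀ i j, B i j ∈ ord n (m - 1) := fun i j => by
    rw [hB']
    simp only [Matrix.add_apply, Matrix.sub_apply, Matrix.transpose_apply]
    exact sub_mem (sub_mem (sub_mem (add_mem (add_mem (hsord i j) (hsord i j))
      (sub_mem (sub_mem (matrix_mul_mem hsord _ i j) (matrix_mul_mem hdord _ i j))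
        (matrix_mul_mem (fun i j => add_mem (add_mem (hord i j) (hdord i j))
          (matrix_mul_mem hdord _ i j)) _ i j))) (hord i j)) (hdord i j)) (hdord j i)
  -- Both `s` and `B` are symmetric of order `m − 1`, so symmetrizing and truncating `t = s − B`
  -- changes nothing. But by definition it returns `s`, whence `B = 0`.
  have hB0 : B = 0 := by
    ext1 i j
    have h1 := hsapp i j
    have h2 : B j i = B i j := congrFun (congrFun hBT i) j
    have h3 : s j i = s i j := congrFun (congrFun hsT i) j
    rw [htB, htB, h2, h3, map_add, map_sub, cut_eq_self.2 (hsord i j),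
      cut_eq_self.2 (hBord i j)] at h1
    have h4 : (1 / 2 : ℝ) • (s i j - B i j + (s i j - B i j)) = s i j - B i j := by module
    rw [h4] at h1
    simpa using (sub_eq_self.1 h1.symm)
  refine ⟨Z, s, hZ, hsT, hsord, sub_eq_zero.1 hB0, fun i => ?_⟩
  set F := ∑ j, s i j * (coord j + smoothen (Z j)) - κ • (s.trace * (coord i + smoothen (Z i)))
    with hF
  have hX : ∀ j, coord j + smoothen (Z j) ∈ ord n 1 := fun j =>
    add_mem (coord_mem j) (smoothen_mem (ord_anti (by omega) (hZ j)))
  have hFord : F ∈ ord n m := by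
    have hm1 : m = m - 1 + 1 := by omega
    rw [hm1]
    exact sub_mem (Ideal.sum_mem _ fun j _ => mul_mem_ord (hsord i j) (hX j))
      (smul_mem_ord _ (mul_mem_ord (Ideal.sum_mem _ fun l _ => hsord l l) (hX i)))
  have h1 := hp₂ i
  have hF' : F = ∑ j, coord j * s i j - κ • (coord i * ∑ l, s l l) +
      (∑ j, s i j * smoothen (Z j) - (∑ l, κ • s l l) * smoothen (Z i)) := by
    rw [hF, Matrix.trace, ← Finset.smul_sum]
    simp only [mul_add, Finset.sum_add_distrib, Matrix.diag_apply, mul_comm _ (coord _), smul_add,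
      smul_mul_assoc]
    abel
  have h2 : cut m F + Y i - Z i = 0 := by
    rw [hF', map_add, ← h1]
    simp only [linear₂, quad₂, _root_.add_apply, _root_.sub_apply, ContinuousLinearMap.comp_apply,
      _root_.smul_apply, _root_.sum_apply, ContinuousLinearMap.mul_apply']
    change _ = cut m (∑ j, coord j * s i j - κ • (coord i * ∑ l, s l l)) + Y i - Z i +
      cut m (∑ j, s i j * smoothen (Z j) - (∑ l, κ • s l l) * smoothen (Z i))
    abel
  -- A further truncation kills `Y i - Z i`, as `Z i` is the truncation of `Y i`; and `F`, a product
  -- of orders `m − 1` and `1`, is unaffected by it.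
  have h3 := congrArg (cut m) h2
  rw [map_sub, map_add, cut_eq_self.2 (cut_mem m F), cut_eq_self.2 (hZ i), map_zero] at h3
  change cut m F + Z i - Z i = 0 at h3
  rw [add_sub_cancel_right, cut_eq_self.2 hFord] at h3
  exact sub_eq_zero.1 h3

end PSeries

end AnalyticNormalForm

/-! ### The equation for frames -/

namespace AnalyticNormalForm
open MvPowerSeries

variable {n : ℕ}

namespace PSeries

/-- The unknown and the parameter of the equation for radial coordinates of a frame. -/
abbrev FDom (n : ℕ) : Type := (Fin n → Fin n → PSeries n) × (Fin n → PSeries n)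

noncomputable def fη (i j : Fin n) : FDom n →L[ℝ] PSeries n :=
  ContinuousLinearMap.proj j ∘L ContinuousLinearMap.proj i ∘L ContinuousLinearMap.fst ℝ _ _

noncomputable def fY (i : Fin n) : FDom n →L[ℝ] PSeries n :=
  ContinuousLinearMap.proj i ∘L ContinuousLinearMap.snd ℝ _ _

noncomputable def fd (i j : Fin n) : FDom n →L[ℝ] PSeries n := dsmoothen j ∘L cut 2 ∘L fY i

noncomputable def fX (i : Fin n) : FDom n →L[ℝ] PSeries n := smoothen ∘L cut 2 ∘L fY i

/-- Here the Jacobian enters only through its product with `x`, so no auxiliary matrix unknown is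
needed. As in the case of metrics, `Y − cut Y` fills the low degrees of the range. -/
noncomputable def frameLinear (i : Fin n) : FDom n →L[ℝ] PSeries n :=
  cut 2 ∘L (∑ j, ContinuousLinearMap.mul ℝ (PSeries n) (coord j) ∘L (fd i j + fη i j)) +
    fY i - cut 2 ∘L fY i

noncomputable def frameLinearPart : FDom n →L[ℝ] FDom n :=
  (ContinuousLinearMap.fst ℝ _ _).prod (ContinuousLinearMap.pi frameLinear)

noncomputable def frameMatrix (p : FDom n) : Matrix (Fin n) (Fin n) (PSeries n) :=
  Matrix.of fun i j => fd i j p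

noncomputable def frameQuad (i : Fin n) (p : FDom n) : PSeries n :=
  cut 2 (∑ j, ((frameMatrix p * Matrix.of p.1) i j * coord j +
    (fd i j p + fη i j p + (frameMatrix p * Matrix.of p.1) i j) * fX j p))

/-- The equation for radial coordinates of a frame. -/
noncomputable def frameEq (p : FDom n) : FDom n :=
  (p.1, fun i => frameLinear i p + frameQuad i p)

lemma vanishesTwice_frameQuad (i : Fin n) : VanishesTwice fun p : FDom n => frameQuad i p := by
  have hd : ∀ i j, VanishesStrict fun p : FDom n => frameMatrix p i j := fun i j =>
    (fd i j).vanishesStrict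
  have hη : ∀ i j, VanishesStrict fun p : FDom n => (Matrix.of p.1 : Matrix _ _ _) i j :=
    fun i j => (fη i j).vanishesStrict
  have hm := vanishesTwice_matrix_mul hd hη
  refine VanishesTwice.clm (VanishesTwice.sum _ fun j _ => VanishesTwice.add ?_ ?_) (cut 2)
  · simpa only [mul_comm, ContinuousLinearMap.mul_apply'] using
      (hm i j).clm (ContinuousLinearMap.mul ℝ (PSeries n) (coord j))
  · exact (((hd i j).add (hη i j)).add (hm i j).strict).mul (fX j).vanishesStrict

lemma hasStrictFDerivAt_frameEq :
    HasStrictFDerivAt (frameEq (n := n)) frameLinearPart 0 := by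
  have h1 : HasStrictFDerivAt (fun p : FDom n => p.1) (ContinuousLinearMap.fst ℝ _ _) 0 :=
    hasStrictFDerivAt_fst
  have h2 : HasStrictFDerivAt (fun p : FDom n => fun i => frameLinear i p + frameQuad i p)
      (ContinuousLinearMap.pi frameLinear) 0 := by
    refine hasStrictFDerivAt_pi.2 fun i => ?_
    simpa using (frameLinear i).hasStrictFDerivAt.fun_add (vanishesTwice_frameQuad i).2
  exact h1.prodMk h2

lemma frameEq_zero : frameEq (n := n) 0 = 0 := by
  refine Prod.ext rfl (funext fun i => ?_)
  simp [frameEq, (vanishesTwice_frameQuad i).1]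

lemma val_radOp (Y : Fin n → PSeries n) (i : Fin n) :
    (∑ j, coord j * jacS Y i j).val = radOp (fun j => (smoothen (Y j)).val) i := by
  rw [radOp_apply]
  simp only [val_mul, val_sum, jacS_apply, val_dsmoothen, val_coord]

lemma solvable_radOp : Solvable (n := n) radOp 2 := fun f hf =>
  exists_smoothen_eq radOp homogeneousComponent_radOp
    (fun _ hk _ hg => exists_radOp_eq hk hg) f hf

lemma solvable_symOp_zero : Solvable (n := n) (symOp 0) 2 := fun f hf =>
  exists_smoothen_eq (symOp 0) (homogeneousComponent_symOp 0)
    (fun _ hk _ hg => exists_symOp_zero_eq hk hg) f hf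

lemma solvable_symOp_inv (hn : 3 ≤ n) : Solvable (n := n) (symOp (n : ℝ)⁻¹) 3 := fun f hf =>
  exists_smoothen_eq (symOp (n : ℝ)⁻¹) (homogeneousComponent_symOp _)
    (fun _ hk _ hg => exists_symOp_inv_eq hn hk hg) f hf

lemma frameLinearPart_surjective : (frameLinearPart (n := n)).range = ⊤ := by
  rw [LinearMap.range_eq_top]
  rintro ⟨η, e⟩
  obtain ⟨Z, hZ, hZeq⟩ := solvable_radOp (fun i => cut 2 (e i - ∑ j, coord j * η i j))
    fun i => cut_eq_self.2 (cut_mem _ _)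
  have hcc : ∀ a : PSeries n, cut 2 (cut 2 a) = cut 2 a := fun a => cut_eq_self.2 (cut_mem _ _)
  let Y : Fin n → PSeries n := fun i => Z i + (e i - cut 2 (e i))
  have hY : ∀ i, cut 2 (Y i) = Z i := fun i => by
    simp only [Y, map_add, map_sub, hZ, hcc, sub_self, add_zero]
  refine ⟨(η, Y), Prod.ext rfl (funext fun i => ?_)⟩
  change frameLinear i (η, Y) = e i
  have h1 := val_radOp Z i
  rw [hZeq] at h1
  have h2 := PSeries.ext h1
  have hd : ∀ j, fd i j (η, Y) = jacS Z i j := fun j => congrArg (dsmoothen j) (hY i)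
  have hη : ∀ j, fη i j (η, Y) = η i j := fun j => rfl
  have hYi : fY i (η, Y) = Y i := rfl
  simp only [frameLinear, _root_.add_apply, _root_.sub_apply, ContinuousLinearMap.comp_apply,
    _root_.sum_apply, ContinuousLinearMap.mul_apply', hd, hη, hYi, hY, mul_add,
    Finset.sum_add_distrib]
  rw [h2, map_add (cut 2), hcc, map_sub (cut 2) (e i)]
  simp only [Y]
  abel

/-- A germ of matrices close to the identity is brought to normal form by a map `x + X(x)`. -/
theorem exists_normal_frame :
    ∃ δ > 0, ∀ η : Matrix (Fin n) (Fin n) (PSeries n),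
      (∀ i j, η i j ∈ ord n 1) → (∀ i j, ‖η i j‖ < δ) →
      ∃ Y : Fin n → PSeries n, (∀ i, Y i ∈ ord n 2) ∧
        ∀ i, ∑ j, (jacS Y + η + jacS Y * η) i j * (coord j + smoothen (Y j)) = 0 := by
  have hmap := (hasStrictFDerivAt_frameEq (n := n)).map_nhds_eq_of_surj
    frameLinearPart_surjective
  rw [frameEq_zero] at hmap
  have hmem : Set.range (frameEq (n := n)) ∈ 𝓝 (0 : FDom n) := by
    rw [← hmap]
    exact Filter.range_mem_map
  obtain ⟨δ, hδ, hball⟩ := Metric.mem_nhds_iff.1 hmem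
  refine ⟨δ, hδ, fun η hord hlt => ?_⟩
  have hin : ((fun i j => η i j, 0) : FDom n) ∈ Metric.ball (0 : FDom n) δ := by
    rw [mem_ball_zero_iff, Prod.norm_def]
    simp only [norm_zero, sup_lt_iff, hδ, and_true]
    exact (pi_norm_lt_iff hδ).2 fun i => (pi_norm_lt_iff hδ).2 fun j => hlt i j
  obtain ⟨⟨η', Y⟩, hp⟩ := hball hin
  obtain rfl : η' = fun i j => η i j := congrArg Prod.fst hp
  set p : FDom n := (fun i j => η i j, Y) with hpdef
  have hp₂ : ∀ i, frameLinear i p + frameQuad i p = 0 := fun i =>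
    congrFun (congrArg (fun q : FDom n => q.2) hp) i
  let Z : Fin n → PSeries n := fun i => cut 2 (Y i)
  have hZ : ∀ i, Z i ∈ ord n 2 := fun i => cut_mem 2 _
  have hmd : frameMatrix p = jacS Z := rfl
  have hdord : ∀ i j, jacS Z i j ∈ ord n 1 := fun i j => dsmoothen_mem (hZ i) j
  refine ⟨Z, hZ, fun i => ?_⟩
  set F := ∑ j, (jacS Z + η + jacS Z * η) i j * (coord j + smoothen (Z j)) with hF
  have hX : ∀ j, coord j + smoothen (Z j) ∈ ord n 1 := fun j =>
    add_mem (coord_mem j) (smoothen_mem (ord_anti (by omega) (hZ j)))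
  have hFord : F ∈ ord n 2 := Ideal.sum_mem _ fun j _ =>
    mul_mem_ord (p := 1) (q := 1) (add_mem (add_mem (hdord i j) (hord i j))
      (matrix_mul_mem hdord _ i j)) (hX j)
  have h1 := hp₂ i
  have hF' : F = ∑ j, coord j * (jacS Z i j + η i j) +
      ∑ j, ((jacS Z * η) i j * coord j +
        (jacS Z i j + η i j + (jacS Z * η) i j) * smoothen (Z j)) := by
    rw [hF, ← Finset.sum_add_distrib]
    refine Finset.sum_congr rfl fun j _ => ?_
    simp only [Matrix.add_apply]
    ring
  have h2 : cut 2 F + Y i - Z i = 0 := by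
    rw [hF', map_add, ← h1]
    simp only [frameLinear, frameQuad, _root_.add_apply, _root_.sub_apply,
      ContinuousLinearMap.comp_apply, _root_.sum_apply, ContinuousLinearMap.mul_apply']
    change _ = cut 2 (∑ j, coord j * (jacS Z i j + η i j)) + Y i - Z i +
      cut 2 (∑ j, ((jacS Z * η) i j * coord j +
        (jacS Z i j + η i j + (jacS Z * η) i j) * smoothen (Z j)))
    abel
  have h3 := congrArg (cut 2) h2
  rw [map_sub, map_add, cut_eq_self.2 (cut_mem 2 F), cut_eq_self.2 (hZ i), map_zero] at h3
  change cut 2 F + Z i - Z i = 0 at h3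
  rwa [add_sub_cancel_right, cut_eq_self.2 hFord] at h3

end PSeries

end AnalyticNormalForm

/-! ### From power series back to maps -/

namespace AnalyticNormalForm
open MvPowerSeries

variable {n : ℕ}

/-- The Jacobian matrix. -/
noncomputable def jac (Φ : Coord n → Coord n) (x : Coord n) : Matrix (Fin n) (Fin n) ℝ :=
  LinearMap.toMatrix' (fderiv ℝ Φ x : Coord n →ₗ[ℝ] Coord n)

lemma jac_apply (Φ : Coord n → Coord n) (x : Coord n) (i j : Fin n) :
    jac Φ x i j = fderiv ℝ Φ x (Pi.single j 1) i := by
  rw [jac, LinearMap.toMatrix'_apply]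
  congr 2

lemma jac_mulVec (Φ : Coord n → Coord n) (x v : Coord n) :
    (jac Φ x).mulVec v = fderiv ℝ Φ x v := by
  rw [jac, LinearMap.toMatrix'_mulVec]
  rfl

/-- Conjugation by a dilation only moves the argument of the Jacobian. Therefore a solution for the
dilated, small data gives one for the original data. -/
lemma jac_smul_comp_smul (Φ : Coord n → Coord n) {c : ℝ} (hc : c ≠ 0) (x : Coord n) :
    jac (fun y => c • Φ (c⁻¹ • y)) x = jac Φ (c⁻¹ • x) := by
  ext i j
  have h1 : fderiv ℝ (fun y => c • Φ (c⁻¹ • y)) x = c • fderiv ℝ (fun y => Φ (c⁻¹ • y)) x :=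
    congrFun (fderiv_const_smul_field (f := fun y => Φ (c⁻¹ • y)) c) x
  rw [jac_apply, jac_apply, h1, fderiv_comp_smul, smul_smul, mul_inv_cancel₀ hc, one_smul]

namespace PSeries

lemma hasGerm_ev (a : PSeries n) : HasGerm (ev a.val) a.val := a.isConv.hasGerm_ev

/-- The entries of the matrix-valued function `A` have the entries of `a` as power series. -/
def MatGerm (A : Coord n → Matrix (Fin n) (Fin n) ℝ) (a : Matrix (Fin n) (Fin n) (PSeries n)) :
    Prop :=
  ∀ i j, HasGerm (fun x => A x i j) (a i j).val

lemma MatGerm.add {A B : Coord n → Matrix (Fin n) (Fin n) ℝ}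
    {a b : Matrix (Fin n) (Fin n) (PSeries n)} (hA : MatGerm A a) (hB : MatGerm B b) :
    MatGerm (fun x => A x + B x) (a + b) := fun i j => (hA i j).add (hB i j)

lemma MatGerm.mul {A B : Coord n → Matrix (Fin n) (Fin n) ℝ}
    {a b : Matrix (Fin n) (Fin n) (PSeries n)} (hA : MatGerm A a) (hB : MatGerm B b) :
    MatGerm (fun x => A x * B x) (a * b) := fun i j => by
  simp only [Matrix.mul_apply, val_sum, val_mul]
  exact HasGerm.sum _ fun k _ => (hA i k).mul (hB k j)

lemma MatGerm.transpose {A : Coord n → Matrix (Fin n) (Fin n) ℝ}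
    {a : Matrix (Fin n) (Fin n) (PSeries n)} (hA : MatGerm A a) :
    MatGerm (fun x => (A x).transpose) a.transpose := fun i j => hA j i

lemma matGerm_one : MatGerm (fun _ => 1) (1 : Matrix (Fin n) (Fin n) (PSeries n)) := fun i j => by
  by_cases h : i = j
  · subst h
    simpa using hasGerm_const (n := n) 1
  · simpa [h] using hasGerm_const (n := n) 0

lemma MatGerm.unique {A B : Coord n → Matrix (Fin n) (Fin n) ℝ}
    {a : Matrix (Fin n) (Fin n) (PSeries n)} (hA : MatGerm A a) (hB : MatGerm B a) :
    ∀ᶠ x in 𝓝 0, A x = B x := by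
  have h : ∀ᶠ x in 𝓝 0, ∀ i j, A x i j = B x i j :=
    eventually_all.2 fun i => eventually_all.2 fun j => (hA i j).unique (hB i j)
  filter_upwards [h] with x hx using Matrix.ext hx

lemma MatGerm.analytic {A : Coord n → Matrix (Fin n) (Fin n) ℝ}
    {a : Matrix (Fin n) (Fin n) (PSeries n)} (hA : MatGerm A a) : IsAnalyticMatrixGerm A :=
  fun i j => (hA i j).analyticAt

lemma MatGerm.apply_zero {A : Coord n → Matrix (Fin n) (Fin n) ℝ}
    {a : Matrix (Fin n) (Fin n) (PSeries n)} (hA : MatGerm A a) (h : ∀ i j, a i j ∈ ord n 1) :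
    A 0 = 0 := by
  ext i j
  rw [(hA i j).apply_zero]
  exact h i j 0 (by simp)

/-- The map with the components `xᵢ + smoothen (Y i)`. -/
noncomputable def perturb (Y : Fin n → PSeries n) (x : Coord n) : Coord n :=
  fun i => x i + ev (smoothen (Y i)).val x

lemma hasGerm_perturb (Y : Fin n → PSeries n) (i : Fin n) :
    HasGerm (fun x => perturb Y x i) (coord i + smoothen (Y i)).val :=
  (hasGerm_coord i).add (hasGerm_ev _)

lemma analyticAt_perturb (Y : Fin n → PSeries n) : AnalyticAt ℝ (perturb Y) 0 :=
  AnalyticAt.pi fun i => (hasGerm_perturb Y i).analyticAt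

lemma perturb_zero {Y : Fin n → PSeries n} (hY : ∀ i, Y i ∈ ord n 2) : perturb Y 0 = 0 := by
  ext i
  have := (hasGerm_perturb Y i).apply_zero
  rw [this]
  exact add_mem (coord_mem i) (smoothen_mem (ord_anti (by omega) (hY i))) 0 (by simp)

lemma matGerm_jac_perturb (Y : Fin n → PSeries n) : MatGerm (jac (perturb Y)) (1 + jacS Y) := by
  intro i j
  have h1 := (hasGerm_perturb Y i).pderiv j
  have h2 : MvPowerSeries.pderiv ℝ j (coord i + smoothen (Y i)).val =
      ((1 + jacS Y) i j).val := by
    classical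
    rw [val_add, map_add, Matrix.add_apply, val_add, jacS_apply, val_dsmoothen, val_coord,
      pderiv_X, Matrix.one_apply]
    congr 1
    by_cases h : i = j
    · subst h; simp
    · simp [h]
  rw [h2] at h1
  refine h1.congr ?_
  filter_upwards [(analyticAt_perturb Y).eventually_analyticAt] with x hx
  rw [jac_apply, fderiv_apply hx.differentiableAt]
  rfl

lemma jac_perturb_zero {Y : Fin n → PSeries n} (hY : ∀ i, Y i ∈ ord n 2) :
    jac (perturb Y) 0 = 1 := by
  have h1 : MatGerm (fun x => jac (perturb Y) x - 1) (jacS Y) := fun i j => by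
    simpa using! ((matGerm_jac_perturb Y) i j).sub (matGerm_one i j)
  exact sub_eq_zero.1 (h1.apply_zero fun i j => dsmoothen_mem (hY i) j)

lemma hasGerm_mulVec {A : Coord n → Matrix (Fin n) (Fin n) ℝ} {Φ : Coord n → Coord n}
    {a : Matrix (Fin n) (Fin n) (PSeries n)} {φ : Fin n → PSeries n} (hA : MatGerm A a)
    (hΦ : ∀ i, HasGerm (fun x => Φ x i) (φ i).val) (i : Fin n) :
    HasGerm (fun x => (A x).mulVec (Φ x) i) (∑ j, a i j * φ j).val := by
  simp only [Matrix.mulVec, dotProduct, val_sum, val_mul]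
  exact HasGerm.sum _ fun j _ => (hA i j).mul (hΦ j)

lemma tendsto_smul_zero (c : ℝ) : Tendsto (fun x : Coord n => c • x) (𝓝 0) (𝓝 0) := by
  simpa using (continuous_const_smul c).tendsto (0 : Coord n)

lemma analyticAt_smul_comp_smul {F : Type*} [NormedAddCommGroup F] [NormedSpace ℝ F]
    {f : Coord n → F} (hf : AnalyticAt ℝ f 0) (c d : ℝ) :
    AnalyticAt ℝ (fun x => d • f (c • x)) 0 := by
  refine analyticAt_const.smul (AnalyticAt.fun_comp (g := f) (f := fun x => c • x) ?_ ?_)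
  · simpa using hf
  · fun_prop

end PSeries

open PSeries

/-- Some dilation of finitely many convergent power series gives small elements of the algebra. -/
lemma exists_dilate_small {a : Fin n → Fin n → MvPowerSeries (Fin n) ℝ} (ha : ∀ i j, IsConv (a i j))
    (h0 : ∀ i j, coeff 0 (a i j) = 0) {δ : ℝ} (hδ : 0 < δ) :
    ∃ c > 0, ∃ b : Matrix (Fin n) (Fin n) (PSeries n), (∀ i j, (b i j).val = dilate c (a i j)) ∧
      ∀ i j, ‖b i j‖ < δ := by
  have h1 : ∀ᶠ c in 𝓝[>] (0 : ℝ), ∀ i j, ∃ b : PSeries n, b.val = dilate c (a i j) ∧ ‖b‖ < δ :=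
    eventually_all.2 fun i => eventually_all.2 fun j => (ha i j).eventually_dilate (h0 i j) hδ
  obtain ⟨c, h2, hc⟩ := (h1.and self_mem_nhdsWithin).exists
  choose b hb using h2
  exact ⟨c, hc, Matrix.of b, fun i j => (hb i j).1, fun i j => (hb i j).2⟩

/-- The matrix-valued function `E` is analytic at `0` and vanishes there to the order `m`. -/
def VanishesToOrder (m : ℕ) (E : Coord n → Matrix (Fin n) (Fin n) ℝ) : Prop :=
  ∀ i j, ∃ a, HasGerm (fun x => E x i j) a ∧ ∀ α : Fin n →₀ ℕ, α.degree < m → coeff α a = 0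

/-- `1 + E` is the frame matrix, normalized at the origin. The product `jac Φ * (1 + E)` is the
matrix of the transformed frame at the point `Φ x`, so the equation says that this matrix fixes the
position vector. -/
theorem exists_normal_map_frame {E : Coord n → Matrix (Fin n) (Fin n) ℝ}
    (hE : VanishesToOrder 1 E) :
    ∃ Φ : Coord n → Coord n, AnalyticAt ℝ Φ 0 ∧ Φ 0 = 0 ∧ jac Φ 0 = 1 ∧
      ∀ᶠ x in 𝓝 0, (jac Φ x * (1 + E x)).mulVec (Φ x) = Φ x := by
  choose a ha ha0 using hE
  obtain ⟨δ, hδ, h⟩ := exists_normal_frame (n := n)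
  obtain ⟨c, hc, b, hb, hbδ⟩ := exists_dilate_small (fun i j => (ha i j).isConv)
    (fun i j => ha0 i j 0 (by simp)) hδ
  obtain ⟨Y, hY, hres⟩ := h b (fun i j α hα => by rw [hb, coeff_dilate, ha0 i j α hα, mul_zero]) hbδ
  have hEb : MatGerm (fun x => E (c • x)) b := fun i j => by
    rw [hb]
    exact (ha i j).dilate hc
  refine ⟨fun x => c • perturb Y (c⁻¹ • x), analyticAt_smul_comp_smul (analyticAt_perturb Y) _ _,
    by simp [perturb_zero hY], ?_, ?_⟩
  · rw [jac_smul_comp_smul _ hc.ne', smul_zero, jac_perturb_zero hY]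
  · have h1 : ∀ᶠ x in 𝓝 0, ∀ i,
        (jac (perturb Y) x * (1 + E (c • x))).mulVec (perturb Y x) i = perturb Y x i := by
      refine eventually_all.2 fun i => ?_
      have h2 := hasGerm_mulVec ((matGerm_jac_perturb Y).mul (matGerm_one.add hEb))
        (hasGerm_perturb Y) i
      refine (h2.unique ?_)
      have h3 : ∑ j, ((1 + jacS Y) * (1 + b)) i j * (coord j + smoothen (Y j)) =
          coord i + smoothen (Y i) := by
        have h4 : (1 + jacS Y) * (1 + b) = 1 + (jacS Y + b + jacS Y * b) := by noncomm_ring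
        simp only [h4, Matrix.add_apply 1, add_mul _ _ (coord _ + _), Finset.sum_add_distrib,
          hres, add_zero]
        simp [Matrix.one_apply]
      rw [h3]
      exact hasGerm_perturb Y i
    filter_upwards [(tendsto_smul_zero c⁻¹).eventually h1] with x hx
    rw [jac_smul_comp_smul _ hc.ne']
    rw [smul_smul, mul_inv_cancel₀ hc.ne', one_smul] at hx
    rw [Matrix.mulVec_smul, funext hx]

/-- `1 + E` is the inverse matrix of the metric and `jac Φ * (1 + E) * (jac Φ)ᵗ` its transform; its
symmetric square root `S` is the matrix of the sought orthonormal frame, still written at `x` and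
not at `Φ x`. -/
theorem exists_normal_map_sym {m : ℕ} {κ : ℝ} (hm : 2 ≤ m) (h : Solvable (n := n) (symOp κ) m)
    {E : Coord n → Matrix (Fin n) (Fin n) ℝ} (hE : VanishesToOrder (m - 1) E)
    (hsym : ∀ᶠ x in 𝓝 0, (E x).transpose = E x) :
    ∃ (Φ : Coord n → Coord n) (S : Coord n → Matrix (Fin n) (Fin n) ℝ),
      AnalyticAt ℝ Φ 0 ∧ Φ 0 = 0 ∧ jac Φ 0 = 1 ∧ IsAnalyticMatrixGerm S ∧ S 0 = 1 ∧
      ∀ᶠ x in 𝓝 0, (S x).transpose = S x ∧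
        S x * S x = jac Φ x * (1 + E x) * (jac Φ x).transpose ∧
        (S x - 1).mulVec (Φ x) = (κ * (S x - 1).trace) • Φ x := by
  choose a' ha' ha0' using hE
  -- The chosen series are made symmetric by force, using only the entries on and above the
  -- diagonal.
  let a : Fin n → Fin n → MvPowerSeries (Fin n) ℝ := fun i j => a' (min i j) (max i j)
  have ha : ∀ i j, HasGerm (fun x => E x i j) (a i j) := fun i j => by
    rcases le_total i j with h | h
    · simpa only [a, min_eq_left h, max_eq_right h] using ha' i j
    · simp only [a, min_eq_right h, max_eq_left h]
      refine (ha' j i).congr ?_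
      filter_upwards [hsym] with x hx
      rw [← hx, Matrix.transpose_apply, hx]
  have ha0 : ∀ i j α, α.degree < m - 1 → coeff α (a i j) = 0 := fun i j => ha0' _ _
  have has : ∀ i j, a i j = a j i := fun i j => by simp only [a, min_comm, max_comm]
  obtain ⟨δ, hδ, h⟩ := exists_normal_sym hm h
  obtain ⟨c, hc, b, hb, hbδ⟩ := exists_dilate_small (fun i j => (ha i j).isConv)
    (fun i j => ha0 i j 0 (by rw [map_zero]; omega)) hδ
  have hbT : b.transpose = b := by
    ext1 i j
    exact PSeries.ext (by rw [Matrix.transpose_apply, hb, hb, has])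
  obtain ⟨Y, s, hY, hsT, hs0, hss, hres⟩ := h b hbT
    (fun i j α hα => by rw [hb, coeff_dilate, ha0 i j α hα, mul_zero]) hbδ
  have hY2 : ∀ i, Y i ∈ ord n 2 := fun i => ord_anti hm (hY i)
  have hEb : MatGerm (fun x => E (c • x)) b := fun i j => by
    rw [hb]
    exact (ha i j).dilate hc
  let T : Coord n → Matrix (Fin n) (Fin n) ℝ := fun x => Matrix.of fun i j => ev (s i j).val x
  have hT : MatGerm T s := fun i j => hasGerm_ev (s i j)
  have hT0 : T 0 = 0 := hT.apply_zero fun i j => ord_anti (by omega) (hs0 i j)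
  refine ⟨fun x => c • perturb Y (c⁻¹ • x), fun x => 1 + T (c⁻¹ • x),
    analyticAt_smul_comp_smul (analyticAt_perturb Y) _ _, by simp [perturb_zero hY2], ?_,
    fun i j => ?_, by simp [hT0], ?_⟩
  · rw [jac_smul_comp_smul _ hc.ne', smul_zero, jac_perturb_zero hY2]
  · have := analyticAt_smul_comp_smul ((matGerm_one.add hT).analytic i j) c⁻¹ 1
    simpa using this
  · have h1 : ∀ᶠ x in 𝓝 0, ∀ i, (T x).mulVec (perturb Y x) i =
        (κ * (T x).trace) * perturb Y x i := by
      refine eventually_all.2 fun i => ?_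
      have h2 := hasGerm_mulVec hT (hasGerm_perturb Y) i
      refine h2.unique ?_
      rw [hres, val_smul, val_mul, Matrix.trace, val_sum]
      have h3 := ((HasGerm.sum Finset.univ fun l _ => hT l l).mul (hasGerm_perturb Y i)).smul κ
      simpa only [Matrix.trace, Matrix.diag_apply, mul_assoc] using h3
    have h2 := hT.transpose.unique (hsT.symm ▸ hT)
    have h3 := ((matGerm_one.add hT).mul (matGerm_one.add hT)).unique (hss.symm ▸
      (((matGerm_jac_perturb Y).mul (matGerm_one.add hEb)).mul (matGerm_jac_perturb Y).transpose))
    filter_upwards [(tendsto_smul_zero c⁻¹).eventually h1, (tendsto_smul_zero c⁻¹).eventually h2,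
      (tendsto_smul_zero c⁻¹).eventually h3] with x hx1 hx2 hx3
    rw [smul_smul, mul_inv_cancel₀ hc.ne', one_smul] at hx3
    rw [jac_smul_comp_smul _ hc.ne', add_sub_cancel_left, Matrix.mulVec_smul, funext hx1]
    refine ⟨by rw [Matrix.transpose_add, hx2, Matrix.transpose_one], hx3, ?_⟩
    rw [smul_comm]
    rfl

end AnalyticNormalForm

/-! ### Cauchy–Kovalevskaya for a linear system in two variables -/

namespace AnalyticNormalForm
open MvPowerSeries

/-- The power series `u` and `v` in two variables agree up to terms of degree less than `b` in the
second variable. -/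
def AgreeBelow (b : ℕ) (u v : Fin 2 → MvPowerSeries (Fin 2) ℝ) : Prop :=
  ∀ i (α : Fin 2 →₀ ℕ), α 1 < b → coeff α (u i) = coeff α (v i)

/-- A map which improves the agreement of power series has a fixed point. -/
lemma exists_fixedPoint_of_agreeBelow
    {F : (Fin 2 → MvPowerSeries (Fin 2) ℝ) → Fin 2 → MvPowerSeries (Fin 2) ℝ}
    (hF : ∀ b u v, AgreeBelow b u v → AgreeBelow (b + 1) (F u) (F v)) : ∃ u, F u = u := by
  have h1 : ∀ b, AgreeBelow b (F^[b] 0) (F^[b + 1] 0) := by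
    intro b
    induction b with
    | zero => exact fun i α hα => absurd hα (Nat.not_lt_zero _)
    | succ b ih =>
      rw [Function.iterate_succ_apply', Function.iterate_succ_apply' F (b + 1)]
      exact hF b _ _ ih
  have h2 : ∀ b c, AgreeBelow b (F^[b] 0) (F^[b + c] 0) := by
    intro b c
    induction c with
    | zero => exact fun i α _ => rfl
    | succ c ih => exact fun i α hα => (ih i α hα).trans (h1 (b + c) i α (by omega))
  -- The coefficient at `α` is stationary from the iterate number `α 1 + 1` on, and is taken from
  -- that iterate.
  let u : Fin 2 → MvPowerSeries (Fin 2) ℝ := fun i α => coeff α (F^[α 1 + 1] 0 i)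
  have hu : ∀ i α, coeff α (u i) = coeff α (F^[α 1 + 1] 0 i) := fun i α => rfl
  have h3 : ∀ b, AgreeBelow b u (F^[b] 0) := by
    intro b i α hα
    obtain ⟨c, rfl⟩ : ∃ c, b = α 1 + 1 + c := ⟨b - (α 1 + 1), by omega⟩
    rw [hu, h2 (α 1 + 1) c i α (by omega)]
  refine ⟨u, funext fun i => ?_⟩
  ext α
  rw [hF (α 1) _ _ (h3 (α 1)) i α (by omega), ← Function.iterate_succ_apply' F, hu]

lemma choose_add_le_choose_add {a b a' b' : ℕ} (ha : a ≤ a') (hb : b ≤ b') :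
    (a + b).choose a ≤ (a' + b').choose a' :=
  calc (a + b).choose a ≤ (a + b').choose a := Nat.choose_mono a (by omega)
    _ = (a + b').choose b' := Nat.choose_symm_add
    _ ≤ (a' + b').choose b' := Nat.choose_mono b' (by omega)
    _ = (a' + b').choose a' := Nat.choose_symm_add.symm

lemma sum_antidiagonal_fst_le_tsum {σ : Type*} [DecidableEq σ] {f : (σ →₀ ℕ) → ℝ} (hf : Summable f)
    (h0 : ∀ β, 0 ≤ f β) (γ : σ →₀ ℕ) :
    ∑ p ∈ Finset.HasAntidiagonal.antidiagonal γ, f p.1 ≤ ∑' β, f β := by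
  classical
  rw [← Finset.sum_image (g := Prod.fst) (f := f)]
  · exact hf.sum_le_tsum _ fun β _ => h0 β
  · intro p hp q hq h
    have hp' := Finset.HasAntidiagonal.mem_antidiagonal.1 hp
    have hq' := Finset.HasAntidiagonal.mem_antidiagonal.1 hq
    refine Prod.ext h ?_
    rw [← hq'] at hp'
    have h' : p.1 = q.1 := h
    rw [h'] at hp'
    exact add_left_cancel hp'

lemma degree_fin_two (α : Fin 2 →₀ ℕ) : α.degree = α 0 + α 1 := by
  rw [Finsupp.degree_eq_sum, Fin.sum_univ_two]

/-- The Cauchy-Kovalevskaya theorem for a linear system of two equations in two variables. -/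
theorem exists_linear_system {T : Fin 2 → Fin 2 → Coord 2 → ℝ} (hT : ∀ i j, AnalyticAt ℝ (T i j) 0)
    (c : Fin 2 → ℝ) :
    ∃ φ : Fin 2 → Coord 2 → ℝ, (∀ i, AnalyticAt ℝ (φ i) 0) ∧ (∀ i, φ i 0 = 0) ∧
      (∀ i, fderiv ℝ (φ i) 0 (Pi.single 0 1) = c i) ∧
      ∀ᶠ x in 𝓝 0, ∀ i, fderiv ℝ (φ i) x (Pi.single 1 1) =
        ∑ j, T i j x * fderiv ℝ (φ j) x (Pi.single 0 1) := by
  classical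
  choose t ht using fun i j => exists_hasGerm (hT i j)
  -- Formal integration of the system in the second variable, with the initial values `cᵢ x₀` on the
  -- line `x₁ = 0`. A coefficient with second exponent `b` uses only coefficients with second
  -- exponent less than `b`.
  let F : (Fin 2 → MvPowerSeries (Fin 2) ℝ) → Fin 2 → MvPowerSeries (Fin 2) ℝ := fun u i α =>
    if α 1 = 0 then (if α = Finsupp.single 0 1 then c i else 0) else
      coeff (α - Finsupp.single 1 1) (∑ j, t i j * pderiv ℝ 0 (u j)) / α 1
  have hFc : ∀ u i α, coeff α (F u i) =
    if α 1 = 0 then (if α = Finsupp.single 0 1 then c i else 0) else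
      coeff (α - Finsupp.single 1 1) (∑ j, t i j * pderiv ℝ 0 (u j)) / α 1 := fun u i α => rfl
  have hF : ∀ b u v, AgreeBelow b u v → AgreeBelow (b + 1) (F u) (F v) := by
    intro b u v h i α hα
    rw [hFc, hFc]
    split_ifs with h0 h1
    · rfl
    · rfl
    · congr 1
      simp only [map_sum, coeff_mul, coeff_pderiv]
      refine Finset.sum_congr rfl fun j _ => Finset.sum_congr rfl fun p hp => ?_
      rw [h j]
      have h2 := DFunLike.congr_fun (Finset.HasAntidiagonal.mem_antidiagonal.1 hp) 1
      simp only [Finsupp.add_apply, Finsupp.tsub_apply, Finsupp.single_eq_same] at h2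
      have h3 : (Finsupp.single (0 : Fin 2) 1 : Fin 2 →₀ ℕ) 1 = 0 := by simp
      rw [Finsupp.add_apply, h3]
      omega
  obtain ⟨u, hu⟩ := exists_fixedPoint_of_agreeBelow hF
  have hu0 : ∀ i α, α 1 = 0 → coeff α (u i) = if α = Finsupp.single 0 1 then c i else 0 := by
    intro i α hα
    rw [← hu, hFc, if_pos hα]
  have hu1 : ∀ i γ, ((γ 1 : ℝ) + 1) * coeff (γ + Finsupp.single 1 1) (u i) =
      coeff γ (∑ j, t i j * pderiv ℝ 0 (u j)) := by
    intro i γ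
    have h1 : (γ + Finsupp.single 1 1 : Fin 2 →₀ ℕ) 1 = γ 1 + 1 := by simp
    conv_lhs => rw [← hu, hFc]
    rw [h1, if_neg (by omega), add_tsub_cancel_right]
    push_cast
    field_simp
  obtain ⟨r, hr, hsum⟩ : ∃ r > 0, ∀ i j, Summable fun β => |coeff β (t i j)| * r ^ β.degree := by
    choose R hR hR' using fun i j => (ht i j).shrink
    let r := Finset.univ.inf' Finset.univ_nonempty fun p : Fin 2 × Fin 2 => R p.1 p.2
    have hr : 0 < r := (Finset.lt_inf'_iff _).2 fun p _ => hR p.1 p.2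
    exact ⟨r, hr, fun i j => (hR' i j r hr (Finset.inf'_le _ (Finset.mem_univ (i, j)))).1⟩
  set K : ℝ := ∑ i, ∑ j, ∑' β, |coeff β (t i j)| * r ^ β.degree with hK
  have hpos : ∀ i j, 0 ≤ ∑' β, |coeff β (t i j)| * r ^ β.degree := fun i j =>
    tsum_nonneg fun β => by positivity
  have hKi : ∀ i, ∑ j, ∑' β, |coeff β (t i j)| * r ^ β.degree ≤ K := fun i =>
    Finset.single_le_sum (f := fun i => ∑ j, ∑' β, |coeff β (t i j)| * r ^ β.degree)
      (fun i _ => Finset.sum_nonneg fun j _ => hpos i j) (Finset.mem_univ i)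
  have hK0 : 0 ≤ K := Finset.sum_nonneg fun i _ => Finset.sum_nonneg fun j _ => hpos i j
  set L : ℝ := K + 1 with hL
  set D : ℝ := (∑ i, |c i|) * r with hD
  have hD0 : 0 ≤ D := mul_nonneg (Finset.sum_nonneg fun i _ => abs_nonneg _) hr.le
  -- The majorant is `D / (1 − (x₀ + L x₁)/r)`. In the induction, the derivative in `x₀` is
  -- compensated by the division by `γ 1 + 1` through the binomial coefficients, and the size `K ≤
  -- L` of the matrix by one more power of `L`.
  have hbound : ∀ b i (α : Fin 2 →₀ ℕ), α 1 = b →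
      |coeff α (u i)| ≤ D * (r⁻¹ ^ α.degree * L ^ α 1 * ((α 0 + α 1).choose (α 0) : ℝ)) := by
    intro b
    induction b using Nat.strong_induction_on with
    | _ b ih =>
    intro i α hα
    rcases Nat.eq_zero_or_pos b with rfl | hb
    · rw [hu0 i α hα]
      split_ifs with h1
      · have h2 : (Finsupp.single (0 : Fin 2) 1 : Fin 2 →₀ ℕ) 1 = 0 := by simp
        rw [h1, h2]
        simp only [Finsupp.degree_single, Finsupp.single_eq_same, pow_one, pow_zero, mul_one,
          Nat.add_zero, Nat.choose_self, Nat.cast_one]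
        rw [hD, mul_assoc, mul_inv_cancel₀ hr.ne', mul_one]
        exact Finset.single_le_sum (f := fun i => |c i|) (fun i _ => abs_nonneg _)
          (Finset.mem_univ i)
      · rw [abs_zero]
        positivity
    · obtain ⟨γ, rfl⟩ : ∃ γ : Fin 2 →₀ ℕ, α = γ + Finsupp.single 1 1 := by
        refine ⟨α - Finsupp.single 1 1, (tsub_add_cancel_of_le ?_).symm⟩
        rw [Finsupp.single_le_iff]
        omega
      have hγ1 : (γ + Finsupp.single 1 1 : Fin 2 →₀ ℕ) 1 = γ 1 + 1 := by simp
      have hγ0 : (γ + Finsupp.single 1 1 : Fin 2 →₀ ℕ) 0 = γ 0 := by simp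
      rw [hγ1] at hα
      rw [hγ1, hγ0, map_add, Finsupp.degree_single]
      set Q : ℝ := D * (r⁻¹ ^ (γ.degree + 1) * L ^ γ 1 * ((γ 0 + (γ 1 + 1)).choose (γ 0) : ℝ))
        with hQ
      have hQ0 : 0 ≤ Q := by positivity
      have hterm : ∀ j, ∀ p ∈ Finset.HasAntidiagonal.antidiagonal γ,
          |coeff p.1 (t i j) * coeff p.2 (pderiv ℝ 0 (u j))| ≤
            |coeff p.1 (t i j)| * r ^ p.1.degree * ((γ 1 + 1) * Q) := by
        rintro j ⟨β, δ⟩ hp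
        have hp' : β + δ = γ := Finset.HasAntidiagonal.mem_antidiagonal.1 hp
        have hp0 : β 0 + δ 0 = γ 0 := DFunLike.congr_fun hp' 0
        have hp1 : β 1 + δ 1 = γ 1 := DFunLike.congr_fun hp' 1
        have hdeg : β.degree + δ.degree = γ.degree := by rw [← hp', map_add]
        have hδ1 : (δ + Finsupp.single 0 1 : Fin 2 →₀ ℕ) 1 = δ 1 := by simp
        have hδ0 : (δ + Finsupp.single 0 1 : Fin 2 →₀ ℕ) 0 = δ 0 + 1 := by simp
        have h1 := ih (δ 1) (by omega) j (δ + Finsupp.single 0 1) hδ1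
        rw [hδ0, hδ1, map_add, Finsupp.degree_single] at h1
        simp only
        rw [coeff_pderiv, abs_mul, abs_mul, mul_assoc]
        refine mul_le_mul_of_nonneg_left ?_ (abs_nonneg _)
        have h2 : |(δ 0 : ℝ) + 1| = δ 0 + 1 := abs_of_nonneg (by positivity)
        have h3 : ((δ 0 + 1 + δ 1).choose (δ 0 + 1) : ℝ) * (δ 0 + 1) ≤
            (γ 1 + 1) * ((γ 0 + (γ 1 + 1)).choose (γ 0) : ℝ) := by
          have h4 := Nat.choose_succ_right_eq (δ 0 + 1 + δ 1) (δ 0)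
          have h5 : δ 0 + 1 + δ 1 - δ 0 = δ 1 + 1 := by omega
          rw [h5] at h4
          have h6 : (δ 0 + 1 + δ 1).choose (δ 0) ≤ (γ 0 + (γ 1 + 1)).choose (γ 0) := by
            have := choose_add_le_choose_add (a := δ 0) (b := δ 1 + 1) (a' := γ 0) (b' := γ 1 + 1)
              (by omega) (by omega)
            rwa [show δ 0 + (δ 1 + 1) = δ 0 + 1 + δ 1 by ring] at this
          have h7 : (δ 0 + 1 + δ 1).choose (δ 0 + 1) * (δ 0 + 1) ≤
              (γ 1 + 1) * (γ 0 + (γ 1 + 1)).choose (γ 0) := by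
            rw [h4, mul_comm]
            exact Nat.mul_le_mul (by omega) h6
          exact_mod_cast h7
        have h8 : r⁻¹ ^ (δ.degree + 1) = r ^ β.degree * r⁻¹ ^ (γ.degree + 1) := by
          rw [← hdeg, show β.degree + δ.degree + 1 = β.degree + (δ.degree + 1) by ring,
            pow_add _ β.degree, ← mul_assoc, ← mul_pow, mul_inv_cancel₀ hr.ne', one_pow, one_mul]
        have h9 : L ^ δ 1 ≤ L ^ γ 1 := pow_le_pow_right₀ (by linarith) (by omega)
        have hL0 : 0 ≤ L := by linarith
        rw [h2]
        calc |coeff (δ + Finsupp.single 0 1) (u j)| * ((δ 0 : ℝ) + 1)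
            ≤ D * (r⁻¹ ^ (δ.degree + 1) * L ^ δ 1 * ((δ 0 + 1 + δ 1).choose (δ 0 + 1) : ℝ)) *
              ((δ 0 : ℝ) + 1) := mul_le_mul_of_nonneg_right h1 (by positivity)
          _ = D * r⁻¹ ^ (δ.degree + 1) * (L ^ δ 1 *
              (((δ 0 + 1 + δ 1).choose (δ 0 + 1) : ℝ) * (δ 0 + 1))) := by ring
          _ ≤ D * r⁻¹ ^ (δ.degree + 1) * (L ^ γ 1 *
              ((γ 1 + 1) * ((γ 0 + (γ 1 + 1)).choose (γ 0) : ℝ))) := by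
            refine mul_le_mul_of_nonneg_left (mul_le_mul h9 h3 (by positivity) (by positivity))
              (by positivity)
          _ = r ^ β.degree * ((γ 1 + 1) * Q) := by
            rw [h8, hQ]
            ring
      have hmain : ((γ 1 : ℝ) + 1) * |coeff (γ + Finsupp.single 1 1) (u i)| ≤
          ((γ 1 : ℝ) + 1) * (K * Q) := by
        have h2 : |(γ 1 : ℝ) + 1| = γ 1 + 1 := abs_of_nonneg (by positivity)
        rw [← h2, ← abs_mul, h2, hu1, map_sum]
        calc |∑ j, coeff γ (t i j * pderiv ℝ 0 (u j))|
            ≤ ∑ j, |coeff γ (t i j * pderiv ℝ 0 (u j))| := Finset.abs_sum_le_sum_abs _ _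
          _ ≤ ∑ j, (∑' β, |coeff β (t i j)| * r ^ β.degree) * ((γ 1 + 1) * Q) := by
            refine Finset.sum_le_sum fun j _ => ?_
            rw [coeff_mul]
            refine (Finset.abs_sum_le_sum_abs _ _).trans ((Finset.sum_le_sum (hterm j)).trans ?_)
            rw [← Finset.sum_mul]
            refine mul_le_mul_of_nonneg_right ?_ (by positivity)
            exact sum_antidiagonal_fst_le_tsum (hsum i j) (fun β => by positivity) γ
          _ ≤ K * ((γ 1 + 1) * Q) := by
            rw [← Finset.sum_mul]
            exact mul_le_mul_of_nonneg_right (hKi i) (by positivity)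
          _ = ((γ 1 : ℝ) + 1) * (K * Q) := by ring
      have h10 := le_of_mul_le_mul_left hmain (by positivity)
      refine h10.trans ?_
      have h11 : K * Q ≤ L * Q := mul_le_mul_of_nonneg_right (by linarith) hQ0
      refine h11.trans_eq ?_
      rw [hQ, pow_succ L]
      ring
  have hLpos : 1 ≤ L := by linarith
  have hconv : ∀ i, IsConv (u i) := by
    intro i
    -- Of the factor `8`, one `2` pays for the binomial coefficient and one for the number of
    -- multi-indices of degree `k`; the last leaves a geometric series.
    refine ⟨r / (8 * L), by positivity, summable_of_sum_degree (fun _ => by positivity) ?_⟩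
    have hgeo : Summable fun k : ℕ => D * (1 / 2 : ℝ) ^ k :=
      (summable_geometric_of_lt_one (by norm_num) (by norm_num)).mul_left D
    refine hgeo.of_nonneg_of_le (fun k => Finset.sum_nonneg fun _ _ => by positivity) fun k => ?_
    have hcard : (degIdx 2 k).card ≤ k + 1 := by
      refine (Finset.card_le_card_of_injOn (t := Finset.range (k + 1)) (fun α => α 0) ?_ ?_).trans_eq
        (Finset.card_range _)
      · intro α hα
        have h1 := mem_degIdx.1 hα
        rw [degree_fin_two] at h1
        simp only [Finset.coe_range, Set.mem_Iio]
        omega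
      · intro α hα β hβ h
        have h1 := mem_degIdx.1 hα
        have h2 := mem_degIdx.1 hβ
        rw [degree_fin_two] at h1 h2
        have h : α 0 = β 0 := h
        ext j
        fin_cases j
        · exact h
        · change α 1 = β 1
          omega
    have hterm : ∀ α ∈ degIdx 2 k, |coeff α (u i)| * (r / (8 * L)) ^ α.degree ≤
        D * (1 / 4) ^ k := by
      intro α hα
      have h1 := mem_degIdx.1 hα
      have h2 : ((α 0 + α 1).choose (α 0) : ℝ) ≤ 2 ^ k := by
        rw [← degree_fin_two, h1]
        exact_mod_cast Nat.choose_le_two_pow k (α 0)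
      have h3 : L ^ α 1 ≤ L ^ k := by
        rw [degree_fin_two] at h1
        exact pow_le_pow_right₀ hLpos (by omega)
      have h4 := hbound _ i α rfl
      rw [h1] at h4 ⊢
      calc |coeff α (u i)| * (r / (8 * L)) ^ k
          ≤ D * (r⁻¹ ^ k * L ^ k * 2 ^ k) * (r / (8 * L)) ^ k := by
            refine mul_le_mul_of_nonneg_right (h4.trans ?_) (by positivity)
            gcongr
        _ = D * (r⁻¹ * L * 2 * (r / (8 * L))) ^ k := by simp only [mul_pow]; ring
        _ = D * (1 / 4) ^ k := by
          congr 2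
          field_simp
          norm_num
    refine (Finset.sum_le_card_nsmul _ _ _ hterm).trans ?_
    rw [nsmul_eq_mul]
    have h5 : ((degIdx 2 k).card : ℝ) ≤ 2 ^ k := by
      exact_mod_cast hcard.trans Nat.lt_two_pow_self
    calc ((degIdx 2 k).card : ℝ) * (D * (1 / 4) ^ k) ≤ 2 ^ k * (D * (1 / 4) ^ k) :=
          mul_le_mul_of_nonneg_right h5 (by positivity)
      _ = D * (2 * (1 / 4)) ^ k := by rw [mul_pow]; ring
      _ = D * (1 / 2) ^ k := by norm_num
  have hgerm : ∀ i, HasGerm (ev (u i)) (u i) := fun i => (hconv i).hasGerm_ev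
  refine ⟨fun i => ev (u i), fun i => (hgerm i).analyticAt, fun i => ?_, fun i => ?_, ?_⟩
  · change ev (u i) 0 = 0
    rw [(hgerm i).apply_zero, hu0 i 0 rfl, if_neg]
    intro h
    simpa using DFunLike.congr_fun h 0
  · rw [((hgerm i).pderiv 0).apply_zero, coeff_pderiv, hu0 i _ (by simp)]
    simp
  · refine eventually_all.2 fun i => ((hgerm i).pderiv 1).unique ?_
    have h1 : pderiv ℝ 1 (u i) = ∑ j, t i j * pderiv ℝ 0 (u j) := by
      ext γ
      rw [coeff_pderiv, ← hu1, mul_comm]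
    rw [h1]
    exact HasGerm.sum _ fun j _ => (ht i j).mul ((hgerm j).pderiv 0)

end AnalyticNormalForm

/-! ### Analytic matrices, Jacobians and metrics as matrices -/

namespace AnalyticNormalForm
open MvPowerSeries

variable {n : ℕ}

section AnalyticMatrix

variable {A B : Coord n → Matrix (Fin n) (Fin n) ℝ}

lemma IsAnalyticMatrixGerm.sub (hA : IsAnalyticMatrixGerm A) (hB : IsAnalyticMatrixGerm B) :
    IsAnalyticMatrixGerm fun x => A x - B x := fun i j => (hA i j).fun_sub (hB i j)

lemma IsAnalyticMatrixGerm.mul (hA : IsAnalyticMatrixGerm A) (hB : IsAnalyticMatrixGerm B) :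
    IsAnalyticMatrixGerm fun x => A x * B x := fun i j => by
  simp only [Matrix.mul_apply]
  exact Finset.univ.analyticAt_fun_sum fun k _ => (hA i k).fun_mul (hB k j)

lemma IsAnalyticMatrixGerm.transpose (hA : IsAnalyticMatrixGerm A) :
    IsAnalyticMatrixGerm fun x => (A x).transpose := fun i j => hA j i

lemma IsAnalyticMatrixGerm.smul {c : Coord n → ℝ} (hc : AnalyticAt ℝ c 0)
    (hA : IsAnalyticMatrixGerm A) : IsAnalyticMatrixGerm fun x => c x • A x :=
  fun i j => hc.fun_mul (hA i j)

lemma isAnalyticMatrixGerm_const (A : Matrix (Fin n) (Fin n) ℝ) :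
    IsAnalyticMatrixGerm fun _ => A := fun _ _ => analyticAt_const

lemma IsAnalyticMatrixGerm.comp (hA : IsAnalyticMatrixGerm A) {Ψ : Coord n → Coord n}
    (hΨ : AnalyticAt ℝ Ψ 0) (h0 : Ψ 0 = 0) : IsAnalyticMatrixGerm fun x => A (Ψ x) := fun i j =>
  AnalyticAt.fun_comp (g := fun x => A x i j) (by rw [h0]; exact hA i j) hΨ

lemma IsAnalyticMatrixGerm.det (hA : IsAnalyticMatrixGerm A) :
    AnalyticAt ℝ (fun x => (A x).det) 0 := by
  simp only [Matrix.det_apply']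
  exact Finset.univ.analyticAt_fun_sum fun σ _ =>
    analyticAt_const.fun_mul (Finset.univ.analyticAt_fun_prod fun k _ => hA _ _)

lemma IsAnalyticMatrixGerm.trace (hA : IsAnalyticMatrixGerm A) :
    AnalyticAt ℝ (fun x => (A x).trace) 0 :=
  Finset.univ.analyticAt_fun_sum fun k _ => hA k k

lemma IsAnalyticMatrixGerm.inv (hA : IsAnalyticMatrixGerm A) (h : (A 0).det ≠ 0) :
    IsAnalyticMatrixGerm fun x => (A x)⁻¹ := by
  have h1 : IsAnalyticMatrixGerm fun x => (A x).adjugate := fun i j => by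
    simp only [Matrix.adjugate_apply]
    refine IsAnalyticMatrixGerm.det fun k l => ?_
    by_cases hk : k = j
    · subst hk
      simpa using! analyticAt_const
    · simpa [Matrix.updateRow_ne hk] using! hA k l
  simp only [Matrix.inv_def, Ring.inverse_eq_inv']
  exact IsAnalyticMatrixGerm.smul (hA.det.fun_inv h) h1

end AnalyticMatrix

lemma analyticAt_smul {F : Type*} [NormedAddCommGroup F] [NormedSpace ℝ F] {c : Coord n → ℝ}
    {f : Coord n → F} (hc : AnalyticAt ℝ c 0) (hf : AnalyticAt ℝ f 0) :
    AnalyticAt ℝ (fun x => c x • f x) 0 := hc.smul hf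

lemma analyticAt_clm_apply {E F : Type*} [NormedAddCommGroup E] [NormedSpace ℝ E]
    [NormedAddCommGroup F] [NormedSpace ℝ F] {L : Coord n → E →L[ℝ] F} (hL : AnalyticAt ℝ L 0)
    (v : E) : AnalyticAt ℝ (fun x => L x v) 0 :=
  AnalyticAt.fun_comp (g := fun T : E →L[ℝ] F => T v)
    ((ContinuousLinearMap.apply ℝ F v).analyticAt _) hL

lemma isAnalyticMatrixGerm_jac {Φ : Coord n → Coord n} (hΦ : AnalyticAt ℝ Φ 0) :
    IsAnalyticMatrixGerm (jac Φ) := fun i j => by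
  simp only [jac_apply]
  exact AnalyticAt.fun_comp (g := fun v : Coord n => v i)
    ((ContinuousLinearMap.proj (R := ℝ) (φ := fun _ : Fin n => ℝ) i).analyticAt _)
    (analyticAt_clm_apply hΦ.fderiv _)

lemma jac_comp {Φ Ψ : Coord n → Coord n} {x : Coord n} (hΦ : DifferentiableAt ℝ Φ (Ψ x))
    (hΨ : DifferentiableAt ℝ Ψ x) : jac (fun y => Φ (Ψ y)) x = jac Φ (Ψ x) * jac Ψ x := by
  rw [jac, jac, jac, ← LinearMap.toMatrix'_comp, fderiv_fun_comp x hΦ hΨ]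
  rfl

lemma jac_mulVec_map (B : Matrix (Fin n) (Fin n) ℝ) (x : Coord n) :
    jac (fun y => B.mulVec y) x = B := by
  have h : HasFDerivAt (fun y : Coord n => B.mulVec y)
      (LinearMap.toContinuousLinearMap B.mulVecLin) x :=
    (LinearMap.toContinuousLinearMap B.mulVecLin).hasFDerivAt
  rw [jac, h.fderiv]
  exact LinearMap.toMatrix'_toLin' B

lemma jac_congr {Φ Ψ : Coord n → Coord n} {x : Coord n} (h : Φ =ᶠ[𝓝 x] Ψ) : jac Φ x = jac Ψ x := by
  rw [jac, jac, h.fderiv_eq]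

lemma jac_id (x : Coord n) : jac (fun y : Coord n => y) x = 1 := by
  simpa using jac_mulVec_map (1 : Matrix (Fin n) (Fin n) ℝ) x

/-- The inverse function theorem. -/
lemma isLocalAnalyticDiffeo_of_det_ne_zero {Φ : Coord n → Coord n} (hΦ : AnalyticAt ℝ Φ 0)
    (h0 : Φ 0 = 0) (h : (jac Φ 0).det ≠ 0) : IsLocalAnalyticDiffeo Φ := by
  have hdet : (fderiv ℝ Φ 0).det ≠ 0 := by
    rwa [jac, LinearMap.det_toMatrix'] at h
  let f' := (fderiv ℝ Φ 0).toContinuousLinearEquivOfDetNeZero hdet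
  have hf' : HasFDerivAt Φ (f' : Coord n →L[ℝ] Coord n) 0 :=
    hΦ.differentiableAt.hasFDerivAt
  -- The exponent `⊤` means analyticity here, so the local inverse is analytic too.
  have hc : ContDiffAt ℝ ⊤ Φ 0 := hΦ.contDiffAt
  have hs := hc.hasStrictFDerivAt' hf' (by simp)
  refine ⟨hΦ, h0, hc.localInverse hf' (by simp), ?_, ?_, hs.eventually_left_inverse, ?_⟩
  · have h1 := (hc.to_localInverse hf' (by simp)).analyticAt
    rwa [h0] at h1
  · have h1 := hc.localInverse_apply_image hf' (by simp)
    rwa [h0] at h1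
  · have h1 := hs.eventually_right_inverse
    rwa [h0] at h1

/-- The bilinear form with the given matrix. -/
noncomputable def bil (A : Matrix (Fin n) (Fin n) ℝ) : Coord n →L[ℝ] Coord n →L[ℝ] ℝ :=
  ∑ i, ∑ j, A i j • (ContinuousLinearMap.proj (R := ℝ) (φ := fun _ : Fin n => ℝ) i).smulRight
    (ContinuousLinearMap.proj (R := ℝ) (φ := fun _ : Fin n => ℝ) j)

lemma bil_apply (A : Matrix (Fin n) (Fin n) ℝ) (u v : Coord n) :
    bil A u v = u ⬝ᵥ A.mulVec v := by
  simp only [bil, sum_apply, smul_apply, ContinuousLinearMap.smulRight_apply,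
    ContinuousLinearMap.proj_apply, smul_eq_mul, dotProduct, Matrix.mulVec, Finset.mul_sum]
  refine Finset.sum_congr rfl fun i _ => Finset.sum_congr rfl fun j _ => ?_
  ring

/-- The matrix of a metric. -/
noncomputable def metricMatrix (g : Coord n → Coord n →L[ℝ] Coord n →L[ℝ] ℝ) (x : Coord n) :
    Matrix (Fin n) (Fin n) ℝ :=
  Matrix.of fun i j => g x (Pi.single i 1) (Pi.single j 1)

lemma metricMatrix_apply (g : Coord n → Coord n →L[ℝ] Coord n →L[ℝ] ℝ) (x u v : Coord n) :
    g x u v = u ⬝ᵥ (metricMatrix g x).mulVec v := by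
  have h1 : ∀ w : Coord n, w = ∑ i, w i • Pi.single i (1 : ℝ) := fun w => by
    ext k
    simp [Finset.sum_apply, Pi.single_apply]
  conv_lhs => rw [h1 u, h1 v]
  simp only [map_sum, map_smul, sum_apply, smul_apply, dotProduct, Matrix.mulVec, metricMatrix,
    Matrix.of_apply, smul_eq_mul, Finset.mul_sum]
  rw [Finset.sum_comm]
  refine Finset.sum_congr rfl fun i _ => Finset.sum_congr rfl fun j _ => ?_
  ring

lemma analyticAt_bil {A : Coord n → Matrix (Fin n) (Fin n) ℝ} (hA : IsAnalyticMatrixGerm A) :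
    AnalyticAt ℝ (fun x => bil (A x)) 0 :=
  Finset.univ.analyticAt_fun_sum fun i _ => Finset.univ.analyticAt_fun_sum fun j _ =>
    analyticAt_smul (hA i j) analyticAt_const

lemma IsMetricGerm.analytic_metricMatrix {g : Coord n → Coord n →L[ℝ] Coord n →L[ℝ] ℝ}
    (hg : IsMetricGerm g) : IsAnalyticMatrixGerm (metricMatrix g) := fun _ _ =>
  analyticAt_clm_apply (analyticAt_clm_apply hg.analytic _) _

lemma IsMetricGerm.eventually_posDef {g : Coord n → Coord n →L[ℝ] Coord n →L[ℝ] ℝ}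
    (hg : IsMetricGerm g) : ∀ᶠ x in 𝓝 0, (metricMatrix g x).PosDef := by
  filter_upwards [hg.symm, hg.pos] with x h1 h2
  refine Matrix.PosDef.of_dotProduct_mulVec_pos ?_ fun v hv => ?_
  · ext i j
    exact h1 _ _
  · rw [star_trivial, ← metricMatrix_apply]
    exact h2 v hv

lemma isMetricGerm_bil {A : Coord n → Matrix (Fin n) (Fin n) ℝ} (hA : IsAnalyticMatrixGerm A)
    (h : ∀ᶠ x in 𝓝 0, (A x).PosDef) : IsMetricGerm fun x => bil (A x) where
  analytic := analyticAt_bil hA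
  symm := by
    filter_upwards [h] with x hx u v
    have h1 : (A x).transpose = A x := hx.isHermitian
    rw [bil_apply, bil_apply, Matrix.dotProduct_mulVec, ← Matrix.mulVec_transpose, h1,
      dotProduct_comm]
  pos := by
    filter_upwards [h] with x hx v hv
    rw [bil_apply]
    simpa using hx.dotProduct_mulVec_pos hv

lemma IsMetricGerm.smul {g : Coord n → Coord n →L[ℝ] Coord n →L[ℝ] ℝ} (hg : IsMetricGerm g)
    {c : Coord n → ℝ} (hc : AnalyticAt ℝ c 0) (hpos : ∀ᶠ x in 𝓝 0, 0 < c x) :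
    IsMetricGerm fun x => c x • g x where
  analytic := analyticAt_smul hc hg.analytic
  symm := by
    filter_upwards [hg.symm] with x h u v
    simp only [smul_apply, h u v]
  pos := by
    filter_upwards [hg.pos, hpos] with x h hx v hv
    simpa using mul_pos hx (h v hv)

end AnalyticNormalForm

/-! ### Transport by local diffeomorphisms; the normal form of frames -/

namespace AnalyticNormalForm
open MvPowerSeries

variable {n : ℕ}

/-- An inverse of a local diffeomorphism, with the relation between the Jacobian matrices. -/
lemma IsLocalAnalyticDiffeo.exists_inverse {Φ : Coord n → Coord n} (hΦ : IsLocalAnalyticDiffeo Φ) :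
    ∃ Ψ : Coord n → Coord n, AnalyticAt ℝ Ψ 0 ∧ Ψ 0 = 0 ∧
      (∀ᶠ x in 𝓝 0, Ψ (Φ x) = x ∧ jac Ψ (Φ x) * jac Φ x = 1) ∧
      ∀ᶠ y in 𝓝 0, Φ (Ψ y) = y ∧ jac Φ (Ψ y) * jac Ψ y = 1 := by
  obtain ⟨h1, h2, Ψ, h3, h4, h5, h6⟩ := hΦ
  have key : ∀ {f g : Coord n → Coord n}, AnalyticAt ℝ f 0 → f 0 = 0 → AnalyticAt ℝ g 0 →
      (∀ᶠ x in 𝓝 0, g (f x) = x) → ∀ᶠ x in 𝓝 0, g (f x) = x ∧ jac g (f x) * jac f x = 1 := by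
    intro f g hf h0 hg hgf
    have ht : Tendsto f (𝓝 0) (𝓝 0) := by
      simpa only [h0] using hf.continuousAt.tendsto
    filter_upwards [hgf.eventually_nhds, hf.eventually_analyticAt,
      ht.eventually hg.eventually_analyticAt] with x hx hfx hgx
    refine ⟨hx.self_of_nhds, ?_⟩
    rw [← jac_comp hgx.differentiableAt hfx.differentiableAt, jac_congr (Ψ := fun y => y) hx, jac_id]
  exact ⟨Ψ, h3, h4, key h1 h2 h3 h5, key h3 h4 h1 h6⟩

lemma IsLocalAnalyticDiffeo.comp {Φ Ψ : Coord n → Coord n} (hΦ : IsLocalAnalyticDiffeo Φ)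
    (hΨ : IsLocalAnalyticDiffeo Ψ) : IsLocalAnalyticDiffeo fun x => Φ (Ψ x) := by
  obtain ⟨h1, h2, Φ', h3, h4, h5, h6⟩ := hΦ
  obtain ⟨k1, k2, Ψ', k3, k4, k5, k6⟩ := hΨ
  have ht : Tendsto Ψ (𝓝 0) (𝓝 0) := by simpa only [k2] using k1.continuousAt.tendsto
  have ht' : Tendsto Φ' (𝓝 0) (𝓝 0) := by simpa only [h4] using h3.continuousAt.tendsto
  refine ⟨AnalyticAt.fun_comp (by rwa [k2]) k1, by simp only [k2, h2], fun y => Ψ' (Φ' y),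
    AnalyticAt.fun_comp (by rwa [h4]) h3, by simp only [h4, k4], ?_, ?_⟩
  · filter_upwards [k5, ht.eventually h5] with x hx hx'
    rw [hx', hx]
  · filter_upwards [h6, ht'.eventually k6] with x hx hx'
    rw [hx', hx]

lemma TransformsMetric.comp {Φ Ψ : Coord n → Coord n} (hΦ : AnalyticAt ℝ Φ 0)
    (hΨ : AnalyticAt ℝ Ψ 0) (h0 : Ψ 0 = 0)
    {g g' g'' : Coord n → Coord n →L[ℝ] Coord n →L[ℝ] ℝ} (h : TransformsMetric Ψ g g')
    (h' : TransformsMetric Φ g' g'') : TransformsMetric (fun x => Φ (Ψ x)) g g'' := by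
  have ht : Tendsto Ψ (𝓝 0) (𝓝 0) := by simpa only [h0] using hΨ.continuousAt.tendsto
  filter_upwards [h, ht.eventually h', hΨ.eventually_analyticAt,
    ht.eventually hΦ.eventually_analyticAt] with x h1 h2 h3 h4 u v
  rw [fderiv_fun_comp x h4.differentiableAt h3.differentiableAt]
  exact (h2 _ _).trans (h1 u v)

lemma dotProduct_mulVec_mul (A P : Matrix (Fin n) (Fin n) ℝ) (u v : Coord n) :
    (A.mulVec u) ⬝ᵥ P.mulVec (A.mulVec v) = u ⬝ᵥ (A.transpose * P * A).mulVec v := by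
  rw [Matrix.mulVec_mulVec, Matrix.dotProduct_mulVec, Matrix.vecMul_mulVec,
    ← Matrix.dotProduct_mulVec, Matrix.mul_assoc]

lemma associatedMatrix_eq_transpose (A : Coord n → Matrix (Fin n) (Fin n) ℝ) (x : Coord n) :
    associatedMatrix (fun k y i => A y i k) x = A x := rfl

lemma isFrameGerm_of_matrix {A : Coord n → Matrix (Fin n) (Fin n) ℝ} (hA : IsAnalyticMatrixGerm A)
    (h : ∀ᶠ x in 𝓝 0, IsUnit (A x)) : IsFrameGerm fun k x i => A x i k where
  analytic k := AnalyticAt.pi fun i => hA i k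
  linearIndependent := by
    filter_upwards [h] with x hx
    exact Matrix.linearIndependent_cols_of_isUnit hx

/-- A map together with a square root of the transformed inverse metric gives the transformed
metric and an orthonormal frame for a multiple of it. -/
lemma exists_metric_data {g : Coord n → Coord n →L[ℝ] Coord n →L[ℝ] ℝ} (hg : IsMetricGerm g)
    {Φ : Coord n → Coord n} (hΦ : IsLocalAnalyticDiffeo Φ)
    {T : Coord n → Matrix (Fin n) (Fin n) ℝ} {l : Coord n → ℝ} (hT : IsAnalyticMatrixGerm T)
    (h : ∀ᶠ x in 𝓝 0, (T x).transpose = T x ∧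
      l x • (T x * T x) = jac Φ x * (metricMatrix g x)⁻¹ * (jac Φ x).transpose ∧
      (T x).mulVec (Φ x) = Φ x) :
    ∃ (Ψ : Coord n → Coord n) (g' : Coord n → Coord n →L[ℝ] Coord n →L[ℝ] ℝ)
      (W : Fin n → Coord n → Coord n), AnalyticAt ℝ Ψ 0 ∧ Ψ 0 = 0 ∧
      IsMetricGerm g' ∧ TransformsMetric Φ g g' ∧
      IsOrthonormalFrame (fun y => l (Ψ y) • g' y) W ∧
      HasNormalMatrix W (fun y => T (Ψ y) - 1) := by
  obtain ⟨Ψ, hΨ, hΨ0, hΨΦ, hΦΨ⟩ := hΦ.exists_inverse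
  have ht : Tendsto Ψ (𝓝 0) (𝓝 0) := by simpa only [hΨ0] using hΨ.continuousAt.tendsto
  let P : Coord n → Matrix (Fin n) (Fin n) ℝ := fun y =>
    (jac Ψ y).transpose * metricMatrix g (Ψ y) * jac Ψ y
  have hJ := isAnalyticMatrixGerm_jac hΨ
  have hP : IsAnalyticMatrixGerm P :=
    (hJ.transpose.mul (hg.analytic_metricMatrix.comp hΨ hΨ0)).mul hJ
  have hTΨ := hT.comp hΨ hΨ0
  have hPpos : ∀ᶠ y in 𝓝 0, (P y).PosDef := by
    filter_upwards [ht.eventually hg.eventually_posDef, hΦΨ] with y h1 h2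
    have h3 : IsUnit (jac Ψ y) := .of_mul_eq_one _ (mul_eq_one_comm.1 h2.2)
    have := h1.conjTranspose_mul_mul_same (B := jac Ψ y) (Matrix.mulVec_injective_of_isUnit h3)
    exact this
  have hone : ∀ᶠ y in 𝓝 0, T (Ψ y) * (l (Ψ y) • P y) * T (Ψ y) = 1 := by
    filter_upwards [ht.eventually h, hΦΨ, ht.eventually hg.eventually_posDef] with y h1 h2 h3
    have h4 : metricMatrix g (Ψ y) * (metricMatrix g (Ψ y))⁻¹ = 1 :=
      Matrix.mul_nonsing_inv _ ((Matrix.isUnit_iff_isUnit_det _).1 h3.isUnit)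
    -- `l T²` is the transformed inverse matrix of the metric, hence inverse to the transformed
    -- matrix `P`.
    have h5 : P y * (l (Ψ y) • (T (Ψ y) * T (Ψ y))) = 1 := by
      rw [h1.2.1]
      calc P y * (jac Φ (Ψ y) * (metricMatrix g (Ψ y))⁻¹ * (jac Φ (Ψ y)).transpose)
          = (jac Ψ y).transpose * metricMatrix g (Ψ y) * (jac Ψ y * jac Φ (Ψ y)) *
            (metricMatrix g (Ψ y))⁻¹ * (jac Φ (Ψ y)).transpose := by
            simp only [P, Matrix.mul_assoc]
        _ = (jac Ψ y).transpose * (metricMatrix g (Ψ y) * (metricMatrix g (Ψ y))⁻¹) *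
            (jac Φ (Ψ y)).transpose := by
            rw [mul_eq_one_comm.1 h2.2, Matrix.mul_one, Matrix.mul_assoc (jac Ψ y).transpose]
        _ = 1 := by
            rw [h4, Matrix.mul_one, ← Matrix.transpose_mul, h2.2, Matrix.transpose_one]
    -- A one-sided inverse of a square matrix is two-sided, so one factor `T` can be moved to the
    -- left. Since `T` is symmetric, the result says that its columns are orthonormal for `l P`.
    have h6 : (l (Ψ y) • P y) * T (Ψ y) * T (Ψ y) = 1 := by
      rw [← h5, Matrix.mul_assoc, Matrix.smul_mul, Matrix.mul_smul]
    rw [Matrix.mul_assoc]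
    exact mul_eq_one_comm.1 h6
  refine ⟨Ψ, fun y => bil (P y), fun k y i => T (Ψ y) i k, hΨ, hΨ0, isMetricGerm_bil hP hPpos, ?_,
    ?_, ?_, hTΨ.sub (isAnalyticMatrixGerm_const 1), ?_, ?_⟩
  · filter_upwards [hΨΦ] with x hx u v
    rw [bil_apply, ← jac_mulVec, ← jac_mulVec, dotProduct_mulVec_mul, metricMatrix_apply g]
    have h1 : (jac Φ x).transpose * P (Φ x) * jac Φ x = (jac Ψ (Φ x) * jac Φ x).transpose *
        metricMatrix g (Ψ (Φ x)) * (jac Ψ (Φ x) * jac Φ x) := by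
      simp only [P, Matrix.transpose_mul, Matrix.mul_assoc]
    rw [h1, hx.2, hx.1, Matrix.transpose_one, Matrix.one_mul, Matrix.mul_one]
  · filter_upwards [hone, ht.eventually h] with y hy h1 i j
    have h2 : ∀ k, (fun i => T (Ψ y) i k) = (T (Ψ y)).mulVec (Pi.single k 1) := fun k => by
      simp
      rfl
    rw [h2, h2, smul_apply, smul_apply, bil_apply, ← dotProduct_smul, ← Matrix.smul_mulVec,
      dotProduct_mulVec_mul, h1.1, hy]
    simp [Matrix.one_apply]
  · exact isFrameGerm_of_matrix hTΨ (hone.mono fun y hy => .of_mul_eq_one _ (mul_eq_one_comm.1 hy))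
  · refine Eventually.of_forall fun y => ?_
    rw [associatedMatrix_eq_transpose fun y => T (Ψ y)]
    abel
  · filter_upwards [ht.eventually h, hΦΨ] with y h1 h2
    have h3 := h1.2.2
    rw [h2.1] at h3
    rw [Matrix.sub_mulVec, h3, Matrix.one_mulVec, sub_self]

lemma vanishesToOrder_one {E : Coord n → Matrix (Fin n) (Fin n) ℝ} (hE : IsAnalyticMatrixGerm E)
    (h0 : E 0 = 0) : VanishesToOrder 1 E := fun i j => by
  obtain ⟨a, ha⟩ := exists_hasGerm (hE i j)
  refine ⟨a, ha, fun α hα => ?_⟩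
  obtain rfl : α = 0 := by
    rw [← Finsupp.degree_eq_zero_iff]
    omega
  rw [← ha.apply_zero, h0]
  rfl

lemma analyticAt_mulVec (B : Matrix (Fin n) (Fin n) ℝ) (x : Coord n) :
    AnalyticAt ℝ (fun y : Coord n => B.mulVec y) x :=
  (LinearMap.toContinuousLinearMap B.mulVecLin).analyticAt x

lemma tendsto_mulVec (B : Matrix (Fin n) (Fin n) ℝ) :
    Tendsto (fun x : Coord n => B.mulVec x) (𝓝 0) (𝓝 0) := by
  simpa using (analyticAt_mulVec B 0).continuousAt.tendsto

lemma jac_comp_mulVec {Φ : Coord n → Coord n} (hΦ : AnalyticAt ℝ Φ 0)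
    (B : Matrix (Fin n) (Fin n) ℝ) :
    ∀ᶠ x in 𝓝 0, jac (fun y => Φ (B.mulVec y)) x = jac Φ (B.mulVec x) * B := by
  filter_upwards [(tendsto_mulVec B).eventually hΦ.eventually_analyticAt] with x hx
  rw [jac_comp hx.differentiableAt (analyticAt_mulVec B x).differentiableAt, jac_mulVec_map]

/-- The linear map `B = A(0)⁻¹` makes the frame matrix the identity at the origin, and
`exists_normal_map_frame` supplies the rest of the map. -/
theorem exists_normal_form_frame (V : Fin n → Coord n → Coord n) (hV : IsFrameGerm V) :
    ∃ (Φ : Coord n → Coord n) (W : Fin n → Coord n → Coord n)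
      (M : Coord n → Matrix (Fin n) (Fin n) ℝ),
      IsLocalAnalyticDiffeo Φ ∧ TransformsFrame Φ V W ∧ HasNormalMatrix W M := by
  let A : Coord n → Matrix (Fin n) (Fin n) ℝ := associatedMatrix V
  have hA : IsAnalyticMatrixGerm A := fun i k =>
    AnalyticAt.fun_comp (g := fun v : Coord n => v i)
      ((ContinuousLinearMap.proj (R := ℝ) (φ := fun _ : Fin n => ℝ) i).analyticAt _) (hV.analytic k)
  have hAu : ∀ᶠ x in 𝓝 0, IsUnit (A x) := by
    filter_upwards [hV.linearIndependent] with x hx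
    exact Matrix.linearIndependent_cols_iff_isUnit.1 hx
  have hA0 : IsUnit (A 0).det := (Matrix.isUnit_iff_isUnit_det _).1 hAu.self_of_nhds
  set B := (A 0)⁻¹ with hB
  have hBA : B * A 0 = 1 := Matrix.nonsing_inv_mul _ hA0
  have hAB : A 0 * B = 1 := Matrix.mul_nonsing_inv _ hA0
  -- In the coordinates `z = Bx` the frame matrix is `B A(A(0) z) = 1 + E(z)`.
  let E : Coord n → Matrix (Fin n) (Fin n) ℝ := fun x => B * A ((A 0).mulVec x) - 1
  have hE : IsAnalyticMatrixGerm E := ((isAnalyticMatrixGerm_const B).mul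
    (hA.comp (analyticAt_mulVec _ 0) (by simp))).sub (isAnalyticMatrixGerm_const 1)
  obtain ⟨F, hF, hF0, hFJ, hFx⟩ := exists_normal_map_frame (vanishesToOrder_one hE (by simp [E, hBA]))
  let Φ : Coord n → Coord n := fun x => F (B.mulVec x)
  have hJ := jac_comp_mulVec hF B
  have hΦ : IsLocalAnalyticDiffeo Φ := by
    refine isLocalAnalyticDiffeo_of_det_ne_zero
      (AnalyticAt.fun_comp (by simpa using hF) (analyticAt_mulVec B 0)) (by simp [Φ, hF0]) ?_
    rw [hJ.self_of_nhds, Matrix.mulVec_zero, hFJ, Matrix.one_mul]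
    exact fun h => by simpa [h] using congrArg Matrix.det hBA
  obtain ⟨Ψ, hΨ, hΨ0, hΨΦ, hΦΨ⟩ := hΦ.exists_inverse
  have ht : Tendsto Ψ (𝓝 0) (𝓝 0) := by simpa only [hΨ0] using hΨ.continuousAt.tendsto
  let C : Coord n → Matrix (Fin n) (Fin n) ℝ := fun y => jac Φ (Ψ y) * A (Ψ y)
  have hC : IsAnalyticMatrixGerm C := ((isAnalyticMatrixGerm_jac hΦ.1).mul hA).comp hΨ hΨ0
  refine ⟨Φ, fun k y i => C y i k, fun y => C y - 1, hΦ, ?_, isFrameGerm_of_matrix hC ?_,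
    hC.sub (isAnalyticMatrixGerm_const 1), Eventually.of_forall fun y => ?_, ?_⟩
  · filter_upwards [hΨΦ] with x hx k
    ext i
    simp only [C, hx.1]
    rw [← jac_mulVec]
    rfl
  · filter_upwards [ht.eventually hAu, hΦΨ] with y h1 h2
    exact (IsUnit.of_mul_eq_one _ h2.2).mul h1
  · rw [associatedMatrix_eq_transpose C]
    abel
  · filter_upwards [ht.eventually ((tendsto_mulVec B).eventually hFx), hΦΨ, ht.eventually hJ]
      with y h1 h2 h3
    have h4 : C y = jac F (B.mulVec (Ψ y)) * (1 + E (B.mulVec (Ψ y))) := by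
      simp only [C, E, Matrix.mulVec_mulVec, hAB, Matrix.one_mulVec, add_sub_cancel]
      rw [← Matrix.mul_assoc, ← h3]
    have h5 : F (B.mulVec (Ψ y)) = y := h2.1
    rw [← h4, h5] at h1
    rw [Matrix.sub_mulVec, h1, Matrix.one_mulVec, sub_self]

end AnalyticNormalForm

/-! ### The normal form of metrics, and of conformal structures for `n ≠ 2` -/

namespace AnalyticNormalForm
open MvPowerSeries

variable {n : ℕ}

/-- Induction on the degree: a coefficient of degree `d + 1` is, up to a positive factor, one of
degree `d` of a partial derivative, which again represents zero. -/
lemma HasGerm.coeff_eq_zero {a : MvPowerSeries (Fin n) ℝ} (h : HasGerm (fun _ => 0) a) : a = 0 := by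
  have key : ∀ d (a : MvPowerSeries (Fin n) ℝ), HasGerm (fun _ => 0) a →
      ∀ α : Fin n →₀ ℕ, α.degree = d → coeff α a = 0 := by
    intro d
    induction d with
    | zero =>
      intro a ha α hα
      rw [(Finsupp.degree_eq_zero_iff α).1 hα, ← ha.apply_zero]
    | succ d ih =>
      intro a ha α hα
      obtain ⟨i, hi⟩ : ∃ i, α i ≠ 0 := by
        by_contra! h
        rw [Finsupp.ext (g := 0) h, map_zero] at hα
        omega
      obtain ⟨β, rfl⟩ : ∃ β : Fin n →₀ ℕ, α = β + Finsupp.single i 1 := by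
        refine ⟨α - Finsupp.single i 1, (tsub_add_cancel_of_le ?_).symm⟩
        rw [Finsupp.single_le_iff]
        omega
      rw [map_add, Finsupp.degree_single] at hα
      have h1 := ih (MvPowerSeries.pderiv ℝ i a) (by simpa using ha.pderiv i) β (by omega)
      rw [coeff_pderiv] at h1
      exact (mul_eq_zero.1 h1).resolve_right (by positivity)
  ext α
  exact key _ a h α rfl

lemma HasGerm.series_unique {f : Coord n → ℝ} {a b : MvPowerSeries (Fin n) ℝ} (ha : HasGerm f a)
    (hb : HasGerm f b) : a = b :=
  sub_eq_zero.1 (HasGerm.coeff_eq_zero (by simpa using ha.sub hb))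

/-- A germ of symmetric matrices `M` with `M(x) x = 0` vanishes to the second order. -/
lemma vanishesToOrder_two {M : Coord n → Matrix (Fin n) (Fin n) ℝ} (hM : IsAnalyticMatrixGerm M)
    (hsym : ∀ᶠ x in 𝓝 0, (M x).transpose = M x) (h0 : ∀ᶠ x in 𝓝 0, (M x).mulVec x = 0) :
    VanishesToOrder 2 M := by
  choose a ha using fun i j => exists_hasGerm (hM i j)
  have has : ∀ i j, a i j = a j i := fun i j => (ha i j).series_unique ((ha j i).congr (by
    filter_upwards [hsym] with x hx
    rw [← hx, Matrix.transpose_apply, hx]))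
  have hr : ∀ i, rdot (a i) = 0 := fun i => by
    refine HasGerm.coeff_eq_zero (HasGerm.congr
      (HasGerm.sum Finset.univ fun j _ => (hasGerm_coord j).mul (ha i j)) ?_)
    filter_upwards [h0] with x hx
    have h1 : ∑ j, M x i j * x j = 0 := congrFun hx i
    simpa only [mul_comm] using h1
  have h1 : ∀ i k, a i k + ∑ j, X j * MvPowerSeries.pderiv ℝ k (a i j) = 0 := fun i k => by
    rw [← pderiv_rdot, hr, map_zero]
  have hc : ∀ f : Fin n → MvPowerSeries (Fin n) ℝ, coeff 0 (∑ j, X j * f j) = 0 := fun f => by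
    rw [map_sum]
    refine Finset.sum_eq_zero fun j _ => ?_
    rw [coeff_zero_eq_constantCoeff_apply, map_mul, constantCoeff_X, zero_mul]
  have ha0 : ∀ i k, coeff 0 (a i k) = 0 := fun i k => by
    have := congrArg (coeff 0) (h1 i k)
    rwa [map_add, hc, add_zero, map_zero] at this
  let t : Fin n → Fin n → Fin n → ℝ := fun k i j => coeff 0 (MvPowerSeries.pderiv ℝ k (a i j))
  have ht1 : ∀ k i j, t k i j = t k j i := fun k i j => by simp only [t, has i j]
  have ht2 : ∀ k i l, t l i k = -t k i l := fun k i l => by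
    have h2 := congrArg (MvPowerSeries.pderiv ℝ l) (h1 i k)
    rw [map_zero, map_add, map_sum] at h2
    simp only [pderiv_X_mul, Finset.sum_add_distrib] at h2
    have h3 := congrArg (coeff 0) h2
    rw [map_add, map_add, hc, map_zero, add_zero] at h3
    rw [eq_neg_iff_add_eq_zero, ← h3]
    simp [t]
  -- The first-order coefficients are symmetric in the last two indices, since `M` is, and skew in
  -- the first and third, since two derivatives of `M(x)x` vanish at the origin. Both symmetries
  -- together force them to vanish.
  have ht : ∀ k i j, t k i j = 0 := fun k i j => by
    linarith [ht2 j i k, ht1 j i k, ht2 i k j, ht1 i k j, ht2 k j i, ht1 k j i]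
  refine fun i j => ⟨a i j, ha i j, fun α hα => ?_⟩
  rcases Nat.eq_zero_or_pos α.degree with h | h
  · rw [(Finsupp.degree_eq_zero_iff α).1 h, ha0]
  · obtain ⟨k, rfl⟩ : ∃ k, α = Finsupp.single k 1 := by
      obtain ⟨k, hk⟩ : ∃ k, α k ≠ 0 := by
        by_contra! h2
        rw [Finsupp.ext (g := 0) h2, map_zero] at h
        omega
      obtain ⟨β, rfl⟩ : ∃ β : Fin n →₀ ℕ, α = β + Finsupp.single k 1 := by
        refine ⟨α - Finsupp.single k 1, (tsub_add_cancel_of_le ?_).symm⟩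
        rw [Finsupp.single_le_iff]
        omega
      rw [map_add, Finsupp.degree_single] at hα
      exact ⟨k, by rw [(Finsupp.degree_eq_zero_iff β).1 (by omega), zero_add]⟩
    have h2 := ht k i j
    simp only [t] at h2
    rw [coeff_pderiv, zero_add] at h2
    simpa using h2

lemma VanishesToOrder.add {m : ℕ} {A B : Coord n → Matrix (Fin n) (Fin n) ℝ}
    (hA : VanishesToOrder m A) (hB : VanishesToOrder m B) :
    VanishesToOrder m fun x => A x + B x := fun i j => by
  obtain ⟨a, ha, ha0⟩ := hA i j
  obtain ⟨b, hb, hb0⟩ := hB i j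
  exact ⟨a + b, ha.add hb, fun α hα => by rw [map_add, ha0 α hα, hb0 α hα, add_zero]⟩

lemma VanishesToOrder.mul {m k : ℕ} {A B : Coord n → Matrix (Fin n) (Fin n) ℝ}
    (hA : VanishesToOrder m A) (hB : VanishesToOrder k B) :
    VanishesToOrder m fun x => A x * B x := fun i j => by
  classical
  choose a ha ha0 using hA
  choose b hb _ using hB
  refine ⟨∑ l, a i l * b l j, HasGerm.sum _ fun l _ => (ha i l).mul (hb l j), fun α hα => ?_⟩
  rw [map_sum]
  refine Finset.sum_eq_zero fun l _ => ?_
  rw [coeff_mul]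
  refine Finset.sum_eq_zero fun p hp => ?_
  rw [ha0, zero_mul]
  have h1 := congrArg Finsupp.degree (Finset.HasAntidiagonal.mem_antidiagonal.1 hp)
  rw [map_add] at h1
  omega

lemma VanishesToOrder.congr {m : ℕ} {A B : Coord n → Matrix (Fin n) (Fin n) ℝ}
    (hA : VanishesToOrder m A) (h : ∀ᶠ x in 𝓝 0, A x = B x) : VanishesToOrder m B := fun i j =>
  let ⟨a, ha, ha0⟩ := hA i j
  ⟨a, ha.congr (h.mono fun _ hx => congrFun (congrFun hx i) j), ha0⟩

open scoped MatrixOrder ComplexOrder Matrix.Norms.L2Operator in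
lemma exists_transpose_mul_self {G : Matrix (Fin n) (Fin n) ℝ} (hG : G.PosDef) :
    ∃ C : Matrix (Fin n) (Fin n) ℝ, IsUnit C ∧ G = C.transpose * C :=
  let ⟨C, hC, h⟩ := CStarAlgebra.isStrictlyPositive_iff_eq_star_mul_self.1 hG.isStrictlyPositive
  ⟨C, hC, h⟩

/-- Writing the metric at the origin as `BᵗB`, the linear map `B` makes it Euclidean there; the
equation with `κ = 0` then gives the symmetric square root fixing the position vector. -/
theorem exists_normal_form_metric (g : Coord n → Coord n →L[ℝ] Coord n →L[ℝ] ℝ)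
    (hg : IsMetricGerm g) :
    ∃ (Φ : Coord n → Coord n) (g' : Coord n → Coord n →L[ℝ] Coord n →L[ℝ] ℝ)
      (W : Fin n → Coord n → Coord n) (M : Coord n → Matrix (Fin n) (Fin n) ℝ),
      IsLocalAnalyticDiffeo Φ ∧ IsMetricGerm g' ∧ TransformsMetric Φ g g' ∧
      IsOrthonormalFrame g' W ∧ HasNormalMatrix W M ∧
      (∀ᶠ x in 𝓝 0, (M x).transpose = M x) := by
  obtain ⟨B, hBu, hB⟩ := exists_transpose_mul_self hg.eventually_posDef.self_of_nhds
  have hBd : IsUnit B.det := (Matrix.isUnit_iff_isUnit_det _).1 hBu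
  have hBB : B⁻¹ * B = 1 := Matrix.nonsing_inv_mul _ hBd
  have hBB' : B * B⁻¹ = 1 := Matrix.mul_nonsing_inv _ hBd
  let H : Coord n → Matrix (Fin n) (Fin n) ℝ := fun x => (metricMatrix g x)⁻¹
  have hH : IsAnalyticMatrixGerm H := hg.analytic_metricMatrix.inv
    hg.eventually_posDef.self_of_nhds.det_pos.ne'
  have hHs : ∀ᶠ x in 𝓝 0, (H x).transpose = H x := by
    filter_upwards [hg.eventually_posDef] with x hx
    exact hx.inv.isHermitian
  -- The inverse matrix of the metric in the coordinates `Bx` is `1 + E`.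
  let E : Coord n → Matrix (Fin n) (Fin n) ℝ := fun x =>
    B * H (B⁻¹.mulVec x) * B.transpose - 1
  have hE : IsAnalyticMatrixGerm E := (((isAnalyticMatrixGerm_const B).mul
    (hH.comp (analyticAt_mulVec _ 0) (by simp))).mul
      (isAnalyticMatrixGerm_const _)).sub (isAnalyticMatrixGerm_const 1)
  have hE0 : E 0 = 0 := by
    simp only [E, H, Matrix.mulVec_zero, hB, Matrix.mul_inv_rev]
    rw [← Matrix.mul_assoc, hBB', Matrix.one_mul, ← Matrix.transpose_nonsing_inv,
      ← Matrix.transpose_mul, hBB', Matrix.transpose_one, sub_self]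
  obtain ⟨F, S, hF, hF0, hFJ, hS, -, h⟩ := exists_normal_map_sym (m := 2) (κ := 0) le_rfl
    PSeries.solvable_symOp_zero (vanishesToOrder_one hE hE0) (by
      filter_upwards [(tendsto_mulVec B⁻¹).eventually hHs] with x hx
      simp only [E, Matrix.transpose_sub, Matrix.transpose_mul, Matrix.transpose_transpose, hx,
        Matrix.transpose_one, Matrix.mul_assoc])
  have hJ := jac_comp_mulVec hF B
  have hΦ : IsLocalAnalyticDiffeo fun x => F (B.mulVec x) := by
    refine isLocalAnalyticDiffeo_of_det_ne_zero
      (AnalyticAt.fun_comp (by simpa using hF) (analyticAt_mulVec B 0)) (by simp [hF0]) ?_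
    rw [hJ.self_of_nhds, Matrix.mulVec_zero, hFJ, Matrix.one_mul]
    exact hBd.ne_zero
  have hd := exists_metric_data hg hΦ (T := fun x => S (B.mulVec x)) (l := fun _ => 1)
    (hS.comp (analyticAt_mulVec B 0) (by simp)) (by
      filter_upwards [hJ, (tendsto_mulVec B).eventually h] with x h1 h2
      refine ⟨h2.1, ?_, ?_⟩
      · have h3 : 1 + E (B.mulVec x) = B * H x * B.transpose := by
          simp only [E, Matrix.mulVec_mulVec, hBB, Matrix.one_mulVec, add_sub_cancel]
        rw [one_smul, h2.2.1, h3, h1, Matrix.transpose_mul]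
        simp only [H, Matrix.mul_assoc]
      · have h3 := h2.2.2
        rwa [zero_mul, zero_smul, Matrix.sub_mulVec, Matrix.one_mulVec, sub_eq_zero] at h3)
  obtain ⟨Ψ, g', W, hΨ, hΨ0, hg', hT, hW, hM⟩ := hd
  have ht : Tendsto Ψ (𝓝 0) (𝓝 0) := by simpa only [hΨ0] using hΨ.continuousAt.tendsto
  refine ⟨_, g', W, _, hΦ, hg', hT, by simpa only [one_smul] using hW, hM, ?_⟩
  filter_upwards [ht.eventually ((tendsto_mulVec B).eventually h)] with y hy
  rw [Matrix.transpose_sub, Matrix.transpose_one, hy.1]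

/-- The normal form of a conformal structure. -/
def HasConformalNormalForm (g : Coord n → Coord n →L[ℝ] Coord n →L[ℝ] ℝ) : Prop :=
  ∃ (Φ : Coord n → Coord n) (g' g'' : Coord n → Coord n →L[ℝ] Coord n →L[ℝ] ℝ)
    (W : Fin n → Coord n → Coord n) (M : Coord n → Matrix (Fin n) (Fin n) ℝ),
    IsLocalAnalyticDiffeo Φ ∧ IsMetricGerm g' ∧ TransformsMetric Φ g g' ∧ IsMetricGerm g'' ∧
    ConformallyEquivalent g' g'' ∧ IsOrthonormalFrame g'' W ∧ HasNormalMatrix W M ∧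
    (∀ᶠ x in 𝓝 0, (M x).transpose = M x) ∧ (∀ᶠ x in 𝓝 0, (M x).trace = 0)

lemma HasConformalNormalForm.of_transforms {Φ : Coord n → Coord n} (hΦ : IsLocalAnalyticDiffeo Φ)
    {g g' : Coord n → Coord n →L[ℝ] Coord n →L[ℝ] ℝ} (h : TransformsMetric Φ g g')
    (hg' : HasConformalNormalForm g') : HasConformalNormalForm g := by
  obtain ⟨F, g₁, g₂, W, M, hF, h1, h2, h3⟩ := hg'
  exact ⟨_, g₁, g₂, W, M, hF.comp hΦ, h1, h.comp hF.1 hΦ.1 hΦ.2.1 h2, h3⟩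

lemma hasConformalNormalForm_of_data {g : Coord n → Coord n →L[ℝ] Coord n →L[ℝ] ℝ}
    (hg : IsMetricGerm g) {Φ : Coord n → Coord n} (hΦ : IsLocalAnalyticDiffeo Φ)
    {T : Coord n → Matrix (Fin n) (Fin n) ℝ} {l : Coord n → ℝ} (hT : IsAnalyticMatrixGerm T)
    (hl : AnalyticAt ℝ l 0) (hpos : ∀ᶠ x in 𝓝 0, 0 < l x)
    (h : ∀ᶠ x in 𝓝 0, (T x).transpose = T x ∧
      l x • (T x * T x) = jac Φ x * (metricMatrix g x)⁻¹ * (jac Φ x).transpose ∧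
      (T x).mulVec (Φ x) = Φ x) (htr : ∀ᶠ x in 𝓝 0, (T x - 1).trace = 0) :
    HasConformalNormalForm g := by
  obtain ⟨Ψ, g', W, hΨ, hΨ0, hg', hTr, hW, hM⟩ := exists_metric_data hg hΦ hT h
  have ht : Tendsto Ψ (𝓝 0) (𝓝 0) := by simpa only [hΨ0] using hΨ.continuousAt.tendsto
  have hlΨ : AnalyticAt ℝ (fun y => l (Ψ y)) 0 := AnalyticAt.fun_comp (by rwa [hΨ0]) hΨ
  have hlpos : ∀ᶠ y in 𝓝 0, 0 < l (Ψ y) := ht.eventually hpos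
  refine ⟨Φ, g', _, W, _, hΦ, hg', hTr, hg'.smul hlΨ hlpos,
    ⟨_, hlΨ, hlpos, Eventually.of_forall fun y => rfl⟩, hW, hM, ?_, ht.eventually htr⟩
  filter_upwards [ht.eventually h] with y hy
  rw [Matrix.transpose_sub, Matrix.transpose_one, hy.1]

/-- A metric with an orthonormal frame whose matrix `A` is symmetric has the inverse `A * A`. -/
lemma metricMatrix_inv_eq {g : Coord n → Coord n →L[ℝ] Coord n →L[ℝ] ℝ}
    {W : Fin n → Coord n → Coord n} {A : Matrix (Fin n) (Fin n) ℝ} {x : Coord n}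
    (hW : ∀ i j, g x (W i x) (W j x) = if i = j then 1 else 0) (hA : associatedMatrix W x = A)
    (hs : A.transpose = A) : (metricMatrix g x)⁻¹ = A * A := by
  have h1 : A.transpose * metricMatrix g x * A = 1 := by
    ext i j
    have h2 : ∀ k, W k x = A.mulVec (Pi.single k 1) := fun k => by
      rw [← hA, Matrix.mulVec_single_one]
      rfl
    have h3 := hW i j
    rw [metricMatrix_apply, h2, h2, dotProduct_mulVec_mul] at h3
    simpa [Matrix.one_apply] using h3
  refine Matrix.inv_eq_right_inv ?_
  rw [hs, Matrix.mul_assoc] at h1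
  rw [← Matrix.mul_assoc]
  exact mul_eq_one_comm.1 h1

/-- The trace-free equation is solvable only from degree three on, so the error must vanish to order
two. The Riemannian normal form ensures this: the inverse matrix is `(1 + M)²`, and `M` vanishes to
order two. -/
lemma hasConformalNormalForm_of_three_le (hn : 3 ≤ n)
    {g : Coord n → Coord n →L[ℝ] Coord n →L[ℝ] ℝ} (hg : IsMetricGerm g) :
    HasConformalNormalForm g := by
  obtain ⟨Φ, g', W, M, hΦ, hg', hT, hW, hM, hMs⟩ := exists_normal_form_metric g hg
  refine HasConformalNormalForm.of_transforms hΦ hT ?_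
  have hM2 := vanishesToOrder_two hM.analytic hMs hM.mulVec_eq
  have hE : VanishesToOrder 2 fun x => (metricMatrix g' x)⁻¹ - 1 := by
    refine ((hM2.add hM2).add (hM2.mul hM2)).congr ?_
    filter_upwards [hMs, hW, hM.matrix_eq] with x h1 h2 h3
    rw [metricMatrix_inv_eq h2 h3 (by rw [Matrix.transpose_add, Matrix.transpose_one, h1])]
    noncomm_ring
  obtain ⟨F, S, hF, hF0, hFJ, hS, hS0, h⟩ := exists_normal_map_sym (m := 3) (by norm_num)
    (PSeries.solvable_symOp_inv hn) hE (by
      filter_upwards [hg'.eventually_posDef] with x hx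
      rw [Matrix.transpose_sub, Matrix.transpose_one]
      congr 1
      exact hx.inv.isHermitian)
  have hn0 : (n : ℝ) ≠ 0 := by
    have : n ≠ 0 := by omega
    exact_mod_cast this
  -- For `κ = 1/n` the position vector is an eigenvector of `S` with eigenvalue `c`, the mean of the
  -- diagonal. Division by `c` therefore produces eigenvalue `1` and trace `n` at once, and the
  -- metric is multiplied by `c²`.
  let c : Coord n → ℝ := fun x => (n : ℝ)⁻¹ * (S x).trace
  have hc : AnalyticAt ℝ c 0 := analyticAt_const.fun_mul hS.trace
  have hc0 : c 0 = 1 := by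
    simp only [c, hS0, Matrix.trace_one, Fintype.card_fin]
    exact inv_mul_cancel₀ hn0
  have hcpos : ∀ᶠ x in 𝓝 0, 0 < c x := hc.continuousAt.eventually_const_lt (by rw [hc0]; norm_num)
  refine hasConformalNormalForm_of_data hg'
    (isLocalAnalyticDiffeo_of_det_ne_zero hF hF0 (by rw [hFJ, Matrix.det_one]; norm_num))
    (T := fun x => (c x)⁻¹ • S x) (l := fun x => c x ^ 2)
    (IsAnalyticMatrixGerm.smul (hc.fun_inv (by rw [hc0]; norm_num)) hS) (hc.fun_pow 2)
    (hcpos.mono fun x hx => by positivity) ?_ ?_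
  · filter_upwards [h, hcpos] with x h1 h2
    refine ⟨by rw [Matrix.transpose_smul, h1.1], ?_, ?_⟩
    · have h3 := h1.2.1
      rw [add_sub_cancel] at h3
      rw [← h3, Matrix.smul_mul, Matrix.mul_smul, smul_smul, smul_smul]
      have h4 : c x ^ 2 * ((c x)⁻¹ * (c x)⁻¹) = 1 := by field_simp
      rw [← mul_assoc] at h4
      rw [h4, one_smul]
    · have h3 := h1.2.2
      rw [Matrix.sub_mulVec, Matrix.one_mulVec, sub_eq_iff_eq_add] at h3
      have h4 : (S x).mulVec (F x) = c x • F x := by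
        rw [h3, Matrix.trace_sub, Matrix.trace_one, Fintype.card_fin, mul_sub,
          inv_mul_cancel₀ hn0, sub_smul, one_smul, sub_add_cancel]
      rw [Matrix.smul_mulVec, h4, smul_smul, inv_mul_cancel₀ h2.ne', one_smul]
  · filter_upwards [hcpos] with x h2
    rw [Matrix.trace_sub, Matrix.trace_smul, Matrix.trace_one, Fintype.card_fin]
    have h3 : (S x).trace = n * c x := by
      simp only [c]
      field_simp
    rw [h3, smul_eq_mul]
    field_simp
    ring

/-- In dimension one `M(x)x = 0` forces `M = 0` off the origin, and at the origin `M` vanishes by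
`vanishesToOrder_two`. So the Riemannian normal form is already trace-free. -/
lemma hasConformalNormalForm_of_le_one (hn : n ≤ 1)
    {g : Coord n → Coord n →L[ℝ] Coord n →L[ℝ] ℝ} (hg : IsMetricGerm g) :
    HasConformalNormalForm g := by
  obtain ⟨Φ, g', W, M, hΦ, hg', hT, hW, hM, hMs⟩ := exists_normal_form_metric g hg
  refine ⟨Φ, g', g', W, M, hΦ, hg', hT, hg', ⟨fun _ => 1, analyticAt_const,
    Eventually.of_forall fun _ => one_pos, Eventually.of_forall fun x => (one_smul ℝ _).symm⟩, hW,
    hM, hMs, ?_⟩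
  have hM2 := vanishesToOrder_two hM.analytic hMs hM.mulVec_eq
  filter_upwards [hM.mulVec_eq] with x hx
  refine Finset.sum_eq_zero fun i _ => ?_
  have hsub : ∀ j : Fin n, j = i := fun j => Fin.ext (by omega)
  have h1 : M x i i * x i = 0 := by
    have h2 := congrFun hx i
    rwa [Matrix.mulVec, dotProduct, Finset.sum_eq_single i (fun j _ hj => absurd (hsub j) hj)
      (fun h => absurd (Finset.mem_univ i) h)] at h2
  rcases mul_eq_zero.1 h1 with h2 | h2
  · exact h2
  · have hx0 : x = 0 := funext fun j => by rw [hsub j, h2]; rfl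
    obtain ⟨a, ha, ha0⟩ := hM2 i i
    rw [hx0, Matrix.diag_apply, ha.apply_zero]
    exact ha0 0 (by simp)

end AnalyticNormalForm

/-! ### Conformal structures in dimension two, and the conclusion -/

namespace AnalyticNormalForm
open MvPowerSeries

/-- Existence of isothermal coordinates. -/
lemma hasConformalNormalForm_two {g : Coord 2 → Coord 2 →L[ℝ] Coord 2 →L[ℝ] ℝ}
    (hg : IsMetricGerm g) : HasConformalNormalForm g := by
  let H : Coord 2 → Matrix (Fin 2) (Fin 2) ℝ := fun x => (metricMatrix g x)⁻¹
  have hH : IsAnalyticMatrixGerm H := hg.analytic_metricMatrix.inv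
    hg.eventually_posDef.self_of_nhds.det_pos.ne'
  have hHpos : ∀ᶠ x in 𝓝 0, (H x).PosDef := hg.eventually_posDef.mono fun x hx => hx.inv
  have hG0 : 0 < H 0 1 1 := hHpos.self_of_nhds.diag_pos
  have hD0 : 0 < (H 0).det := hHpos.self_of_nhds.det_pos
  -- The numbers `α ± iβ` are the roots `z` of the quadratic form of `H` at the covector `(1, z)`.
  -- With `w = φ₀ + iφ₁` the system below is the Beltrami equation `∂₁w = (α + iβ)∂₀w`, which makes
  -- `dw` isotropic, that is, the two gradients orthogonal and equally long.
  let α : Coord 2 → ℝ := fun x => -H x 0 1 * (H x 1 1)⁻¹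
  let β : Coord 2 → ℝ := fun x => √((H x).det) * (H x 1 1)⁻¹
  have hinv : AnalyticAt ℝ (fun x => (H x 1 1)⁻¹) 0 := (hH 1 1).fun_inv hG0.ne'
  have hα : AnalyticAt ℝ α 0 := (hH 0 1).fun_neg.fun_mul hinv
  have hβ : AnalyticAt ℝ β 0 :=
    (ContDiffAt.sqrt hH.det.contDiffAt hD0.ne').analyticAt.fun_mul hinv
  have hβ0 : 0 < β 0 := mul_pos (Real.sqrt_pos.2 hD0) (inv_pos.2 hG0)
  obtain ⟨φ, hφ, hφ0, hφx, hφy⟩ := exists_linear_system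
    (T := fun i j x => if i = 0 then (if j = 0 then α x else -β x) else
      (if j = 0 then β x else α x))
    (fun i j => by fin_cases i <;> fin_cases j <;> simp [hα, hβ, hβ.fun_neg])
    (fun i => if i = 0 then 1 else 0)
  let Φ : Coord 2 → Coord 2 := fun x i => φ i x
  have hΦ : AnalyticAt ℝ Φ 0 := AnalyticAt.pi hφ
  have hjac : ∀ᶠ x in 𝓝 0, ∀ i j, jac Φ x i j = fderiv ℝ (φ i) x (Pi.single j 1) := by
    filter_upwards [hΦ.eventually_analyticAt] with x hx i j
    rw [jac_apply, fderiv_apply hx.differentiableAt]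
    rfl
  have hJ : ∀ᶠ x in 𝓝 0, jac Φ x 0 1 = α x * jac Φ x 0 0 - β x * jac Φ x 1 0 ∧
      jac Φ x 1 1 = β x * jac Φ x 0 0 + α x * jac Φ x 1 0 := by
    filter_upwards [hφy, hjac] with x h1 h2
    have h3 := h1 0
    have h4 := h1 1
    simp only [Fin.sum_univ_two, if_true, one_ne_zero, if_false, ← h2] at h3 h4
    exact ⟨by rw [h3]; ring, by rw [h4]⟩
  have h00 : jac Φ 0 0 0 = 1 := by rw [hjac.self_of_nhds, hφx, if_pos rfl]
  have h10 : jac Φ 0 1 0 = 0 := by rw [hjac.self_of_nhds, hφx, if_neg (by norm_num)]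
  have hdiffeo : IsLocalAnalyticDiffeo Φ := by
    refine isLocalAnalyticDiffeo_of_det_ne_zero hΦ (funext hφ0) ?_
    rw [Matrix.det_fin_two, hJ.self_of_nhds.2, h00, h10]
    simpa using hβ0.ne'
  have hJa := isAnalyticMatrixGerm_jac hΦ
  -- The common squared length of the two gradients. The rescaled metric is flat, with the
  -- coordinate frame, so `T = 1`.
  let l : Coord 2 → ℝ := fun x => H x 1 1 * β x ^ 2 * (jac Φ x 0 0 ^ 2 + jac Φ x 1 0 ^ 2)
  have hl : AnalyticAt ℝ l 0 := ((hH 1 1).fun_mul (hβ.fun_pow 2)).fun_mul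
    (((hJa 0 0).fun_pow 2).fun_add ((hJa 1 0).fun_pow 2))
  have hl0 : 0 < l 0 := by
    simp only [l, h00, h10]
    positivity
  refine hasConformalNormalForm_of_data hg hdiffeo (T := fun _ => 1) (isAnalyticMatrixGerm_const 1)
    hl (hl.continuousAt.eventually_const_lt hl0) ?_ (Eventually.of_forall fun x => by simp)
  filter_upwards [hJ, hHpos] with x h1 h2
  refine ⟨Matrix.transpose_one, ?_, Matrix.one_mulVec _⟩
  have hG : 0 < H x 1 1 := h2.diag_pos
  have hs : H x 1 0 = H x 0 1 := congrFun (congrFun h2.isHermitian 0) 1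
  have hF : H x 0 1 = -(H x 1 1 * α x) := by
    simp only [α]
    field_simp
  have hE : H x 0 0 = H x 1 1 * (α x ^ 2 + β x ^ 2) := by
    have hd : (H x).det = H x 0 0 * H x 1 1 - H x 0 1 ^ 2 := by
      rw [Matrix.det_fin_two, hs]
      ring
    have h3 : β x ^ 2 = (H x 0 0 * H x 1 1 - H x 0 1 ^ 2) * (H x 1 1)⁻¹ ^ 2 := by
      simp only [β]
      rw [mul_pow, Real.sq_sqrt h2.det_pos.le, hd]
    rw [h3]
    simp only [α]
    field_simp
    ring
  change l x • ((1 : Matrix (Fin 2) (Fin 2) ℝ) * 1) = jac Φ x * H x * (jac Φ x).transpose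
  ext i j
  simp only [Matrix.smul_apply, Matrix.mul_apply, Matrix.transpose_apply, Fin.sum_univ_two,
    smul_eq_mul, l]
  fin_cases i <;> fin_cases j <;>
    simp only [Fin.zero_eta, Fin.mk_one, Fin.isValue, Matrix.one_apply, h1.1,
      h1.2, hs, hE, hF, one_ne_zero, zero_ne_one, if_true, if_false] <;>
    ring

lemma IsMetricGerm.hasConformalNormalForm {n : ℕ} {g : Coord n → Coord n →L[ℝ] Coord n →L[ℝ] ℝ}
    (hg : IsMetricGerm g) : HasConformalNormalForm g := by
  rcases le_or_gt n 1 with h | h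
  · exact hasConformalNormalForm_of_le_one h hg
  · rcases Nat.lt_or_ge 2 n with h' | h'
    · exact hasConformalNormalForm_of_three_le h' hg
    · obtain rfl : n = 2 := by omega
      exact hasConformalNormalForm_two hg

end AnalyticNormalForm

theorem theoremA2 (n : ℕ) :
    (∀ V : Fin n → AnalyticNormalForm.Coord n → AnalyticNormalForm.Coord n,
      AnalyticNormalForm.IsFrameGerm V →
      ∃ (Φ : AnalyticNormalForm.Coord n → AnalyticNormalForm.Coord n)
        (W : Fin n → AnalyticNormalForm.Coord n → AnalyticNormalForm.Coord n)
        (M : AnalyticNormalForm.Coord n → Matrix (Fin n) (Fin n) ℝ),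
        AnalyticNormalForm.IsLocalAnalyticDiffeo Φ ∧
        AnalyticNormalForm.TransformsFrame Φ V W ∧
        AnalyticNormalForm.HasNormalMatrix W M) ∧
    (∀ g : AnalyticNormalForm.Coord n →
        AnalyticNormalForm.Coord n →L[ℝ] AnalyticNormalForm.Coord n →L[ℝ] ℝ,
      AnalyticNormalForm.IsMetricGerm g →
      ∃ (Φ : AnalyticNormalForm.Coord n → AnalyticNormalForm.Coord n)
        (g' : AnalyticNormalForm.Coord n →
          AnalyticNormalForm.Coord n →L[ℝ] AnalyticNormalForm.Coord n →L[ℝ] ℝ)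
        (W : Fin n → AnalyticNormalForm.Coord n → AnalyticNormalForm.Coord n)
        (M : AnalyticNormalForm.Coord n → Matrix (Fin n) (Fin n) ℝ),
        AnalyticNormalForm.IsLocalAnalyticDiffeo Φ ∧
        AnalyticNormalForm.IsMetricGerm g' ∧
        AnalyticNormalForm.TransformsMetric Φ g g' ∧
        AnalyticNormalForm.IsOrthonormalFrame g' W ∧
        AnalyticNormalForm.HasNormalMatrix W M ∧
        (∀ᶠ x in 𝓝 0, (M x).transpose = M x)) ∧
    (∀ g : AnalyticNormalForm.Coord n →
        AnalyticNormalForm.Coord n →L[ℝ] AnalyticNormalForm.Coord n →L[ℝ] ℝ,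
      AnalyticNormalForm.IsMetricGerm g →
      ∃ (Φ : AnalyticNormalForm.Coord n → AnalyticNormalForm.Coord n)
        (g' g'' : AnalyticNormalForm.Coord n →
          AnalyticNormalForm.Coord n →L[ℝ] AnalyticNormalForm.Coord n →L[ℝ] ℝ)
        (W : Fin n → AnalyticNormalForm.Coord n → AnalyticNormalForm.Coord n)
        (M : AnalyticNormalForm.Coord n → Matrix (Fin n) (Fin n) ℝ),
        AnalyticNormalForm.IsLocalAnalyticDiffeo Φ ∧
        AnalyticNormalForm.IsMetricGerm g' ∧
        AnalyticNormalForm.TransformsMetric Φ g g' ∧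
        AnalyticNormalForm.IsMetricGerm g'' ∧
        AnalyticNormalForm.ConformallyEquivalent g' g'' ∧
        AnalyticNormalForm.IsOrthonormalFrame g'' W ∧
        AnalyticNormalForm.HasNormalMatrix W M ∧
        (∀ᶠ x in 𝓝 0, (M x).transpose = M x) ∧
        (∀ᶠ x in 𝓝 0, (M x).trace = 0)) := by
  exact ⟨AnalyticNormalForm.exists_normal_form_frame, AnalyticNormalForm.exists_normal_form_metric,
    fun _ hg => hg.hasConformalNormalForm⟩
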